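/- Let $d\in\{2,3\}$, $\mu>0$, and consider on $\mathbb R^d$ the incompressible viscoelastic system $$u_t+u\cdot\nabla u-\mu\Delta u+\nabla p=\nabla\cdot E+\nabla\cdot(EE^T),\qquad \nabla\cdot u=0,\qquad E_t+u\cdot\nabla E=\nabla u+\nabla u\,E, \tag{1}$$ with $u(0)=u_0$, $E(0)=E_0$, where $(\nabla u)_{ij}=\partial_j u_i$, $(\nabla\cdot A)_i=\sum_k\partial_kA_{ik}$, $(a\otimes b)_{ij}=a_ib_j$, $A:B=\sum_{i,j}A_{ij}B_{ij}$, and $E_j$ denotes the $j$-th column of $E$. Let $k\ge 3$ be an integer and let $u_0,E_0\in H^k(\mathbb R^d)$ satisfy (A1) $\det(E_0+I)=1$ and $\nabla\cdot u_0=0$; (A2) $\nabla\cdot E_0^T=0$; (A3) $\partial_mE_{0ij}-\partial_jE_{0im}=\sum_l\big(E_{0lj}\partial_lE_{0im}-E_{0lm}\partial_lE_{0ij}\big)$ for all $i,j,m$. *Weak solutions.* $(\hat u,\hat E)$ is a finite energy weak solution in $(0,T)\times\mathbb R^d$, $0<T<\infty$, with data $(u_0,E_0)$ if $\hat u,\hat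 E\in L^\infty(0,T;L^2)$, $\nabla\hat u\in L^2(0,T;L^2)$, $\hat u(t),\hat E(t)\in L^2$ for every $t\in[0,T]$, $\nabla\cdot\hat u(t)=0$ in the sense of distributions for a.e. $t$, and, for all vector fields $v,w\in C^1([0,T];\mathcal D(\mathbb R^d))$ with $\nabla\cdot v=0$, all $j$ and all $t\in[0,T]$, $$\int\hat u(t)\cdot v(t)\,dx-\int u_0\cdot v(0)\,dx=\int_0^t\!\!\int\big[\hat u\cdot v_t+(\hat u\otimes\hat u-\hat E\hat E^T-\hat E):\nabla v\big]\,dx\,d\tau-\mu\int_0^t\!\!\int\nabla\hat u:\nabla v\,dx\,d\tau,$$ $$\int\hat E_j(t)\cdot w(t)\,dx-\int E_{0j}\cdot w(0)\,dx=\int_0^t\!\!\int\big[\hat E_j\cdot w_t+(\hat E_j\otimes\hat u-\hat u\otimes\hat E_j):\nabla w-\hat u\cdot\partial_jw\big]\,dx\,d\tau,$$ and, for a.e. $t\in(0,T)$, $$\tfrac12\big(\|\hat u(t)\|_{L^2}^2+\|\hat E(t)\|_{L^2}^2\big)+\mu\int_0^t\|\nabla\hat u\|_{L^2}^2\,d\tau\le\tfrac12\big(\|u_0\|_{L^2}^2+\|E_0\|_{L^2}^2\big).$$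 *Strong solutions.* $(u,E)$ is a strong solution on $[0,S]$, $0<S<\infty$, with data $(u_0,E_0)$ if $u\in L^\infty(0,S;H^k)\cap L^2(0,S;H^{k+1})$, $E\in L^\infty(0,S;H^k)$, there are $u_t,E_t\in L^2(0,S;L^2)$ with $u(t)=u_0+\int_0^tu_t\,ds$ and $E(t)=E_0+\int_0^tE_t\,ds$ for every $t\in[0,S]$ (almost everywhere in $\mathbb R^d$), and (1) holds almost everywhere in $(0,S)\times\mathbb R^d$ for some pressure $p$ with locally integrable weak gradient. **Theorem (weak-strong uniqueness).** Let $(\hat u,\hat E)$ be a finite energy weak solution in $(0,T)\times\mathbb R^d$ and $(u,E)$ a strong solution on $[0,S]$, with the same data $(u_0,E_0)$ as above. Then $\hat u\equiv u$ and $\hat E\equiv E$ on the common time interval of existence: with $T_0=\min(T,S)$, $\hat u(t)=u(t)$ a.e. in $\mathbb R^d$ for a.e. $t\in(0,T_0)$, and also for every $t\in[0,T_0]$ at which $\nabla\cdot\hat u(t)=0$ in the sense of distributions; and $\hat E(t)=E(t)$ a.e. in $\mathbb R^d$ for every $t\in[0,T_0]$. -/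

import Mathlib

open MeasureTheory Set
open scoped ContDiff ENNReal

namespace Viscoelastic

/-- The physical space, `ℝᵈ` with its Euclidean norm and Lebesgue measure. -/
abbrev Space (d : ℕ) : Type := EuclideanSpace ℝ (Fin d)

variable {d : ℕ}

/-- The classical partial derivative `∂ᵢ f`. -/
noncomputable def partialD (i : Fin d) (f : Space d → ℝ) (x : Space d) : ℝ :=
  fderiv ℝ f x (EuclideanSpace.single i 1)

/-- `g` is the weak partial derivative `∂ᵢ f` on `ℝᵈ`: both functions are locally integrable and
`∫ f ∂ᵢφ = - ∫ g φ` for all `φ ∈ C_c^∞(ℝᵈ)`. -/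
structure HasWeakPartial (i : Fin d) (f g : Space d → ℝ) : Prop where
  locallyIntegrable : LocallyIntegrable f volume
  locallyIntegrable_deriv : LocallyIntegrable g volume
  integral_eq : ∀ φ : Space d → ℝ, ContDiff ℝ ∞ φ → HasCompactSupport φ →
    ∫ x, f x * partialD i φ x = - ∫ x, g x * φ x

open Classical in
/-- The weak partial derivative `∂ᵢ f`, which is unique up to a null set
(and the function `0` if `f` has no weak partial derivative). -/
noncomputable def weakPartial (i : Fin d) (f : Space d → ℝ) : Space d → ℝ :=
  if h : ∃ g, HasWeakPartial i f g then h.choose else 0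

/-- `f ∈ H^m(ℝᵈ) = W^{m,2}(ℝᵈ)`: all weak derivatives of order at most `m` exist and are in
`L²(ℝᵈ)`. -/
def MemH : ℕ → (Space d → ℝ) → Prop
  | 0, f => MemLp f 2 volume
  | m + 1, f => MemLp f 2 volume ∧ ∀ i, ∃ g, HasWeakPartial i f g ∧ MemH m g

/-- `f ∈ L^q(0,T; H^m(ℝᵈ))`, where `f t x` is a function of time and space: all weak spatial
derivatives of order at most `m` exist for almost every time, are measurable on `(0,T) × ℝᵈ`,
and their `L²(ℝᵈ)` norms are in `L^q(0,T)`. -/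
def MemLqH (q : ℝ≥0∞) (T : ℝ) : ℕ → (ℝ → Space d → ℝ) → Prop
  | 0, f =>
      AEStronglyMeasurable (Function.uncurry f) ((volume.restrict (Ioo 0 T)).prod volume) ∧
      eLpNorm (fun t => eLpNorm (f t) 2 volume) q (volume.restrict (Ioo 0 T)) < ⊤
  | m + 1, f =>
      (AEStronglyMeasurable (Function.uncurry f) ((volume.restrict (Ioo 0 T)).prod volume) ∧
      eLpNorm (fun t => eLpNorm (f t) 2 volume) q (volume.restrict (Ioo 0 T)) < ⊤) ∧
      ∀ i, ∃ g : ℝ → Space d → ℝ,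
        (∀ᵐ t ∂(volume.restrict (Ioo 0 T)), HasWeakPartial i (f t) (g t)) ∧ MemLqH q T m g

/-- `∇ · u = 0` on `ℝᵈ` in the sense of distributions. -/
def WeaklyDivFree (u : Space d → Space d) : Prop :=
  ∀ φ : Space d → ℝ, ContDiff ℝ ∞ φ → HasCompactSupport φ →
    ∫ x, ∑ i, u x i * partialD i φ x = 0

/-- `v ∈ C¹([0,T]; 𝒟(ℝᵈ))`, with time derivative `vt`. -/
structure IsTestField (T : ℝ) (v vt : ℝ → Space d → Space d) : Prop where
  contDiff : ∀ t ∈ Icc 0 T, ContDiff ℝ ∞ (v t)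
  contDiff_deriv : ∀ t ∈ Icc 0 T, ContDiff ℝ ∞ (vt t)
  support : ∃ K : Set (Space d), IsCompact K ∧ ∀ t ∈ Icc 0 T, ∀ x ∉ K, v t x = 0
  hasDeriv : ∀ x, ∀ t ∈ Icc 0 T, HasDerivWithinAt (fun s => v s x) (vt t x) (Icc 0 T) t
  continuousOn : ∀ n : ℕ,
    ContinuousOn (fun z : ℝ × Space d => iteratedFDeriv ℝ n (v z.1) z.2) (Icc 0 T ×ˢ univ)
  continuousOn_deriv : ∀ n : ℕ,
    ContinuousOn (fun z : ℝ × Space d => iteratedFDeriv ℝ n (vt z.1) z.2) (Icc 0 T ×ˢ univ)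

/-- The energy `½ (‖u‖²_{L²} + ‖E‖²_{L²})`, with the Frobenius norm of matrices. -/
noncomputable def energy (u : Space d → Space d) (E : Space d → Matrix (Fin d) (Fin d) ℝ) : ℝ :=
  (1 / 2) * ((∫ x, ∑ i, (u x i) ^ 2) + ∫ x, ∑ i, ∑ j, (E x i j) ^ 2)

/-- The structural assumptions on the initial data: `det (E₀ + I) = 1`, `∇ · u₀ = 0`,
`∇ · E₀ᵀ = 0` and
`∂ₘ E₀ᵢⱼ - ∂ⱼ E₀ᵢₘ = E₀ₗⱼ ∂ₗ E₀ᵢₘ - E₀ₗₘ ∂ₗ E₀ᵢⱼ` (summed over `l`). -/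
structure IsAdmissibleData (u₀ : Space d → Space d)
    (E₀ : Space d → Matrix (Fin d) (Fin d) ℝ) : Prop where
  det_eq_one : ∀ᵐ x, (E₀ x + 1).det = 1
  div_velocity : ∀ᵐ x, ∑ i, weakPartial i (fun y => u₀ y i) x = 0
  div_transpose : ∀ j, ∀ᵐ x, ∑ i, weakPartial i (fun y => E₀ y i j) x = 0
  curl : ∀ i j m, ∀ᵐ x,
    weakPartial m (fun y => E₀ y i j) x - weakPartial j (fun y => E₀ y i m) x =
      ∑ l, E₀ x l j * weakPartial l (fun y => E₀ y i m) x -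
        ∑ l, E₀ x l m * weakPartial l (fun y => E₀ y i j) x

/-- `(u, E)` is a finite energy weak solution in `(0,T) × ℝᵈ` of the incompressible viscoelastic
system with viscosity `μ` and initial data `(u₀, E₀)`.  Conventions: `(∇u)ᵢₖ = ∂ₖ uᵢ`,
`(a ⊗ b)ᵢₖ = aᵢ bₖ`, `A : B = ∑ Aᵢₖ Bᵢₖ`, and `E_j` is the `j`-th column of `E`. -/
structure IsWeakSolution (μ T : ℝ) (u₀ : Space d → Space d)
    (E₀ : Space d → Matrix (Fin d) (Fin d) ℝ)
    (u : ℝ → Space d → Space d) (E : ℝ → Space d → Matrix (Fin d) (Fin d) ℝ) : Prop where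
  /-- `u ∈ L^∞(0,T; L²)` -/
  velocity_mem : ∀ i, MemLqH ⊤ T 0 (fun t x => u t x i)
  /-- `u ∈ L²(0,T; H¹)`, that is, `∇u ∈ L²(0,T; L²)` in addition -/
  gradient_mem : ∀ i, MemLqH 2 T 1 (fun t x => u t x i)
  /-- `E ∈ L^∞(0,T; L²)` -/
  strain_mem : ∀ i j, MemLqH ⊤ T 0 (fun t x => E t x i j)
  /-- The representative in time for which the identities below hold at every time is
  `L²`-valued. -/
  velocity_memLp : ∀ t ∈ Icc 0 T, ∀ i, MemLp (fun x => u t x i) 2 volume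
  strain_memLp : ∀ t ∈ Icc 0 T, ∀ i j, MemLp (fun x => E t x i j) 2 volume
  div_free : ∀ᵐ t ∂(volume.restrict (Ioo 0 T)), WeaklyDivFree (u t)
  momentum : ∀ v vt : ℝ → Space d → Space d, IsTestField T v vt →
    (∀ t ∈ Icc 0 T, ∀ x, ∑ i, partialD i (fun y => v t y i) x = 0) →
    ∀ t ∈ Icc 0 T,
      (∫ x, ∑ i, u t x i * v t x i) - (∫ x, ∑ i, u₀ x i * v 0 x i) =
        (∫ s in (0 : ℝ)..t, ∫ x, ((∑ i, u s x i * vt s x i) +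
          ∑ i, ∑ k, (u s x i * u s x k - (E s x * (E s x).transpose) i k - E s x i k) *
            partialD k (fun y => v s y i) x)) -
        μ * ∫ s in (0 : ℝ)..t, ∫ x, ∑ i, ∑ k,
          weakPartial k (fun y => u s y i) x * partialD k (fun y => v s y i) x
  transport : ∀ w wt : ℝ → Space d → Space d, IsTestField T w wt →
    ∀ j, ∀ t ∈ Icc 0 T,
      (∫ x, ∑ i, E t x i j * w t x i) - (∫ x, ∑ i, E₀ x i j * w 0 x i) =
        ∫ s in (0 : ℝ)..t, ∫ x, ((∑ i, E s x i j * wt s x i) +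
          (∑ i, ∑ k, (E s x i j * u s x k - u s x i * E s x k j) *
            partialD k (fun y => w s y i) x) -
          ∑ i, u s x i * partialD j (fun y => w s y i) x)
  energy_le : ∀ᵐ t ∂(volume.restrict (Ioo 0 T)),
    energy (u t) (E t) +
      μ * (∫ s in (0 : ℝ)..t, ∫ x, ∑ i, ∑ k, (weakPartial k (fun y => u s y i) x) ^ 2) ≤
      energy u₀ E₀

/-- `(u, E)` is a strong solution on the time interval `[0,S]`, of Sobolev regularity `H^k`, of
```
u_t + u · ∇u - μ Δu + ∇p = ∇ · E + ∇ · (E Eᵀ),   ∇ · u = 0,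
E_t + u · ∇E = ∇u + ∇u E,                        u(0) = u₀,  E(0) = E₀,
```
with `(∇u)ᵢⱼ = ∂ⱼ uᵢ` and `(∇ · A)ᵢ = ∑ₖ ∂ₖ Aᵢₖ`: all terms are functions and the equations hold
almost everywhere, for some pressure `p`.  The time derivatives `ut`, `Et` are in
`L²(0,S; L²)`. -/
structure IsStrongSolution (μ : ℝ) (k : ℕ) (S : ℝ) (u₀ : Space d → Space d)
    (E₀ : Space d → Matrix (Fin d) (Fin d) ℝ)
    (u : ℝ → Space d → Space d) (E : ℝ → Space d → Matrix (Fin d) (Fin d) ℝ) : Prop where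
  /-- `u ∈ L^∞(0,S; H^k) ∩ L²(0,S; H^{k+1})` -/
  velocity_mem : ∀ i, MemLqH ⊤ S k (fun t x => u t x i)
  velocity_mem_succ : ∀ i, MemLqH 2 S (k + 1) (fun t x => u t x i)
  /-- `E ∈ L^∞(0,S; H^k)` -/
  strain_mem : ∀ i j, MemLqH ⊤ S k (fun t x => E t x i j)
  div_free : ∀ᵐ t ∂(volume.restrict (Ioo 0 S)), ∀ᵐ x,
    ∑ i, weakPartial i (fun y => u t y i) x = 0
  momentum : ∃ (ut : ℝ → Space d → Space d) (p : ℝ → Space d → ℝ),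
    (∀ i, MemLqH 2 S 0 (fun t x => ut t x i)) ∧
    (∀ t ∈ Icc 0 S, ∀ᵐ x, ∀ i, u t x i = u₀ x i + ∫ s in (0 : ℝ)..t, ut s x i) ∧
    (∀ᵐ t ∂(volume.restrict (Ioo 0 S)), ∀ i, ∃ g, HasWeakPartial i (p t) g) ∧
    ∀ᵐ t ∂(volume.restrict (Ioo 0 S)), ∀ᵐ x, ∀ i,
      ut t x i + (∑ l, u t x l * weakPartial l (fun y => u t y i) x) -
          μ * (∑ l, weakPartial l (weakPartial l (fun y => u t y i)) x) +
          weakPartial i (p t) x =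
        (∑ l, weakPartial l (fun y => E t y i l) x) +
          ∑ l, weakPartial l (fun y => (E t y * (E t y).transpose) i l) x
  strain : ∃ Et : ℝ → Space d → Matrix (Fin d) (Fin d) ℝ,
    (∀ i j, MemLqH 2 S 0 (fun t x => Et t x i j)) ∧
    (∀ t ∈ Icc 0 S, ∀ᵐ x, ∀ i j, E t x i j = E₀ x i j + ∫ s in (0 : ℝ)..t, Et s x i j) ∧
    ∀ᵐ t ∂(volume.restrict (Ioo 0 S)), ∀ᵐ x, ∀ i j,
      Et t x i j + (∑ l, u t x l * weakPartial l (fun y => E t y i j) x) =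
        weakPartial j (fun y => u t y i) x +
          ∑ l, weakPartial l (fun y => u t y i) x * E t x l j

end Viscoelastic

/-!
The proof is the relative energy method. For a weak solution `(û, Ê)` and a strong solution `(u, E)`
with the same data, let `y(t)` be the squared `L²` distance of the two solutions at time `t`.
Expanding the square, `y / 2` is the energy of the weak solution plus the energy of the strong
solution minus the pairing `⟨û, u⟩ + ⟨Ê, E⟩`. The first is controlled by the energy inequality, which
is part of the definition of a weak solution; the second is given by the energy equality
`IsStrongPath.energy`; and the evolution of the pairing follows from the two systems of equations.

*The pairing.* A strong solution is not an admissible test field: it is neither smooth nor compactly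
supported. In `pairing_identity` the roles are exchanged: the weak solution is mollified in space
and, for the momentum equation, projected onto the solenoidal fields, which turns it into an
absolutely continuous function of time with values in `L²`. The product rule for such functions
(`inner_primitive`) then gives the identity, and the mollification is removed by dominated
convergence. Only test fields that do not depend on time are used. That the momentum equation is
tested with solenoidal fields alone does no harm, because these are dense among the square
integrable solenoidal fields (`leray_eq_zero`): a field in the complement is divergence and curl
free, hence harmonic, hence zero.

*The estimate.* At a fixed time, `IsStrongAt.cross_bound` shows that, apart from the dissipation,
all terms combine to an expression that is quadratic in the difference of the solutions, with the first
derivatives of `u` and `E` as coefficients. These are bounded by the Sobolev embedding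
`ae_abs_le_of_H2`, which is where `d ≤ 3` and `k ≥ 3` enter. The terms that are only linear in the
difference vanish because the velocities and also the columns of both strains are solenoidal. For
the weak solution this follows by testing the transport equation with gradients
(`IsWeakPath.sol_F`); for the strong solution the divergence of a column solves a transport equation
with initial value zero (`strain_div_free`).

*Conclusion.* Gronwall's inequality (`gronwall_ae`) gives `y = 0` for almost every time
(`ae_eq_of_paths`). The weak formulation makes `Ê` weakly continuous in time, and `û` weakly
continuous modulo gradients, so the identity extends to every time for `Ê`, and for the
solenoidal part of `û` (`projection_eq_of_ae`); the latter is `û(t)` itself at the times at which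
its divergence vanishes.
-/

namespace Viscoelastic
open Filter Topology Function
variable {d : ℕ}

/-! ### Test functions and weak derivatives -/

/-- Test functions: the class `C_c^∞(ℝᵈ)`. -/
structure IsTest (φ : Space d → ℝ) : Prop where
  contDiff : ContDiff ℝ ∞ φ
  compact : HasCompactSupport φ

namespace IsTest
variable {φ ψ κ : Space d → ℝ}

lemma continuous (h : IsTest φ) : Continuous φ := h.contDiff.continuous

lemma differentiable (h : IsTest φ) : Differentiable ℝ φ := h.contDiff.differentiable (by simp)

lemma partialD (h : IsTest φ) (i : Fin d) : IsTest (partialD i φ) := by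
  refine ⟨?_, ?_⟩
  · have : ContDiff ℝ ∞ (fderiv ℝ φ) := h.contDiff.fderiv_right (by simp)
    exact this.clm_apply contDiff_const
  · exact (h.compact.fderiv ℝ).comp_left (g := fun L => L (EuclideanSpace.single i 1)) (by simp)

lemma memLp (h : IsTest φ) (p : ℝ≥0∞) : MemLp φ p volume :=
  h.continuous.memLp_of_hasCompactSupport h.compact

lemma integrable (h : IsTest φ) : Integrable φ volume :=
  h.continuous.integrable_of_hasCompactSupport h.compact

lemma neg (h : IsTest φ) : IsTest (fun x => - φ x) :=
  ⟨h.contDiff.neg, h.compact.neg⟩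

lemma mul (h : IsTest φ) (h' : IsTest ψ) : IsTest (fun x => φ x * ψ x) :=
  ⟨h.contDiff.mul h'.contDiff, h.compact.mul_right⟩

lemma zero : IsTest (fun _ : Space d => (0 : ℝ)) := ⟨contDiff_const, HasCompactSupport.zero⟩

lemma comp_sub (h : IsTest φ) (x : Space d) : IsTest (fun y => φ (x - y)) := by
  refine ⟨h.contDiff.comp (contDiff_const.sub contDiff_id), ?_⟩
  exact h.compact.comp_homeomorph (Homeomorph.subLeft x)

lemma comp_neg (h : IsTest φ) : IsTest (fun y => φ (-y)) := by
  simpa using h.comp_sub 0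

lemma comp_sub_right (h : IsTest φ) (x : Space d) : IsTest (fun y => φ (y - x)) := by
  refine ⟨h.contDiff.comp (contDiff_id.sub contDiff_const), ?_⟩
  exact h.compact.comp_homeomorph (Homeomorph.subRight x)

lemma bounded (h : IsTest φ) : ∃ C, 0 ≤ C ∧ ∀ x, |φ x| ≤ C := by
  obtain ⟨C, hC⟩ := h.compact.exists_bound_of_continuous h.continuous
  exact ⟨C, (abs_nonneg _).trans (hC 0), hC⟩

end IsTest

lemma partialD_comp_sub {φ : Space d → ℝ} (h : Differentiable ℝ φ) (i : Fin d) (x y : Space d) :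
    partialD i (fun y => φ (x - y)) y = - partialD i φ (x - y) := by
  unfold partialD
  have : HasFDerivAt (fun y => φ (x - y))
      ((fderiv ℝ φ (x - y)).comp (-(ContinuousLinearMap.id ℝ (Space d)))) y :=
    (h (x - y)).hasFDerivAt.comp y ((hasFDerivAt_id y).const_sub x)
  rw [this.fderiv]; simp

lemma partialD_comp_neg {φ : Space d → ℝ} (h : Differentiable ℝ φ) (i : Fin d) (y : Space d) :
    partialD i (fun y => φ (-y)) y = - partialD i φ (-y) := by
  simpa using partialD_comp_sub h i 0 y

lemma partialD_mul {φ ψ : Space d → ℝ} (h : Differentiable ℝ φ) (h' : Differentiable ℝ ψ)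
    (i : Fin d) (x : Space d) :
    partialD i (fun y => φ y * ψ y) x = partialD i φ x * ψ x + φ x * partialD i ψ x := by
  unfold partialD
  rw [fderiv_fun_mul (h x) (h' x)]
  simp; ring

lemma partialD_neg {φ : Space d → ℝ} (i : Fin d) (x : Space d) :
    partialD i (fun y => - φ y) x = - partialD i φ x := by
  unfold partialD
  rw [fderiv_fun_neg]
  simp

lemma partialD_comm {φ : Space d → ℝ} (h : ContDiff ℝ ∞ φ) (i j : Fin d) (x : Space d) :
    partialD i (partialD j φ) x = partialD j (partialD i φ) x := by
  have hd : Differentiable ℝ (fderiv ℝ φ) :=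
    (h.fderiv_right (m := ∞) (by simp)).differentiable (by simp)
  have key : ∀ a b : Space d, fderiv ℝ (fun y => fderiv ℝ φ y a) x b
      = fderiv ℝ (fderiv ℝ φ) x b a := by
    intro a b
    rw [fderiv_clm_apply (hd x) (differentiableAt_const a)]
    simp
  have hs : IsSymmSndFDerivAt ℝ φ x := (h.contDiffAt).isSymmSndFDerivAt (by
    simp only [minSmoothness_of_isRCLikeNormedField]; exact WithTop.coe_le_coe.2 (le_top : (2 : ℕ∞) ≤ ⊤))
  unfold partialD
  rw [key, key]
  exact hs _ _

namespace HasWeakPartial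
variable {i : Fin d} {f g f' g' : Space d → ℝ}

lemma congr (h : HasWeakPartial i f g) (hf : f =ᵐ[volume] f') (hg : g =ᵐ[volume] g') :
    HasWeakPartial i f' g' := by
  refine ⟨h.1.congr hf, h.2.congr hg, fun φ h1 h2 => ?_⟩
  have a : ∫ x, f' x * partialD i φ x = ∫ x, f x * partialD i φ x :=
    integral_congr_ae (by filter_upwards [hf] with x hx; rw [hx])
  have b : ∫ x, g' x * φ x = ∫ x, g x * φ x :=
    integral_congr_ae (by filter_upwards [hg] with x hx; rw [hx])
  rw [a, b, h.3 φ h1 h2]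

lemma test (h : HasWeakPartial i f g) {φ : Space d → ℝ} (hφ : IsTest φ) :
    ∫ x, f x * partialD i φ x = - ∫ x, g x * φ x := h.3 φ hφ.1 hφ.2

lemma ae_unique (h : HasWeakPartial i f g) (h' : HasWeakPartial i f g') : g =ᵐ[volume] g' := by
  refine ae_eq_of_integral_contDiff_smul_eq h.2 h'.2 fun φ h1 h2 => ?_
  have := h.3 φ h1 h2
  rw [h'.3 φ h1 h2, neg_inj] at this
  simpa [mul_comm] using this.symm

lemma weakPartial (h : HasWeakPartial i f g) : HasWeakPartial i f (weakPartial i f) := by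
  have h' : ∃ g, HasWeakPartial i f g := ⟨g, h⟩
  unfold Viscoelastic.weakPartial
  rw [dif_pos h']
  exact h'.choose_spec

lemma weakPartial_ae_eq (h : HasWeakPartial i f g) :
    Viscoelastic.weakPartial i f =ᵐ[volume] g := h.weakPartial.ae_unique h

lemma add (h : HasWeakPartial i f g) (h' : HasWeakPartial i f' g') :
    HasWeakPartial i (fun x => f x + f' x) (fun x => g x + g' x) := by
  refine ⟨h.1.add h'.1, h.2.add h'.2, fun φ h1 h2 => ?_⟩
  have hφ : IsTest φ := ⟨h1, h2⟩
  have I : ∀ {u ψ : Space d → ℝ}, LocallyIntegrable u → IsTest ψ →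
      Integrable (fun x => u x * ψ x) := fun hu hψ => by
    simpa [mul_comm] using hu.integrable_smul_left_of_hasCompactSupport hψ.continuous hψ.compact
  simp only [add_mul]
  rw [integral_add (I h.1 (hφ.partialD i)) (I h'.1 (hφ.partialD i)),
    integral_add (I h.2 hφ) (I h'.2 hφ), h.3 φ h1 h2, h'.3 φ h1 h2]
  ring

end HasWeakPartial

lemma hasWeakPartial_zero (i : Fin d) : HasWeakPartial i (fun _ => 0) (fun _ => 0) :=
  ⟨locallyIntegrable_zero, locallyIntegrable_zero, by simp⟩

lemma hasWeakPartial_sum {ι : Type*} (s : Finset ι) {i : Fin d} {f g : ι → Space d → ℝ}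
    (h : ∀ a ∈ s, HasWeakPartial i (f a) (g a)) :
    HasWeakPartial i (fun x => ∑ a ∈ s, f a x) (fun x => ∑ a ∈ s, g a x) := by
  classical
  induction s using Finset.induction_on with
  | empty => simpa using hasWeakPartial_zero i
  | insert a s ha ih =>
    simp only [Finset.sum_insert ha]
    exact (h a (by simp)).add (ih fun b hb => h b (by simp [hb]))

lemma _root_.MeasureTheory.MemLp.locInt {f : Space d → ℝ} (h : MemLp f 2 volume) :
    LocallyIntegrable f volume := h.locallyIntegrable (by norm_num)

lemma IsTest.integrable_mul {f φ : Space d → ℝ} (hφ : IsTest φ) (hf : LocallyIntegrable f volume) :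
    Integrable (fun x => f x * φ x) volume := by
  simpa [mul_comm] using hf.integrable_smul_left_of_hasCompactSupport hφ.continuous hφ.compact

/-- Divergence theorem for a compactly supported function. -/
lemma integral_partialD_eq_zero {φ : Space d → ℝ} (hφ : IsTest φ) (i : Fin d) :
    ∫ x, partialD i φ x = 0 := by
  have h1 : Integrable (fun x => fderiv ℝ φ x (EuclideanSpace.single i 1)) volume :=
    (hφ.partialD i).integrable
  have := integral_mul_fderiv_eq_neg_fderiv_mul_of_integrable (𝕜 := ℝ) (μ := volume)
    (f := fun _ : Space d => (1 : ℝ)) (g := φ) (v := EuclideanSpace.single i 1)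
    (by simp) (by simpa using h1) (by simpa using hφ.integrable)
    (fun x _ => differentiableAt_const _) (fun x _ => hφ.differentiable x)
  simpa [partialD] using this

/-- A smooth function has its classical partial derivative as a weak one. -/
lemma hasWeakPartial_of_contDiff {f : Space d → ℝ} (hf : ContDiff ℝ ∞ f) (i : Fin d) :
    HasWeakPartial i f (partialD i f) := by
  have hc : Continuous (partialD i f) :=
    ((hf.fderiv_right (m := ∞) (by simp)).clm_apply contDiff_const).continuous
  refine ⟨hf.continuous.locallyIntegrable, hc.locallyIntegrable, fun φ h1 h2 => ?_⟩
  have hφ : IsTest φ := ⟨h1, h2⟩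
  have hfd := hf.differentiable (by simp)
  have h3 : IsTest (fun x => f x * φ x) := ⟨hf.mul h1, h2.mul_left⟩
  have := integral_partialD_eq_zero h3 i
  simp only [partialD_mul hfd hφ.differentiable] at this
  rw [integral_add (hφ.integrable_mul hc.locallyIntegrable)
    ((hφ.partialD i).integrable_mul hf.continuous.locallyIntegrable)] at this
  linarith

/-! ### Convolution with a test function -/

/-- The convolution `κ * f` with a kernel `κ`. -/
noncomputable def moll (κ f : Space d → ℝ) (x : Space d) : ℝ := ∫ y, κ (x - y) * f y

lemma moll_eq_convolution (κ f : Space d → ℝ) :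
    moll κ f = convolution κ f (ContinuousLinearMap.lsmul ℝ ℝ) volume := by
  ext x; rw [convolution_lsmul_swap]; rfl

lemma moll_congr {κ f g : Space d → ℝ} (h : f =ᵐ[volume] g) : moll κ f = moll κ g := by
  ext x
  exact integral_congr_ae (by filter_upwards [h] with y hy; rw [hy])

lemma integrable_mul2 {α : Type*} [MeasurableSpace α] {μ : Measure α} {f g : α → ℝ}
    (hf : MemLp f 2 μ) (hg : MemLp g 2 μ) : Integrable (fun x => f x * g x) μ :=
  hf.integrable_mul hg

section
variable {κ f : Space d → ℝ}

lemma IsTest.integrable_kernel (hκ : IsTest κ) (hf : LocallyIntegrable f volume) (x : Space d) :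
    Integrable (fun y => κ (x - y) * f y) volume := by
  simpa [mul_comm] using (hκ.comp_sub x).integrable_mul hf

lemma moll_contDiff (hκ : IsTest κ) (hf : LocallyIntegrable f volume) :
    ContDiff ℝ ∞ (moll κ f) := by
  rw [moll_eq_convolution]
  exact hκ.compact.contDiff_convolution_left _ hκ.contDiff hf

lemma moll_add {g : Space d → ℝ} (hκ : IsTest κ) (hf : LocallyIntegrable f volume)
    (hg : LocallyIntegrable g volume) (x : Space d) :
    moll κ (fun y => f y + g y) x = moll κ f x + moll κ g x := by
  unfold moll
  simp only [mul_add]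
  exact integral_add (hκ.integrable_kernel hf x) (hκ.integrable_kernel hg x)

lemma partialD_moll (hκ : IsTest κ) (hf : LocallyIntegrable f volume) (i : Fin d) (x : Space d) :
    partialD i (moll κ f) x = moll (partialD i κ) f x := by
  have h := hκ.compact.hasFDerivAt_convolution_left (ContinuousLinearMap.lsmul ℝ ℝ)
    (hκ.contDiff.of_le (by simp)) hf x
  rw [← moll_eq_convolution] at h
  unfold partialD
  rw [h.fderiv, convolution_eq_swap, ContinuousLinearMap.integral_apply]
  · rfl
  · have hc : HasCompactSupport (fderiv ℝ κ) := hκ.compact.fderiv ℝ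
    have hcont : Continuous (fderiv ℝ κ) := (hκ.contDiff.fderiv_right (m := ∞) (by simp)).continuous
    have := (hc.convolutionExists_left
      ((ContinuousLinearMap.lsmul ℝ ℝ : ℝ →L[ℝ] ℝ →L[ℝ] ℝ).precompL (Space d)) hcont hf x)
    exact this.integrable_swap

/-- Mollification of a weak partial derivative. -/
lemma HasWeakPartial.moll {g : Space d → ℝ} {i : Fin d} (h : HasWeakPartial i f g)
    (hκ : IsTest κ) (x : Space d) : moll (partialD i κ) f x = moll κ g x := by
  have := h.test (hκ.comp_sub x)
  simp only [partialD_comp_sub hκ.differentiable] at this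
  unfold Viscoelastic.moll
  simp only [mul_neg, integral_neg, neg_inj] at this
  simpa [mul_comm] using this

lemma moll_isTest (hκ : IsTest κ) (hf : IsTest f) : IsTest (moll κ f) := by
  refine ⟨moll_contDiff hκ hf.continuous.locallyIntegrable, ?_⟩
  rw [moll_eq_convolution]
  exact hκ.compact.convolution _ hf.compact

lemma partialD_moll' (hκ : IsTest κ) (hf : IsTest f) (i : Fin d) (x : Space d) :
    partialD i (moll κ f) x = moll κ (partialD i f) x := by
  rw [partialD_moll hκ hf.continuous.locallyIntegrable]
  exact (hasWeakPartial_of_contDiff hf.contDiff i).moll hκ x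

lemma integral_comp_sub_left (g : Space d → ℝ) (x : Space d) : ∫ y, g (x - y) = ∫ y, g y :=
  integral_sub_left_eq_self g volume x

/-- Cauchy-Schwarz for nonnegative extended real functions. -/
lemma lintegral_mul_sq_le {α : Type*} [MeasurableSpace α] {μ : Measure α} {a b : α → ℝ≥0∞}
    (ha : AEMeasurable a μ) (hb : AEMeasurable b μ) :
    (∫⁻ x, a x * b x ∂μ) ^ 2 ≤ (∫⁻ x, a x ^ 2 ∂μ) * ∫⁻ x, b x ^ 2 ∂μ := by
  have := ENNReal.lintegral_mul_le_Lp_mul_Lq μ Real.HolderConjugate.two_two ha hb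
  calc (∫⁻ x, a x * b x ∂μ) ^ 2 ≤ _ := pow_le_pow_left' this 2
    _ = _ := by
      rw [mul_pow, ← ENNReal.rpow_natCast, ← ENNReal.rpow_natCast, ← ENNReal.rpow_mul,
        ← ENNReal.rpow_mul]
      norm_num

lemma eLpNorm_two_sq (f : Space d → ℝ) : eLpNorm f 2 volume ^ 2 = ∫⁻ x, ‖f x‖ₑ ^ 2 := by
  rw [eLpNorm_eq_lintegral_rpow_enorm_toReal (by norm_num) (by norm_num),
    ← ENNReal.rpow_natCast, ← ENNReal.rpow_mul]
  norm_num

lemma aemeasurable_kernel (hκ : IsTest κ) (hf : AEStronglyMeasurable f volume) :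
    AEMeasurable (fun p : Space d × Space d => κ (p.1 - p.2) * f p.2) (volume.prod volume) := by
  have h1 : Continuous (fun p : Space d × Space d => κ (p.1 - p.2)) :=
    hκ.continuous.comp (by fun_prop)
  exact h1.aemeasurable.mul (hf.comp_snd.aemeasurable)

lemma lintegral_enorm_comp_sub (κ : Space d → ℝ) (y : Space d) :
    ∫⁻ x, ‖κ (x - y)‖ₑ = ∫⁻ x, ‖κ x‖ₑ :=
  lintegral_sub_right_eq_self (fun x => ‖κ x‖ₑ) y

/-- Young's inequality `L¹ * L² → L²`, with the kernel in `L¹`. -/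
lemma eLpNorm_moll_le (hκ : IsTest κ) (hf : AEStronglyMeasurable f volume) :
    eLpNorm (moll κ f) 2 volume ≤ (∫⁻ x, ‖κ x‖ₑ) * eLpNorm f 2 volume := by
  set A := ∫⁻ x, ‖κ x‖ₑ with hA
  have hmeas : AEMeasurable (fun p : Space d × Space d => ‖κ (p.1 - p.2)‖ₑ * ‖f p.2‖ₑ ^ 2)
      (volume.prod volume) := by
    have h1 : Continuous (fun p : Space d × Space d => κ (p.1 - p.2)) :=
      hκ.continuous.comp (by fun_prop)
    exact h1.aemeasurable.enorm.mul (hf.comp_snd.aemeasurable.enorm.pow_const 2)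
  have hpt : ∀ x, ‖moll κ f x‖ₑ ^ 2 ≤ A * ∫⁻ y, ‖κ (x - y)‖ₑ * ‖f y‖ₑ ^ 2 := by
    intro x
    have hk : AEMeasurable (fun y => ‖κ (x - y)‖ₑ) volume :=
      (hκ.comp_sub x).continuous.aemeasurable.enorm
    have h1 : ‖moll κ f x‖ₑ ≤ ∫⁻ y, ‖κ (x - y)‖ₑ ^ (1 / 2 : ℝ) *
        (‖κ (x - y)‖ₑ ^ (1 / 2 : ℝ) * ‖f y‖ₑ) := by
      refine (enorm_integral_le_lintegral_enorm _).trans (le_of_eq ?_)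
      congr 1; ext y
      rw [enorm_mul, ← mul_assoc, ← ENNReal.rpow_add_of_nonneg _ _ (by norm_num) (by norm_num)]
      norm_num
    calc ‖moll κ f x‖ₑ ^ 2 ≤ _ := pow_le_pow_left' h1 2
      _ ≤ _ := lintegral_mul_sq_le (hk.pow_const _)
          ((hk.pow_const _).mul hf.aemeasurable.enorm)
      _ = _ := by
        congr 1
        · rw [hA, ← lintegral_sub_left_eq_self (fun y => ‖κ y‖ₑ) x]
          congr 1; ext y
          rw [← ENNReal.rpow_natCast, ← ENNReal.rpow_mul]; norm_num
        · congr 1; ext y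
          rw [mul_pow, ← ENNReal.rpow_natCast (‖κ (x - y)‖ₑ ^ (1 / 2 : ℝ)), ← ENNReal.rpow_mul]
          norm_num
  have : eLpNorm (moll κ f) 2 volume ^ 2 ≤ (A * eLpNorm f 2 volume) ^ 2 := by
    rw [eLpNorm_two_sq, mul_pow, eLpNorm_two_sq]
    calc ∫⁻ x, ‖moll κ f x‖ₑ ^ 2 ≤ ∫⁻ x, A * ∫⁻ y, ‖κ (x - y)‖ₑ * ‖f y‖ₑ ^ 2 :=
          lintegral_mono hpt
      _ = A * ∫⁻ x, ∫⁻ y, ‖κ (x - y)‖ₑ * ‖f y‖ₑ ^ 2 := by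
          rw [lintegral_const_mul'']
          exact hmeas.lintegral_prod_right'
      _ = A * ∫⁻ y, ∫⁻ x, ‖κ (x - y)‖ₑ * ‖f y‖ₑ ^ 2 := by
          rw [lintegral_lintegral_swap hmeas]
      _ = A * ∫⁻ y, A * ‖f y‖ₑ ^ 2 := by
          congr 2; ext y
          rw [lintegral_mul_const'' _ (hκ.comp_sub_right y).continuous.aemeasurable.enorm,
            lintegral_enorm_comp_sub κ]
      _ = A ^ 2 * ∫⁻ y, ‖f y‖ₑ ^ 2 := by
          rw [lintegral_const_mul'' _ (hf.aemeasurable.enorm.pow_const 2), ← mul_assoc, sq]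
  exact (ENNReal.pow_le_pow_left_iff (by norm_num)).1 this

/-- Young's inequality `L² * L¹ → L²`, with the kernel in `L²`. -/
lemma eLpNorm_moll_le_one (hκ : IsTest κ) (hf : AEStronglyMeasurable f volume) :
    eLpNorm (moll κ f) 2 volume ≤ eLpNorm κ 2 volume * eLpNorm f 1 volume := by
  have hmeas : AEMeasurable (fun p : Space d × Space d => ‖κ (p.1 - p.2)‖ₑ ^ 2 * ‖f p.2‖ₑ)
      (volume.prod volume) := by
    have h1 : Continuous (fun p : Space d × Space d => κ (p.1 - p.2)) :=
      hκ.continuous.comp (by fun_prop)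
    exact (h1.aemeasurable.enorm.pow_const 2).mul (hf.comp_snd.aemeasurable.enorm)
  set B := ∫⁻ x, ‖f x‖ₑ with hB
  have hpt : ∀ x, ‖moll κ f x‖ₑ ^ 2 ≤ B * ∫⁻ y, ‖κ (x - y)‖ₑ ^ 2 * ‖f y‖ₑ := by
    intro x
    have hk : AEMeasurable (fun y => ‖κ (x - y)‖ₑ) volume :=
      (hκ.comp_sub x).continuous.aemeasurable.enorm
    have h1 : ‖moll κ f x‖ₑ ≤ ∫⁻ y, ‖f y‖ₑ ^ (1 / 2 : ℝ) *
        (‖κ (x - y)‖ₑ * ‖f y‖ₑ ^ (1 / 2 : ℝ)) := by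
      refine (enorm_integral_le_lintegral_enorm _).trans (le_of_eq ?_)
      congr 1; ext y
      rw [enorm_mul, mul_left_comm, ← ENNReal.rpow_add_of_nonneg _ _ (by norm_num) (by norm_num)]
      norm_num
    calc ‖moll κ f x‖ₑ ^ 2 ≤ _ := pow_le_pow_left' h1 2
      _ ≤ _ := lintegral_mul_sq_le (hf.aemeasurable.enorm.pow_const _)
          (hk.mul (hf.aemeasurable.enorm.pow_const _))
      _ = _ := by
        congr 1
        · rw [hB]
          congr 1; ext y
          rw [← ENNReal.rpow_natCast, ← ENNReal.rpow_mul]; norm_num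
        · congr 1; ext y
          rw [mul_pow, ← ENNReal.rpow_natCast (‖f y‖ₑ ^ (1 / 2 : ℝ)), ← ENNReal.rpow_mul]
          norm_num
  have : eLpNorm (moll κ f) 2 volume ^ 2 ≤ (eLpNorm κ 2 volume * eLpNorm f 1 volume) ^ 2 := by
    rw [eLpNorm_one_eq_lintegral_enorm, mul_pow, eLpNorm_two_sq, eLpNorm_two_sq]
    calc ∫⁻ x, ‖moll κ f x‖ₑ ^ 2 ≤ ∫⁻ x, B * ∫⁻ y, ‖κ (x - y)‖ₑ ^ 2 * ‖f y‖ₑ :=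
          lintegral_mono hpt
      _ = B * ∫⁻ x, ∫⁻ y, ‖κ (x - y)‖ₑ ^ 2 * ‖f y‖ₑ := by
          rw [lintegral_const_mul'']
          exact hmeas.lintegral_prod_right'
      _ = B * ∫⁻ y, ∫⁻ x, ‖κ (x - y)‖ₑ ^ 2 * ‖f y‖ₑ := by
          rw [lintegral_lintegral_swap hmeas]
      _ = B * ∫⁻ y, (∫⁻ x, ‖κ x‖ₑ ^ 2) * ‖f y‖ₑ := by
          congr 2; ext y
          rw [lintegral_mul_const'' _
            ((hκ.comp_sub_right y).continuous.aemeasurable.enorm.pow_const 2),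
            lintegral_sub_right_eq_self (fun x => ‖κ x‖ₑ ^ 2) y]
      _ = (∫⁻ x, ‖κ x‖ₑ ^ 2) * B ^ 2 := by
          rw [lintegral_const_mul'' _ hf.aemeasurable.enorm, mul_left_comm, sq]
  exact (ENNReal.pow_le_pow_left_iff (by norm_num)).1 this

lemma moll_memLp (hκ : IsTest κ) (hf : MemLp f 2 volume) : MemLp (moll κ f) 2 volume := by
  refine ⟨(moll_contDiff hκ hf.locInt).continuous.aestronglyMeasurable,
    (eLpNorm_moll_le hκ hf.1).trans_lt (ENNReal.mul_lt_top ?_ hf.2)⟩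
  exact hκ.integrable.2

lemma moll_memLp_one (hκ : IsTest κ) (hf : MemLp f 1 volume) : MemLp (moll κ f) 2 volume := by
  refine ⟨(moll_contDiff hκ (hf.locallyIntegrable le_rfl)).continuous.aestronglyMeasurable,
    (eLpNorm_moll_le_one hκ hf.1).trans_lt (ENNReal.mul_lt_top (hκ.memLp 2).2 hf.2)⟩

/-- Fubini: the transpose of a convolution. -/
lemma integral_moll_mul_of_integrable {g : Space d → ℝ}
    (h : Integrable (fun p : Space d × Space d => κ (p.1 - p.2) * f p.2 * g p.1)
      (volume.prod volume)) :
    ∫ x, moll κ f x * g x = ∫ y, f y * moll (fun z => κ (-z)) g y := by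
  have h1 : ∀ x, moll κ f x * g x = ∫ y, κ (x - y) * f y * g x := fun x => by
    rw [integral_mul_const]; rfl
  have h2 : ∀ y, f y * moll (fun z => κ (-z)) g y = ∫ x, κ (x - y) * f y * g x := fun y => by
    unfold moll
    rw [← integral_const_mul]
    congr 1; ext x; simp only [neg_sub]; ring
  simp only [h1, h2]
  exact integral_integral_swap h

lemma integrable_kernel_mul_sq (hκ : IsTest κ) (hf : Integrable f volume) :
    Integrable (fun p : Space d × Space d => κ (p.1 - p.2) * f p.2) (volume.prod volume) := by
  have := hf.convolution_integrand (ContinuousLinearMap.mul ℝ ℝ) hκ.integrable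
  simpa [mul_comm] using this

lemma integrable_kernel_mul_sq' (hκ : IsTest κ) (hf : Integrable f volume) :
    Integrable (fun p : Space d × Space d => κ (p.1 - p.2) * f p.1) (volume.prod volume) := by
  have := (integrable_kernel_mul_sq hκ.comp_neg hf).swap
  simpa [Function.comp_def] using this

lemma integral_moll_mul {g : Space d → ℝ} (hκ : IsTest κ) (hf : MemLp f 2 volume)
    (hg : MemLp g 2 volume) :
    ∫ x, moll κ f x * g x = ∫ y, f y * moll (fun z => κ (-z)) g y := by
  apply integral_moll_mul_of_integrable
  have h1 := (integrable_kernel_mul_sq hκ hf.integrable_sq).norm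
  have h2 := (integrable_kernel_mul_sq' hκ hg.integrable_sq).norm
  refine (h1.add h2).mono'
    ((aemeasurable_kernel hκ hf.1).mul hg.1.comp_fst.aemeasurable).aestronglyMeasurable
    (Eventually.of_forall fun p => ?_)
  simp only [Pi.add_apply, Real.norm_eq_abs, abs_mul, abs_pow, sq_abs]
  have : |f p.2| * |g p.1| ≤ f p.2 ^ 2 + g p.1 ^ 2 := by
    nlinarith [sq_nonneg (|f p.2| - |g p.1|), sq_abs (f p.2), sq_abs (g p.1),
      abs_nonneg (f p.2), abs_nonneg (g p.1)]
  nlinarith [abs_nonneg (κ (p.1 - p.2)), mul_le_mul_of_nonneg_left this (abs_nonneg (κ (p.1 - p.2)))]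

lemma integral_moll_mul_one {g : Space d → ℝ} (hκ : IsTest κ) (hf : MemLp f 1 volume)
    (hg : MemLp g 2 volume) :
    ∫ x, moll κ f x * g x = ∫ y, f y * moll (fun z => κ (-z)) g y := by
  apply integral_moll_mul_of_integrable
  have hf' := memLp_one_iff_integrable.1 hf
  have h1 := (integrable_kernel_mul_sq (hκ.mul hκ) hf').norm
  have h2 := (hg.integrable_sq.mul_prod hf').norm
  refine (h1.add h2).mono'
    ((aemeasurable_kernel hκ hf.1).mul hg.1.comp_fst.aemeasurable).aestronglyMeasurable
    (Eventually.of_forall fun p => ?_)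
  simp only [Pi.add_apply, Real.norm_eq_abs, abs_mul, abs_pow, sq_abs]
  have : |κ (p.1 - p.2)| * |g p.1| ≤ |κ (p.1 - p.2)| * |κ (p.1 - p.2)| + g p.1 ^ 2 := by
    nlinarith [sq_nonneg (|κ (p.1 - p.2)| - |g p.1|), sq_abs (g p.1),
      abs_nonneg (κ (p.1 - p.2)), abs_nonneg (g p.1)]
  nlinarith [mul_le_mul_of_nonneg_left this (abs_nonneg (f p.2))]

lemma abs_moll_le {C : ℝ} (hκ : IsTest κ) (h0 : ∀ x, 0 ≤ κ x) (h1 : ∫ x, κ x = 1)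
    (hC : ∀ᵐ x, |f x| ≤ C) (x : Space d) : |moll κ f x| ≤ C := by
  have hi := (hκ.comp_sub x).integrable
  calc |moll κ f x| ≤ ∫ y, κ (x - y) * C := by
        rw [← Real.norm_eq_abs]
        refine norm_integral_le_of_norm_le (hi.mul_const C) ?_
        filter_upwards [hC] with y hy
        rw [norm_mul, Real.norm_of_nonneg (h0 _)]
        exact mul_le_mul_of_nonneg_left hy (h0 _)
    _ = C := by
        rw [integral_mul_const, integral_comp_sub_left κ x, h1, one_mul]

end

/-! ### Mollifiers and the product rule for weak derivatives -/

/-- A sequence of smooth bumps shrinking to the origin. The ratio of the two radii is fixed, as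
almost everywhere convergence of the mollifications requires. -/
noncomputable def bump (d n : ℕ) : ContDiffBump (0 : Space d) :=
  ⟨1 / (n + 1), 2 / (n + 1), by positivity, by gcongr; norm_num⟩

/-- The standard even mollifier of integral one. -/
noncomputable def rho (d n : ℕ) : Space d → ℝ := (bump d n).normed volume

lemma rho_isTest (n : ℕ) : IsTest (rho d n) :=
  ⟨(bump d n).contDiff_normed, (bump d n).hasCompactSupport_normed⟩

lemma rho_nonneg (n : ℕ) (x : Space d) : 0 ≤ rho d n x := (bump d n).nonneg_normed x

lemma rho_integral (n : ℕ) : ∫ x, rho d n x = 1 := (bump d n).integral_normed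

lemma rho_neg (n : ℕ) (x : Space d) : rho d n (-x) = rho d n x := (bump d n).normed_neg x

lemma bump_rOut_tendsto : Tendsto (fun n => (bump d n).rOut) atTop (𝓝 0) := by
  have := (tendsto_const_div_atTop_nhds_zero_nat (2 : ℝ)).comp (tendsto_add_atTop_nat 1)
  refine this.congr fun n => ?_
  simp [bump]

/-- The standard mollification operator. -/
noncomputable abbrev J (n : ℕ) (f : Space d → ℝ) : Space d → ℝ := moll (rho d n) f

lemma J_tendsto_ae {f : Space d → ℝ} (hf : LocallyIntegrable f volume) :
    ∀ᵐ x, Tendsto (fun n => J n f x) atTop (𝓝 (f x)) := by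
  have := ContDiffBump.ae_convolution_tendsto_right_of_locallyIntegrable (μ := volume)
    (φ := bump d) (l := atTop) (K := 2) bump_rOut_tendsto
    (Eventually.of_forall fun n => by simp [bump]; field_simp; rfl) hf
  simpa only [moll_eq_convolution, J, rho] using this

lemma J_eLpNorm_le {f : Space d → ℝ} (hf : AEStronglyMeasurable f volume) (n : ℕ) :
    eLpNorm (J n f) 2 volume ≤ eLpNorm f 2 volume := by
  refine (eLpNorm_moll_le (rho_isTest n) hf).trans (le_of_eq ?_)
  have : ∫⁻ x : Space d, ‖rho d n x‖ₑ = 1 := by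
    rw [← ofReal_integral_norm_eq_lintegral_enorm (rho_isTest n).integrable]
    simp only [Real.norm_of_nonneg (rho_nonneg n _), rho_integral, ENNReal.ofReal_one]
  rw [this, one_mul]

lemma J_transpose {f g : Space d → ℝ} (hf : MemLp f 2 volume) (hg : MemLp g 2 volume) (n : ℕ) :
    ∫ x, J n f x * g x = ∫ x, f x * J n g x := by
  rw [integral_moll_mul (rho_isTest n) hf hg]
  simp only [rho_neg]

/-- Mollifications of a continuous function with compact support converge uniformly, and their
supports stay in a fixed compact set, so they converge in `L²`. -/
lemma J_tendsto_of_test {f : Space d → ℝ} (hf : Continuous f) (hc : HasCompactSupport f) :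
    Tendsto (fun n => eLpNorm (fun x => J n f x - f x) 2 volume) atTop (𝓝 0) := by
  obtain ⟨K, hK⟩ : ∃ K : Set (Space d), K = Metric.cthickening 2 (tsupport f) := ⟨_, rfl⟩
  have hKc : IsCompact K := hK ▸ hc.cthickening
  have hsupp : ∀ n x, x ∉ K → J n f x - f x = 0 := by
    intro n x hx
    have h1 : f x = 0 := by
      by_contra h
      exact hx (hK ▸ Metric.self_subset_cthickening _ (subset_tsupport _ h))
    have h2 : J n f x = 0 := by
      refine integral_eq_zero_of_ae (Eventually.of_forall fun y => ?_)
      by_contra h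
      have ha : f y ≠ 0 := fun h0 => h (by simp [h0])
      have hb : rho d n (x - y) ≠ 0 := fun h0 => h (by simp [h0])
      have hb' : x - y ∈ Function.support (rho d n) := hb
      rw [rho, ContDiffBump.support_normed_eq, mem_ball_zero_iff] at hb'
      refine hx (hK ▸ Metric.mem_cthickening_of_dist_le x y 2 _ (subset_tsupport _ ha) ?_)
      rw [dist_eq_norm]
      refine hb'.le.trans ?_
      simp only [bump]
      rw [div_le_iff₀ (by positivity)]
      have : (0:ℝ) ≤ n := by positivity
      linarith
    rw [h1, h2, sub_zero]
  have huc : UniformContinuous f := hc.uniformContinuous_of_continuous hf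
  have hbd : ∀ ε > 0, ∀ᶠ n in atTop, ∀ x, ‖J n f x - f x‖ ≤ ε := by
    intro ε hε
    obtain ⟨δ, hδ, h⟩ := Metric.uniformContinuous_iff.1 huc ε hε
    filter_upwards [(bump_rOut_tendsto (d := d)).eventually (gt_mem_nhds hδ)] with n hn x
    have := (bump d n).dist_normed_convolution_le (μ := volume) (g := f) (x₀ := x) (ε := ε)
      hf.aestronglyMeasurable (fun y hy => (h ((Metric.mem_ball.1 hy).trans hn)).le)
    rw [← dist_eq_norm]
    simpa only [moll_eq_convolution, J, rho] using this
  rw [ENNReal.tendsto_nhds_zero]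
  intro ε hε
  have hKfin : volume K ^ (1 / 2 : ℝ) < ⊤ :=
    ENNReal.rpow_lt_top_of_nonneg (by norm_num) hKc.measure_lt_top.ne
  obtain ⟨η, hη, hle⟩ : ∃ η : ℝ, 0 < η ∧ ENNReal.ofReal η * volume K ^ (1 / 2 : ℝ) ≤ ε := by
    have ht : Tendsto (fun η : ℝ => ENNReal.ofReal η * volume K ^ (1 / 2 : ℝ)) (𝓝[>] 0) (𝓝 0) := by
      have h1 : Tendsto (fun η : ℝ => ENNReal.ofReal η) (𝓝[>] 0) (𝓝 0) := by
        have := (ENNReal.continuous_ofReal.tendsto 0).mono_left (nhdsWithin_le_nhds (s := Ioi 0))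
        simpa using this
      simpa using ENNReal.Tendsto.mul_const h1 (Or.inr hKfin.ne)
    have := (ht.eventually (ge_mem_nhds hε)).and self_mem_nhdsWithin
    obtain ⟨η, h1, h2⟩ := this.exists
    exact ⟨η, h2, h1⟩
  filter_upwards [hbd η hη] with n hn
  have : (fun x => J n f x - f x) = K.indicator (fun x => J n f x - f x) := by
    ext x
    by_cases hx : x ∈ K
    · simp [hx]
    · rw [indicator_of_notMem hx, hsupp n x hx]
  rw [this, eLpNorm_indicator_eq_eLpNorm_restrict hKc.isClosed.measurableSet]
  refine (eLpNorm_le_of_ae_bound (C := η) (Eventually.of_forall hn)).trans ?_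
  simpa [mul_comm] using hle

/-- Mollifications converge in `L²`. -/
lemma J_tendsto_eLpNorm {f : Space d → ℝ} (hf : MemLp f 2 volume) :
    Tendsto (fun n => eLpNorm (fun x => J n f x - f x) 2 volume) atTop (𝓝 0) := by
  rw [ENNReal.tendsto_nhds_zero]
  intro ε hε
  obtain ⟨g, hgc, hfg, hg, hgL⟩ := hf.exists_hasCompactSupport_eLpNorm_sub_le (by norm_num)
    (ε := ε / 3) (ENNReal.div_pos hε.ne' (by norm_num)).ne'
  have h := J_tendsto_of_test hg hgc
  rw [ENNReal.tendsto_nhds_zero] at h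
  filter_upwards [h (ε / 3) (ENNReal.div_pos hε.ne' (by norm_num))] with n hn
  have hsub : MemLp (fun x => f x - g x) 2 volume := hf.sub hgL
  have e : (fun x => J n f x - f x) =
      (J n (fun x => f x - g x) + fun x => J n g x - g x) + (g - f) := by
    ext x
    have h1 := moll_add (rho_isTest n) hsub.locInt hgL.locInt x
    simp only [sub_add_cancel] at h1
    simp only [Pi.add_apply, Pi.sub_apply, J] at h1 ⊢
    rw [h1]; ring
  have m1 : AEStronglyMeasurable (J n (fun x => f x - g x)) volume :=
    (moll_contDiff (rho_isTest n) hsub.locInt).continuous.aestronglyMeasurable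
  have m2 : AEStronglyMeasurable (fun x => J n g x - g x) volume :=
    ((moll_contDiff (rho_isTest n) hgL.locInt).continuous.sub hg).aestronglyMeasurable
  rw [e]
  calc _ ≤ eLpNorm (J n (fun x => f x - g x)) 2 volume
        + eLpNorm (fun x => J n g x - g x) 2 volume + eLpNorm (g - f) 2 volume :=
        (eLpNorm_add_le (m1.add m2) (hgL.1.sub hf.1) (by norm_num)).trans
          (add_le_add_left (eLpNorm_add_le m1 m2 (by norm_num)) _)
    _ ≤ ε / 3 + ε / 3 + ε / 3 := by
        refine add_le_add (add_le_add ((J_eLpNorm_le hsub.1 n).trans hfg) hn) ?_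
        rw [eLpNorm_sub_comm]; exact hfg
    _ = ε := ENNReal.add_thirds ε

/-- Pairings with mollifications converge. -/
lemma J_tendsto_integral {f g : Space d → ℝ} (hf : MemLp f 2 volume) (hg : MemLp g 2 volume) :
    Tendsto (fun n => ∫ x, f x * J n g x) atTop (𝓝 (∫ x, f x * g x)) := by
  have h1 : ∀ n, ∫ x, f x * J n g x - f x * g x = (∫ x, f x * J n g x) - ∫ x, f x * g x :=
    fun n => integral_sub (hf.integrable_mul (moll_memLp (rho_isTest n) hg)) (hf.integrable_mul hg)
  rw [← tendsto_sub_nhds_zero_iff]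
  simp only [← h1]
  rw [tendsto_zero_iff_norm_tendsto_zero]
  have hlim : Tendsto (fun n => (eLpNorm f 2 volume *
      eLpNorm (fun x => J n g x - g x) 2 volume).toReal) atTop (𝓝 0) := by
    have := ENNReal.Tendsto.const_mul (a := eLpNorm f 2 volume) (J_tendsto_eLpNorm hg)
      (Or.inr hf.2.ne)
    rw [mul_zero] at this
    exact (ENNReal.tendsto_toReal ENNReal.zero_ne_top).comp this
  refine squeeze_zero (fun _ => norm_nonneg _) (fun n => ?_) hlim
  have hm : MemLp (fun x => J n g x - g x) 2 volume := (moll_memLp (rho_isTest n) hg).sub hg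
  rw [← toReal_enorm]
  refine ENNReal.toReal_mono (ENNReal.mul_lt_top hf.2 hm.2).ne ?_
  refine (enorm_integral_le_lintegral_enorm _).trans ?_
  have := eLpNorm_smul_le_mul_eLpNorm (p := 2) (q := 2) (r := 1) hm.1 hf.1
  rw [eLpNorm_one_eq_lintegral_enorm] at this
  refine le_trans (le_of_eq ?_) this
  congr 1; ext x; simp [mul_sub]

/-- Integration by parts for two functions of class `H¹` along the `i`-th coordinate. Mollifying one
factor moves the derivative onto the even kernel, and the other factor is weakly differentiable. -/
lemma integral_mul_weak {f f' g g' : Space d → ℝ} {i : Fin d} (h : HasWeakPartial i f f')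
    (h' : HasWeakPartial i g g') (hf : MemLp f 2 volume) (hf' : MemLp f' 2 volume)
    (hg : MemLp g 2 volume) (hg' : MemLp g' 2 volume) :
    ∫ x, f x * g' x = - ∫ x, f' x * g x := by
  have key : ∀ n, ∫ x, f x * J n g' x = - ∫ x, f' x * J n g x := by
    intro n
    have hρ := rho_isTest (d := d) n
    have e : (fun x => J n g' x) = moll (partialD i (rho d n)) g := by
      ext x; exact (h'.moll hρ x).symm
    have hk : (fun z => partialD i (rho d n) (-z)) = fun z => (-1) * partialD i (rho d n) z := by
      ext z
      have := partialD_comp_neg hρ.differentiable i z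
      simp only [rho_neg] at this
      linarith
    calc ∫ x, f x * J n g' x = ∫ x, moll (partialD i (rho d n)) g x * f x := by
          simp only [← e, mul_comm]
      _ = ∫ x, g x * moll (fun z => partialD i (rho d n) (-z)) f x :=
          integral_moll_mul (hρ.partialD i) hg hf
      _ = - ∫ x, g x * moll (partialD i (rho d n)) f x := by
          rw [hk, ← integral_neg]
          congr 1; ext x
          unfold moll
          simp only [mul_assoc, integral_const_mul]; ring
      _ = - ∫ x, g x * J n f' x := by
          congr 2; ext x; rw [h.moll hρ x]
      _ = - ∫ x, f' x * J n g x := by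
          rw [← J_transpose hf' hg n]
          simp only [mul_comm]
  refine tendsto_nhds_unique (J_tendsto_integral hf hg') ?_
  simp only [key]
  exact (J_tendsto_integral hf' hg).neg

/-- Product of a weakly differentiable function and a test function. -/
lemma HasWeakPartial.mul_test {f f' φ : Space d → ℝ} {i : Fin d} (h : HasWeakPartial i f f')
    (hφ : IsTest φ) :
    HasWeakPartial i (fun x => f x * φ x) (fun x => f' x * φ x + f x * partialD i φ x) := by
  refine ⟨(hφ.integrable_mul h.1).locallyIntegrable,
    ((hφ.integrable_mul h.2).add ((hφ.partialD i).integrable_mul h.1)).locallyIntegrable,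
    fun ψ h1 h2 => ?_⟩
  have hψ : IsTest ψ := ⟨h1, h2⟩
  have e := h.test (hφ.mul hψ)
  simp only [partialD_mul hφ.differentiable hψ.differentiable, mul_add] at e
  rw [integral_add (((hφ.partialD i).mul hψ).integrable_mul h.1)
    ((hφ.mul (hψ.partialD i)).integrable_mul h.1)] at e
  simp only [add_mul]
  rw [integral_add (by simpa [mul_assoc] using (hφ.mul hψ).integrable_mul h.2)
    (by simpa [mul_assoc] using ((hφ.partialD i).mul hψ).integrable_mul h.1)]
  simp only [mul_assoc] at e ⊢
  linarith

lemma IsTest.memLp_mul {f φ : Space d → ℝ} (hφ : IsTest φ) (hf : MemLp f 2 volume) :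
    MemLp (fun x => f x * φ x) 2 volume :=
  (hφ.memLp ⊤).mul hf

/-- Product rule for weak derivatives of functions of class `H¹`. -/
lemma HasWeakPartial.mul {f f' g g' : Space d → ℝ} {i : Fin d} (h : HasWeakPartial i f f')
    (h' : HasWeakPartial i g g') (hf : MemLp f 2 volume) (hf' : MemLp f' 2 volume)
    (hg : MemLp g 2 volume) (hg' : MemLp g' 2 volume) :
    HasWeakPartial i (fun x => f x * g x) (fun x => f' x * g x + f x * g' x) := by
  refine ⟨(integrable_mul2 hf hg).locallyIntegrable,
    ((integrable_mul2 hf' hg).add (integrable_mul2 hf hg')).locallyIntegrable, fun φ h1 h2 => ?_⟩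
  have hφ : IsTest φ := ⟨h1, h2⟩
  have e := integral_mul_weak h (h'.mul_test hφ) hf hf' (hφ.memLp_mul hg)
    ((hφ.memLp_mul hg').add ((hφ.partialD i).memLp_mul hg))
  simp only [mul_add, add_mul, ← mul_assoc] at e ⊢
  rw [integral_add (by simpa [mul_assoc] using integrable_mul2 hf (hφ.memLp_mul hg'))
    (by simpa [mul_assoc] using integrable_mul2 hf ((hφ.partialD i).memLp_mul hg))] at e
  rw [integral_add (by simpa [mul_assoc] using integrable_mul2 hf' (hφ.memLp_mul hg))
    (by simpa [mul_assoc] using integrable_mul2 hf (hφ.memLp_mul hg'))]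
  linarith

/-! ### Solenoidal fields -/

/-- A square integrable function on `ℝᵈ`, `d ≥ 1`, that is harmonic in the sense of distributions
vanishes: the gradient of its mollifications vanishes by integration by parts, and the only constant
in `L²(ℝᵈ)` is zero. -/
lemma ae_eq_zero_of_weak_harmonic [Nonempty (Fin d)] {f : Space d → ℝ} (hf : MemLp f 2 volume)
    (h : ∀ φ : Space d → ℝ, IsTest φ → ∑ j, ∫ x, f x * partialD j (partialD j φ) x = 0) :
    f =ᵐ[volume] 0 := by
  have key : ∀ n x, J n f x = 0 := by
    intro n
    have hρ := rho_isTest (d := d) n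
    have hc : ContDiff ℝ ∞ (J n f) := moll_contDiff hρ hf.locInt
    have e1 : ∀ j, partialD j (J n f) = moll (partialD j (rho d n)) f := fun j => by
      ext x; exact partialD_moll hρ hf.locInt j x
    have e2 : ∀ j, partialD j (moll (partialD j (rho d n)) f) =
        moll (partialD j (partialD j (rho d n))) f := fun j => by
      ext x; exact partialD_moll (hρ.partialD j) hf.locInt j x
    have w1 : ∀ j, HasWeakPartial j (J n f) (moll (partialD j (rho d n)) f) := fun j => by
      rw [← e1]; exact hasWeakPartial_of_contDiff hc j
    have w2 : ∀ j, HasWeakPartial j (moll (partialD j (rho d n)) f)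
        (moll (partialD j (partialD j (rho d n))) f) := fun j => by
      rw [← e2]; exact hasWeakPartial_of_contDiff (moll_contDiff (hρ.partialD j) hf.locInt) j
    have m0 := moll_memLp hρ hf
    have m1 := fun j => moll_memLp (hρ.partialD j) hf
    have m2 := fun j => moll_memLp ((hρ.partialD j).partialD j) hf
    have hlap : ∀ x, ∑ j, moll (partialD j (partialD j (rho d n))) f x = 0 := by
      intro x
      rw [← h _ (hρ.comp_sub x)]
      refine Finset.sum_congr rfl fun j _ => ?_
      unfold moll
      congr 1; ext y
      have : partialD j (fun y => rho d n (x - y)) = fun y => - partialD j (rho d n) (x - y) := by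
        ext y; exact partialD_comp_sub hρ.differentiable j x y
      rw [this, partialD_neg, partialD_comp_sub (hρ.partialD j).differentiable]
      ring
    have hz : ∑ j, ∫ x, moll (partialD j (rho d n)) f x * moll (partialD j (rho d n)) f x = 0 := by
      have : ∀ j, ∫ x, moll (partialD j (rho d n)) f x * moll (partialD j (rho d n)) f x =
          - ∫ x, J n f x * moll (partialD j (partialD j (rho d n))) f x := fun j => by
        rw [integral_mul_weak (w1 j) (w2 j) m0 (m1 j) (m1 j) (m2 j), neg_neg]
      simp only [this, Finset.sum_neg_distrib]
      rw [← integral_finsetSum _ fun j _ => integrable_mul2 m0 (m2 j)]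
      simp only [← Finset.mul_sum, hlap]
      simp
    have hz' : ∀ j x, moll (partialD j (rho d n)) f x = 0 := by
      intro j x
      have h1 := (Finset.sum_eq_zero_iff_of_nonneg
        (fun j _ => integral_nonneg fun x => mul_self_nonneg _)).1 hz j (Finset.mem_univ j)
      rw [integral_eq_zero_iff_of_nonneg (fun x => mul_self_nonneg _)
        (integrable_mul2 (m1 j) (m1 j))] at h1
      have h2 := (Continuous.ae_eq_iff_eq volume
        ((moll_contDiff (hρ.partialD j) hf.locInt).continuous.mul
          (moll_contDiff (hρ.partialD j) hf.locInt).continuous) continuous_const).1 h1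
      exact mul_self_eq_zero.1 (congrFun h2 x)
    have hconst : ∀ x y, J n f x = J n f y := by
      apply is_const_of_fderiv_eq_zero (𝕜 := ℝ) (hc.differentiable (by simp))
      intro x
      refine ContinuousLinearMap.coe_injective ((EuclideanSpace.basisFun (Fin d) ℝ).toBasis.ext
        fun j => ?_)
      have := congrFun (e1 j) x
      rw [hz' j x] at this
      simpa [partialD] using this
    have hm : MemLp (fun _ : Space d => J n f 0) 2 volume := by
      convert m0 using 1; ext x; exact hconst 0 x
    rw [memLp_const_iff (by norm_num) (by norm_num)] at hm
    have : (volume : Measure (Space d)) univ = ⊤ := measure_univ_of_isAddLeftInvariant _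
    intro x
    rw [hconst x 0]
    simpa [this] using hm
  filter_upwards [J_tendsto_ae hf.locInt] with x hx
  simp only [key] at hx
  exact (tendsto_nhds_unique hx tendsto_const_nhds)

/-- A square integrable solenoidal field that is orthogonal to all solenoidal test fields
vanishes: it is both divergence and curl free, hence harmonic. -/
lemma ae_eq_zero_of_solenoidal_of_orthogonal {f : Fin d → Space d → ℝ}
    (hf : ∀ i, MemLp (f i) 2 volume)
    (hdiv : ∀ φ, IsTest φ → ∑ i, ∫ x, f i x * partialD i φ x = 0)
    (horth : ∀ v : Fin d → Space d → ℝ, (∀ i, IsTest (v i)) → (∀ x, ∑ i, partialD i (v i) x = 0) →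
      ∑ i, ∫ x, f i x * v i x = 0) (i : Fin d) : f i =ᵐ[volume] 0 := by
  have : Nonempty (Fin d) := ⟨i⟩
  refine ae_eq_zero_of_weak_harmonic (hf i) fun φ hφ => ?_
  rw [← hdiv _ (hφ.partialD i)]
  refine Finset.sum_congr rfl fun j _ => ?_
  set ψ := partialD j φ with hψ
  have hψt : IsTest ψ := hφ.partialD j
  have e : partialD j (partialD i φ) = partialD i ψ := by
    ext x; exact partialD_comm hφ.contDiff j i x
  rw [e]
  by_cases hij : i = j
  · subst hij; rfl
  -- the solenoidal test field `∂ⱼψ eᵢ - ∂ᵢψ eⱼ` shows that `f` is curl free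
  have h1 := horth (fun m => if m = i then partialD j ψ else if m = j then
    (fun x => - partialD i ψ x) else fun _ => 0) ?_ ?_
  · rw [← Finset.add_sum_erase _ _ (Finset.mem_univ i), ← Finset.add_sum_erase _ _
      (Finset.mem_erase.2 ⟨Ne.symm hij, Finset.mem_univ j⟩), Finset.sum_eq_zero] at h1
    · simp only [if_true, if_neg (Ne.symm hij), mul_neg, integral_neg] at h1
      linarith
    · intro m hm
      simp only [Finset.mem_erase] at hm
      simp [hm.1, hm.2.1]
  · intro m
    split_ifs
    exacts [hψt.partialD j, (hψt.partialD i).neg, IsTest.zero]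
  · intro x
    rw [← Finset.add_sum_erase _ _ (Finset.mem_univ i), ← Finset.add_sum_erase _ _
      (Finset.mem_erase.2 ⟨Ne.symm hij, Finset.mem_univ j⟩), Finset.sum_eq_zero]
    · simp only [if_true, if_neg (Ne.symm hij)]
      rw [partialD_neg, partialD_comm hψt.contDiff]; ring
    · intro m hm
      simp only [Finset.mem_erase] at hm
      simp [hm.1, hm.2.1, partialD]

/-- The Hilbert space `L²(ℝᵈ)`. -/
abbrev L2 (d : ℕ) : Type := Lp ℝ 2 (volume : Measure (Space d))

/-- The Hilbert space of square integrable vector fields. -/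
abbrev VL2 (d : ℕ) : Type := PiLp 2 (fun _ : Fin d => L2 d)

open Classical in
/-- The class in `L²` of a function (and `0` if the function is not square integrable). -/
noncomputable def toL2 (f : Space d → ℝ) : L2 d := if h : MemLp f 2 volume then h.toLp f else 0

lemma toL2_eq {f : Space d → ℝ} (h : MemLp f 2 volume) : toL2 f = h.toLp f := dif_pos h

lemma toL2_coe {f : Space d → ℝ} (h : MemLp f 2 volume) : toL2 f =ᵐ[volume] f := by
  rw [toL2_eq h]; exact h.coeFn_toLp

lemma toL2_congr {f g : Space d → ℝ} (h : f =ᵐ[volume] g) : toL2 f = toL2 g := by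
  unfold toL2
  by_cases hf : MemLp f 2 volume
  · have hg := hf.ae_eq h
    rw [dif_pos hf, dif_pos hg]
    exact (MemLp.toLp_eq_toLp_iff _ _).2 h
  · rw [dif_neg hf, dif_neg fun hg => hf (hg.ae_eq h.symm)]

lemma toL2_coeFn (f : L2 d) : toL2 (f : Space d → ℝ) = f := by
  rw [toL2_eq (Lp.memLp f)]; exact Lp.toLp_coeFn f _

lemma toL2_inj {f g : Space d → ℝ} (hf : MemLp f 2 volume) (hg : MemLp g 2 volume)
    (h : toL2 f = toL2 g) : f =ᵐ[volume] g := by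
  have := toL2_coe hf
  rw [h] at this
  exact this.symm.trans (toL2_coe hg)

lemma inner_L2 (f g : L2 d) : inner ℝ f g = ∫ x, f x * g x := by
  rw [L2.inner_def]
  congr 1; ext x; simp [mul_comm]

lemma inner_toL2 {f g : Space d → ℝ} (hf : MemLp f 2 volume) (hg : MemLp g 2 volume) :
    inner ℝ (toL2 f) (toL2 g) = ∫ x, f x * g x := by
  rw [inner_L2]
  exact integral_congr_ae (by
    filter_upwards [toL2_coe hf, toL2_coe hg] with x h1 h2; rw [h1, h2])

lemma toL2_add {f g : Space d → ℝ} (hf : MemLp f 2 volume) (hg : MemLp g 2 volume) :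
    toL2 (fun x => f x + g x) = toL2 f + toL2 g := by
  rw [toL2_eq hf, toL2_eq hg]; exact toL2_eq (hf.add hg)

lemma toL2_sub {f g : Space d → ℝ} (hf : MemLp f 2 volume) (hg : MemLp g 2 volume) :
    toL2 (fun x => f x - g x) = toL2 f - toL2 g := by
  rw [toL2_eq hf, toL2_eq hg]; exact toL2_eq (hf.sub hg)

lemma toL2_const_mul {f : Space d → ℝ} (hf : MemLp f 2 volume) (c : ℝ) :
    toL2 (fun x => c * f x) = c • toL2 f := by
  rw [toL2_eq hf]; exact toL2_eq (hf.const_mul c)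

lemma norm_toL2_sq {f : Space d → ℝ} (hf : MemLp f 2 volume) :
    ‖toL2 f‖ ^ 2 = ∫ x, f x ^ 2 := by
  rw [← real_inner_self_eq_norm_sq, inner_toL2 hf hf]
  simp only [sq]

lemma norm_toL2 {f : Space d → ℝ} (hf : MemLp f 2 volume) :
    ‖toL2 f‖ = (eLpNorm f 2 volume).toReal := by
  rw [toL2_eq hf, Lp.norm_toLp]

/-- The class in `L²` of a vector field; components that are not square integrable are replaced by
`0`. -/
noncomputable def toV (f : Fin d → Space d → ℝ) : VL2 d := WithLp.toLp 2 fun i => toL2 (f i)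

@[simp] lemma toV_apply (f : Fin d → Space d → ℝ) (i : Fin d) : toV f i = toL2 (f i) := rfl

lemma inner_toV {f g : Fin d → Space d → ℝ} (hf : ∀ i, MemLp (f i) 2 volume)
    (hg : ∀ i, MemLp (g i) 2 volume) : inner ℝ (toV f) (toV g) = ∑ i, ∫ x, f i x * g i x := by
  rw [PiLp.inner_apply]
  exact Finset.sum_congr rfl fun i _ => inner_toL2 (hf i) (hg i)

lemma toV_coeFn (f : VL2 d) : toV (fun i => (f i : Space d → ℝ)) = f := by
  ext1 i; simp [toL2_coeFn]

/-- The closed subspace of solenoidal fields: the orthogonal complement of all gradients of test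
functions. -/
noncomputable def Lsigma (d : ℕ) : Submodule ℝ (VL2 d) :=
  (Submodule.span ℝ {g | ∃ φ : Space d → ℝ, IsTest φ ∧ g = toV fun i => partialD i φ})ᗮ

instance : (Lsigma d).HasOrthogonalProjection := by
  have : CompleteSpace (Lsigma d) :=
    (Submodule.isClosed_orthogonal _).completeSpace_coe
  infer_instance

lemma mem_Lsigma_iff {f : Fin d → Space d → ℝ} (hf : ∀ i, MemLp (f i) 2 volume) :
    toV f ∈ Lsigma d ↔ ∀ φ, IsTest φ → ∑ i, ∫ x, f i x * partialD i φ x = 0 := by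
  have e : ∀ φ, IsTest φ → inner ℝ (toV f) (toV fun i => partialD i φ) =
      ∑ i, ∫ x, f i x * partialD i φ x := fun φ hφ =>
    inner_toV hf fun i => (hφ.partialD i).memLp 2
  constructor
  · intro h φ hφ
    rw [← e φ hφ, real_inner_comm]
    exact h _ (Submodule.subset_span ⟨φ, hφ, rfl⟩)
  · intro h
    rw [Lsigma, Submodule.mem_orthogonal']
    intro g hg
    induction hg using Submodule.span_induction with
    | mem x hx => obtain ⟨φ, hφ, rfl⟩ := hx; rw [e φ hφ, h φ hφ]
    | zero => simp
    | add x y _ _ hx hy => rw [inner_add_right, hx, hy, add_zero]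
    | smul a x _ hx => rw [inner_smul_right, hx, mul_zero]

lemma weaklyDivFree_iff {u : Space d → Space d} (hu : ∀ i, MemLp (fun x => u x i) 2 volume) :
    WeaklyDivFree u ↔ toV (fun i x => u x i) ∈ Lsigma d := by
  rw [mem_Lsigma_iff hu]
  have : ∀ φ, IsTest φ → ∫ x, ∑ i, u x i * partialD i φ x = ∑ i, ∫ x, u x i * partialD i φ x :=
    fun φ hφ => integral_finsetSum _ fun i _ => (hφ.partialD i).integrable_mul (hu i).locInt
  exact ⟨fun h φ hφ => by rw [← this φ hφ]; exact h φ hφ.1 hφ.2,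
    fun h φ h1 h2 => by rw [this φ ⟨h1, h2⟩]; exact h φ ⟨h1, h2⟩⟩

/-- A solenoidal test field. -/
structure IsSolTest (v : Fin d → Space d → ℝ) : Prop where
  test : ∀ i, IsTest (v i)
  div : ∀ x, ∑ i, partialD i (v i) x = 0

lemma IsSolTest.mem_Lsigma {v : Fin d → Space d → ℝ} (hv : IsSolTest v) : toV v ∈ Lsigma d := by
  rw [mem_Lsigma_iff fun i => (hv.test i).memLp 2]
  intro φ hφ
  have : ∀ i, ∫ x, v i x * partialD i φ x = - ∫ x, partialD i (v i) x * φ x := fun i =>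
    (hasWeakPartial_of_contDiff (hv.test i).contDiff i).test hφ
  simp only [this, Finset.sum_neg_distrib]
  rw [← integral_finsetSum _ fun i _ =>
    hφ.integrable_mul ((hv.test i).partialD i).continuous.locallyIntegrable]
  simp only [← Finset.sum_mul, hv.div]
  simp

/-- The Leray projection. -/
noncomputable def leray (d : ℕ) : VL2 d →L[ℝ] VL2 d := (Lsigma d).starProjection

/-- Solenoidal test fields are dense in `Lsigma`, in the dual formulation. -/
lemma leray_eq_zero {h : VL2 d} (hh : ∀ v, IsSolTest v → inner ℝ h (toV v) = 0) :
    leray d h = 0 := by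
  set g := leray d h with hg
  have hgm : g ∈ Lsigma d := Submodule.starProjection_apply_mem _ _
  have hmem : ∀ i, MemLp (g i : Space d → ℝ) 2 volume := fun i => Lp.memLp _
  have horth : ∀ v, IsSolTest v → inner ℝ g (toV v) = 0 := fun v hv => by
    rw [hg, leray, Submodule.inner_starProjection_left_eq_right,
      Submodule.starProjection_eq_self_iff.2 hv.mem_Lsigma, hh v hv]
  rw [← toV_coeFn g] at hgm
  rw [mem_Lsigma_iff hmem] at hgm
  have := ae_eq_zero_of_solenoidal_of_orthogonal hmem hgm fun v h1 h2 => by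
    have := horth v ⟨h1, h2⟩
    rw [← toV_coeFn g, inner_toV hmem fun i => (h1 i).memLp 2] at this
    exact this
  ext1 i
  exact (Lp.eq_zero_iff_ae_eq_zero).2 (this i)

/-- Solenoidal square integrable fields are orthogonal to square integrable gradients. -/
lemma sum_integral_mul_grad_eq_zero {U G : Fin d → Space d → ℝ} {p : Space d → ℝ}
    (hU : ∀ i, MemLp (U i) 2 volume) (hU' : toV U ∈ Lsigma d)
    (hG : ∀ i, MemLp (G i) 2 volume) (hp : ∀ i, HasWeakPartial i p (G i)) :
    ∑ i, ∫ x, U i x * G i x = 0 := by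
  have h0 : leray d (toV G) = 0 := by
    refine leray_eq_zero fun v hv => ?_
    rw [inner_toV hG fun i => (hv.test i).memLp 2]
    have : ∀ i, ∫ x, G i x * v i x = - ∫ x, p x * partialD i (v i) x := fun i => by
      rw [(hp i).test (hv.test i), neg_neg]
    simp only [this, Finset.sum_neg_distrib]
    rw [← integral_finsetSum _ fun i _ => ((hv.test i).partialD i).integrable_mul (hp i).1]
    simp only [← Finset.mul_sum, hv.div]
    simp
  rw [← inner_toV hU hG, ← Submodule.starProjection_eq_self_iff.2 hU',
    Submodule.inner_starProjection_left_eq_right]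
  change inner ℝ _ (leray d (toV G)) = 0
  rw [h0, inner_zero_right]

/-! ### The Sobolev embedding `H² ⊂ L^∞` in dimension at most three -/

section Sobolev
open scoped SchwartzMap FourierTransform LineDeriv Laplacian
open SchwartzMap

/-- The symbol `(1 + |ξ|²)⁻¹` of the resolvent of the Laplacian. -/
noncomputable def resolventSymbol (d : ℕ) (ξ : Space d) : ℝ := (1 + ‖ξ‖ ^ 2) ^ (-1 : ℝ)

lemma resolventSymbol_growth : (resolventSymbol d).HasTemperateGrowth :=
  Function.hasTemperateGrowth_one_add_norm_sq_rpow (Space d) (-1)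

/-- The solution operator of `ψ - (2π)⁻² Δ ψ = φ`; the factor `(2π)⁻²` is due to the normalization
of the Fourier transform. -/
noncomputable def resolvent (φ : 𝓢(Space d, ℂ)) : 𝓢(Space d, ℂ) :=
  fourierMultiplierCLM ℂ (resolventSymbol d) φ

lemma resolvent_eq (φ : 𝓢(Space d, ℂ)) :
    resolvent φ - (1 / (2 * Real.pi) ^ 2 : ℝ) • Δ (resolvent φ) = φ := by
  have hg : (fun ξ : Space d => ‖ξ‖ ^ 2).HasTemperateGrowth := by fun_prop
  have h1 : (fun _ : Space d => (1 : ℝ)).HasTemperateGrowth := by fun_prop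
  have h2 : fourierMultiplierCLM ℂ ((fun _ : Space d => (1 : ℝ)) + fun ξ => ‖ξ‖ ^ 2)
      (resolvent φ) = φ := by
    rw [resolvent, fourierMultiplierCLM_fourierMultiplierCLM_apply (h1.add hg)
      resolventSymbol_growth]
    have : ((fun _ : Space d => (1 : ℝ)) + fun ξ => ‖ξ‖ ^ 2) * resolventSymbol d =
        fun _ => (1 : ℝ) := by
      ext ξ
      have : (1 + ‖ξ‖ ^ 2 : ℝ) ≠ 0 := by positivity
      simp [resolventSymbol, Real.rpow_neg_one, this]
    rw [this, fourierMultiplierCLM_const]; simp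
  have h3 : fourierMultiplierCLM ℂ ((fun _ : Space d => (1 : ℝ)) + fun ξ => ‖ξ‖ ^ 2)
      (resolvent φ) = resolvent φ + fourierMultiplierCLM ℂ (fun ξ => ‖ξ‖ ^ 2) (resolvent φ) := by
    rw [fourierMultiplierCLM_apply, smulLeftCLM_add h1 hg]
    simp [FourierTransform.fourierInv_add, fourierMultiplierCLM_apply]
  have h4 := laplacian_eq_fourierMultiplierCLM (resolvent φ)
  have h5 : (‖·‖ ^ 2 : Space d → ℝ) = fun ξ => ‖ξ‖ ^ 2 := rfl
  rw [h5] at h4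
  rw [h4, smul_smul]
  have : (1 / (2 * Real.pi) ^ 2 : ℝ) * -(2 * Real.pi) ^ 2 = -1 := by
    have : Real.pi ≠ 0 := Real.pi_ne_zero
    field_simp
  rw [this, neg_one_smul, sub_neg_eq_add, ← h3, h2]

lemma resolventSymbol_sq_integrable (hd : d ≤ 3) :
    Integrable (fun ξ : Space d => resolventSymbol d ξ ^ 2) volume := by
  have := integrable_rpow_neg_one_add_norm_sq (E := Space d) (μ := volume) (r := 4) (by
    rw [finrank_euclideanSpace_fin]
    have : (d : ℝ) ≤ 3 := by exact_mod_cast hd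
    linarith)
  refine this.congr (Eventually.of_forall fun ξ => ?_)
  simp only [resolventSymbol]
  rw [← Real.rpow_mul_natCast (by positivity)]
  norm_num

/-- Square of the `L²` norm of the resolvent symbol. -/
noncomputable def resolventConst (d : ℕ) : ℝ := ∫ ξ : Space d, resolventSymbol d ξ ^ 2

/-- The resolvent maps `L¹` to `L²` if `d ≤ 3`, by Plancherel: the Fourier transform of `φ` is
bounded by the `L¹` norm, and the symbol is square integrable. -/
lemma integral_norm_sq_resolvent_le (hd : d ≤ 3) (φ : 𝓢(Space d, ℂ)) :
    ∫ x, ‖resolvent φ x‖ ^ 2 ≤ resolventConst d * (∫ x, ‖φ x‖) ^ 2 := by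
  rw [← integral_norm_sq_fourier, resolventConst, ← integral_mul_const]
  refine integral_mono_of_nonneg (Eventually.of_forall fun _ => by positivity)
    ((resolventSymbol_sq_integrable hd).mul_const _) (Eventually.of_forall fun ξ => ?_)
  have h1 : 𝓕 (resolvent φ) ξ = resolventSymbol d ξ • 𝓕 φ ξ := by
    rw [resolvent, fourierMultiplierCLM_apply, FourierTransform.fourier_fourierInv_eq,
      smulLeftCLM_apply_apply resolventSymbol_growth]
  have h2 : ‖𝓕 φ ξ‖ ≤ ∫ x, ‖φ x‖ := by
    simpa [norm_toLp_one] using norm_fourier_apply_le_toLp_one φ ξ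
  simp only [h1, norm_smul, mul_pow, Real.norm_eq_abs, sq_abs]
  gcongr

lemma hasWeakPartial_re (ψ : 𝓢(Space d, ℂ)) (i : Fin d) :
    HasWeakPartial i (fun x => (ψ x).re)
      (fun x => ((∂_{(EuclideanSpace.single i (1 : ℝ) : Space d)} ψ) x).re) := by
  have hc : ContDiff ℝ ∞ (fun x => (ψ x).re) := Complex.reCLM.contDiff.comp (ψ.smooth ⊤)
  have e : partialD i (fun x => (ψ x).re) =
      (fun x => ((∂_{(EuclideanSpace.single i (1 : ℝ) : Space d)} ψ) x).re) := by
    ext x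
    unfold partialD
    rw [lineDerivOp_apply_eq_fderiv]
    have := (Complex.reCLM.hasFDerivAt (x := ψ x)).comp x (ψ.hasFDerivAt x)
    have h2 : HasFDerivAt (fun x => (ψ x).re) (Complex.reCLM.comp (fderiv ℝ ψ x)) x := this
    rw [h2.fderiv]; rfl
  rw [← e]
  exact hasWeakPartial_of_contDiff hc i

lemma memLp_re (ψ : 𝓢(Space d, ℂ)) : MemLp (fun x => (ψ x).re) 2 volume := (ψ.memLp 2).re

/-- A function bounded, as a functional on test functions, by the `L¹` norm is bounded. -/
lemma ae_abs_le_of_integral_le {f : Space d → ℝ} (hf : LocallyIntegrable f volume) {M : ℝ}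
    (h : ∀ φ, IsTest φ → |∫ x, f x * φ x| ≤ M * ∫ x, |φ x|) : ∀ᵐ x, |f x| ≤ M := by
  have key : ∀ n x, |J n f x| ≤ M := by
    intro n x
    have := h _ ((rho_isTest n).comp_sub x)
    have e : ∫ y, |rho d n (x - y)| = 1 := by
      simp only [abs_of_nonneg (rho_nonneg n _)]
      rw [integral_comp_sub_left (rho d n) x, rho_integral]
    rw [e, mul_one] at this
    simpa [moll, mul_comm] using this
  filter_upwards [J_tendsto_ae hf] with x hx
  exact le_of_tendsto hx.abs (Eventually.of_forall fun n => key n x)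

lemma integral_mul_le_norm {f g : Space d → ℝ} (hf : MemLp f 2 volume) (hg : MemLp g 2 volume) :
    |∫ x, f x * g x| ≤ ‖toL2 f‖ * ‖toL2 g‖ := by
  rw [← inner_toL2 hf hg]
  exact abs_real_inner_le_norm _ _

/-- Sobolev embedding `H² ⊂ L^∞` for `d ≤ 3`, by duality: for a test function `φ` with resolvent
`ψ`, `∫ f φ = ∫ (f - (2π)⁻² Δ f) ψ`, and the `L²` norm of `ψ` is bounded by the `L¹` norm of `φ`. -/
lemma ae_abs_le_of_H2 (hd : d ≤ 3) {f : Space d → ℝ} {f1 f2 : Fin d → Space d → ℝ}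
    (hf : MemLp f 2 volume) (hf1 : ∀ j, MemLp (f1 j) 2 volume) (hf2 : ∀ j, MemLp (f2 j) 2 volume)
    (h1 : ∀ j, HasWeakPartial j f (f1 j)) (h2 : ∀ j, HasWeakPartial j (f1 j) (f2 j)) :
    ∀ᵐ x, |f x| ≤ √(resolventConst d) * (‖toL2 f‖ + ∑ j, ‖toL2 (f2 j)‖) := by
  refine ae_abs_le_of_integral_le hf.locInt fun φ hφ => ?_
  have hφc : ContDiff ℝ ∞ (fun x => (φ x : ℂ)) := Complex.ofRealCLM.contDiff.comp hφ.contDiff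
  have hφs : HasCompactSupport (fun x => (φ x : ℂ)) :=
    hφ.compact.comp_left (g := Complex.ofReal) (by simp)
  set Φ : 𝓢(Space d, ℂ) := hφs.toSchwartzMap hφc with hΦ
  have hΦx : ∀ x, Φ x = φ x := fun x => rfl
  set ψ := resolvent Φ with hψ
  set c : ℝ := 1 / (2 * Real.pi) ^ 2 with hc
  have hc0 : 0 ≤ c := by positivity
  have hc1 : c ≤ 1 := by
    rw [hc, div_le_one (by positivity)]
    nlinarith [Real.pi_gt_three]
  set e : Fin d → Space d := fun j => EuclideanSpace.single j (1 : ℝ) with he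
  have hpt : ∀ x, φ x = (ψ x).re - c * ∑ j, ((∂_{e j} (∂_{e j} ψ)) x).re := by
    intro x
    have h := congrArg (fun F : 𝓢(Space d, ℂ) => (F x).re) (resolvent_eq Φ)
    rw [laplacian_eq_sum (EuclideanSpace.basisFun (Fin d) ℝ)] at h
    simp only [sub_apply, smul_apply, Complex.sub_re, Complex.smul_re, hΦx,
      Complex.ofReal_re, EuclideanSpace.basisFun_apply, sum_apply, Complex.re_sum] at h
    rw [← h]; rfl
  have hψm := memLp_re ψ
  have hψ1 := fun j => memLp_re (∂_{e j} ψ)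
  have hψ2 := fun j => memLp_re (∂_{e j} (∂_{e j} ψ))
  have hibp : ∀ j, ∫ x, f x * ((∂_{e j} (∂_{e j} ψ)) x).re = ∫ x, f2 j x * (ψ x).re := by
    intro j
    rw [integral_mul_weak (h1 j) (hasWeakPartial_re (∂_{e j} ψ) j) hf (hf1 j) (hψ1 j) (hψ2 j),
      integral_mul_weak (h2 j) (hasWeakPartial_re ψ j) (hf1 j) (hf2 j) hψm (hψ1 j), neg_neg]
  have hmain : ∫ x, f x * φ x = (∫ x, f x * (ψ x).re) - c * ∑ j, ∫ x, f2 j x * (ψ x).re := by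
    simp only [hpt, mul_sub]
    rw [integral_sub (integrable_mul2 hf hψm)]
    · simp only [mul_left_comm _ c, Finset.mul_sum]
      rw [integral_finsetSum _ fun j _ => (integrable_mul2 hf (hψ2 j)).const_mul c]
      simp only [integral_const_mul, hibp]
    · have : (fun x => f x * (c * ∑ j, ((∂_{e j} (∂_{e j} ψ)) x).re)) =
          fun x => ∑ j, c * (f x * ((∂_{e j} (∂_{e j} ψ)) x).re) := by
        ext x; simp only [Finset.mul_sum]; congr 1; ext j; ring
      rw [this]
      exact integrable_finsetSum _ fun j _ => (integrable_mul2 hf (hψ2 j)).const_mul c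
  have hψn : ‖toL2 fun x => (ψ x).re‖ ≤ √(resolventConst d) * ∫ x, |φ x| := by
    have hR : 0 ≤ resolventConst d := integral_nonneg fun _ => by positivity
    have hI : 0 ≤ ∫ x, |φ x| := integral_nonneg fun _ => abs_nonneg _
    refine abs_le_of_sq_le_sq' ?_ (by positivity) |>.2
    rw [norm_toL2_sq hψm, mul_pow, Real.sq_sqrt hR]
    have := integral_norm_sq_resolvent_le hd Φ
    simp only [hΦx, Complex.norm_real, Real.norm_eq_abs] at this
    refine le_trans ?_ this
    refine integral_mono hψm.integrable_sq ((ψ.memLp 2).integrable_norm_pow (by norm_num)) fun x => ?_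
    simp only
    rw [← sq_abs]
    exact pow_le_pow_left₀ (abs_nonneg _) (Complex.abs_re_le_norm _) 2
  rw [hmain]
  calc _ ≤ |∫ x, f x * (ψ x).re| + |c * ∑ j, ∫ x, f2 j x * (ψ x).re| := abs_sub _ _
    _ ≤ ‖toL2 f‖ * ‖toL2 fun x => (ψ x).re‖ +
        ∑ j, ‖toL2 (f2 j)‖ * ‖toL2 fun x => (ψ x).re‖ := by
        refine add_le_add (integral_mul_le_norm hf hψm) ?_
        rw [abs_mul, abs_of_nonneg hc0]
        refine (mul_le_of_le_one_left (abs_nonneg _) hc1).trans ?_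
        exact (Finset.abs_sum_le_sum_abs _ _).trans
          (Finset.sum_le_sum fun j _ => integral_mul_le_norm (hf2 j) hψm)
    _ = (‖toL2 f‖ + ∑ j, ‖toL2 (f2 j)‖) * ‖toL2 fun x => (ψ x).re‖ := by
        rw [← Finset.sum_mul]; ring
    _ ≤ (‖toL2 f‖ + ∑ j, ‖toL2 (f2 j)‖) * (√(resolventConst d) * ∫ x, |φ x|) := by
        have : 0 ≤ ∑ j, ‖toL2 (f2 j)‖ := Finset.sum_nonneg fun _ _ => norm_nonneg _
        gcongr
    _ = _ := by ring

end Sobolev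

/-! ### Functions of time with values in `L²` -/

/-- A function with values in a separable space is measurable if preimages of balls are. -/
lemma measurable_of_ball {α M : Type*} [MeasurableSpace α] [PseudoMetricSpace M]
    [SecondCountableTopology M] [MeasurableSpace M] [BorelSpace M] {F : α → M}
    (h : ∀ c r, 0 < r → MeasurableSet (F ⁻¹' Metric.ball c r)) : Measurable F := by
  have hb : TopologicalSpace.IsTopologicalBasis
      {s : Set M | ∃ c r, 0 < r ∧ s = Metric.ball c r} := by
    refine TopologicalSpace.isTopologicalBasis_of_isOpen_of_nhds ?_ ?_
    · rintro s ⟨c, r, _, rfl⟩; exact Metric.isOpen_ball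
    · intro a u ha hu
      obtain ⟨ε, hε, hs⟩ := Metric.isOpen_iff.1 hu a ha
      exact ⟨_, ⟨a, ε, hε, rfl⟩, Metric.mem_ball_self hε, hs⟩
  rw [BorelSpace.measurable_eq (α := M), hb.borel_eq_generateFrom]
  refine measurable_generateFrom ?_
  rintro s ⟨c, r, hr, rfl⟩
  exact h c r hr

instance : SecondCountableTopology (L2 d) := by
  have : Fact ((2 : ℝ≥0∞) ≠ ⊤) := ⟨by norm_num⟩
  exact Lp.SecondCountableTopology

/-- A jointly measurable function is strongly measurable as an `L²`-valued function of time; at the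
times at which it is not square integrable in space, `toL2` has the value `0`. -/
lemma aestronglyMeasurable_toL2 {ν : Measure ℝ} [SFinite ν] {f : ℝ → Space d → ℝ}
    (hf : AEStronglyMeasurable (uncurry f) (ν.prod volume)) :
    AEStronglyMeasurable (fun t => toL2 (f t)) ν := by
  obtain ⟨g, hg, hfg⟩ := hf
  have hslice : ∀ᵐ t ∂ν, ∀ᵐ x, f t x = g (t, x) := Measure.ae_ae_of_ae_prod hfg
  have hgm : ∀ t, AEStronglyMeasurable (fun x => g (t, x)) volume := fun t =>
    (hg.comp_measurable measurable_prodMk_left).aestronglyMeasurable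
  set G : ℝ → L2 d := fun t => toL2 fun x => g (t, x) with hG
  have hN : ∀ c : L2 d, Measurable fun t => eLpNorm (fun x => g (t, x) - c x) 2 volume := by
    intro c
    have h1 : Measurable fun t => ∫⁻ x, ‖g (t, x) - c x‖ₑ ^ 2 := by
      apply Measurable.lintegral_prod_right' (f := fun p : ℝ × Space d => ‖g p - c p.2‖ₑ ^ 2)
      have : Measurable fun p : ℝ × Space d => c p.2 :=
        (Lp.stronglyMeasurable c).measurable.comp measurable_snd
      exact ((hg.measurable.sub this).enorm.pow_const 2)
    have h2 : (fun t => eLpNorm (fun x => g (t, x) - c x) 2 volume) =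
        fun t => (∫⁻ x, ‖g (t, x) - c x‖ₑ ^ 2) ^ (1 / 2 : ℝ) := by
      ext t
      rw [← eLpNorm_two_sq, ← ENNReal.rpow_natCast, ← ENNReal.rpow_mul]
      norm_num
    rw [h2]; exact h1.pow_const _
  have hA : MeasurableSet {t | MemLp (fun x => g (t, x)) 2 volume} := by
    have : {t | MemLp (fun x => g (t, x)) 2 volume} =
        {t | eLpNorm (fun x => g (t, x) - (0 : L2 d) x) 2 volume < ⊤} := by
      ext t
      have e : eLpNorm (fun x => g (t, x) - (0 : L2 d) x) 2 volume =
          eLpNorm (fun x => g (t, x)) 2 volume := by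
        apply eLpNorm_congr_ae
        filter_upwards [Lp.coeFn_zero ℝ 2 (volume : Measure (Space d))] with x hx
        rw [hx, Pi.zero_apply, sub_zero]
      simp only [mem_ofPred_eq, e]
      exact ⟨fun h => h.2, fun h => ⟨hgm t, h⟩⟩
    rw [this]; exact measurableSet_lt (hN 0) measurable_const
  borelize (L2 d)
  have hGm : Measurable G := by
    refine measurable_of_ball fun c r hr => ?_
    have : G ⁻¹' Metric.ball c r =
        ({t | MemLp (fun x => g (t, x)) 2 volume} ∩
          {t | eLpNorm (fun x => g (t, x) - c x) 2 volume < ENNReal.ofReal r}) ∪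
        ({t | MemLp (fun x => g (t, x)) 2 volume}ᶜ ∩ {_t | dist 0 c < r}) := by
      ext t
      by_cases ht : MemLp (fun x => g (t, x)) 2 volume
      · have e : dist (G t) c = (eLpNorm (fun x => g (t, x) - c x) 2 volume).toReal := by
          have hs : MemLp (fun x => g (t, x) - c x) 2 volume := ht.sub (Lp.memLp c)
          rw [← norm_toL2 hs, toL2_sub ht (Lp.memLp c), toL2_coeFn, dist_eq_norm]
        have hs : eLpNorm (fun x => g (t, x) - c x) 2 volume ≠ ⊤ := (ht.sub (Lp.memLp c)).2.ne
        simp only [mem_preimage, Metric.mem_ball, e, mem_union, mem_inter_iff, mem_ofPred_eq, ht,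
          true_and, mem_compl_iff, not_true, false_and, or_false]
        rw [ENNReal.lt_ofReal_iff_toReal_lt hs]
      · have e : G t = 0 := dif_neg ht
        simp [e, ht]
    rw [this]
    exact (hA.inter (measurableSet_lt (hN c) measurable_const)).union
      (hA.compl.inter (MeasurableSet.const _))
  refine ⟨G, hGm.stronglyMeasurable, ?_⟩
  filter_upwards [hslice] with t ht
  exact toL2_congr ht

/-- The time interval `(0,T)` with Lebesgue measure. -/
noncomputable abbrev timeMeasure (T : ℝ) : Measure ℝ := volume.restrict (Ioo 0 T)

lemma MemLqH.zero {q : ℝ≥0∞} {T : ℝ} {m : ℕ} {f : ℝ → Space d → ℝ} (h : MemLqH q T m f) :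
    AEStronglyMeasurable (uncurry f) ((timeMeasure T).prod volume) ∧
      eLpNorm (fun t => eLpNorm (f t) 2 volume) q (timeMeasure T) < ⊤ := by
  cases m with
  | zero => exact h
  | succ m => exact h.1

lemma MemLqH.exists_partial {q : ℝ≥0∞} {T : ℝ} {m : ℕ} {f : ℝ → Space d → ℝ}
    (h : MemLqH q T (m + 1) f) (i : Fin d) : ∃ g : ℝ → Space d → ℝ,
      (∀ᵐ t ∂(timeMeasure T), HasWeakPartial i (f t) (g t)) ∧ MemLqH q T m g := h.2 i

lemma measurable_eLpNorm_slice {ν : Measure ℝ} [SFinite ν] {f : ℝ → Space d → ℝ}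
    (hf : AEStronglyMeasurable (uncurry f) (ν.prod volume)) :
    AEMeasurable (fun t => eLpNorm (f t) 2 volume) ν := by
  have h1 : AEMeasurable (fun t => ∫⁻ x, ‖f t x‖ₑ ^ 2) ν :=
    (hf.aemeasurable.enorm.pow_const 2).lintegral_prod_right'
  have h2 : (fun t => eLpNorm (f t) 2 volume) =
      fun t => (∫⁻ x, ‖f t x‖ₑ ^ 2) ^ (1 / 2 : ℝ) := by
    ext t
    rw [← eLpNorm_two_sq, ← ENNReal.rpow_natCast, ← ENNReal.rpow_mul]
    norm_num
  rw [h2]; exact h1.pow_const _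

lemma MemLqH.ae_memLp {q : ℝ≥0∞} (hq : 1 ≤ q) {T : ℝ} {m : ℕ} {f : ℝ → Space d → ℝ}
    (h : MemLqH q T m f) : ∀ᵐ t ∂(timeMeasure T), MemLp (f t) 2 volume := by
  obtain ⟨h1, h2⟩ := h.zero
  have hlt : ∀ᵐ t ∂(timeMeasure T), eLpNorm (f t) 2 volume < ⊤ := by
    have hfin : eLpNorm (fun t => eLpNorm (f t) 2 volume) 1 (timeMeasure T) < ⊤ := by
      have hae := (measurable_eLpNorm_slice h1)
      refine lt_of_le_of_lt
        (eLpNorm_le_eLpNorm_mul_rpow_measure_univ hq hae.aestronglyMeasurable) ?_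
      refine ENNReal.mul_lt_top h2 (ENNReal.rpow_lt_top_of_nonneg ?_ (measure_ne_top _ _))
      simp only [ENNReal.toReal_one, div_one, sub_nonneg, one_div]
      rcases eq_or_ne q ⊤ with rfl | hq'
      · simp
      · exact inv_le_one_of_one_le₀ (by simpa using ENNReal.toReal_mono hq' hq)
    rw [eLpNorm_one_eq_lintegral_enorm] at hfin
    exact ae_lt_top' (measurable_eLpNorm_slice h1) (by simpa using hfin.ne)
  filter_upwards [hlt, h1.prodMk_left] with t a b
  exact ⟨b, a⟩

lemma MemLqH.memLp_toL2 {q : ℝ≥0∞} (hq : 1 ≤ q) {T : ℝ} {m : ℕ} {f : ℝ → Space d → ℝ}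
    (h : MemLqH q T m f) : MemLp (fun t => toL2 (f t)) q (timeMeasure T) := by
  have hm := h.ae_memLp hq
  refine ⟨aestronglyMeasurable_toL2 h.zero.1, lt_of_le_of_lt (le_of_eq ?_) h.zero.2⟩
  apply eLpNorm_congr_enorm_ae
  filter_upwards [hm] with t ht
  rw [toL2_eq ht, Lp.enorm_toLp]; rfl

/-! ### A product rule for absolutely continuous Hilbert space valued functions -/

section product
variable {V : Type*} [NormedAddCommGroup V] [InnerProductSpace ℝ V] [CompleteSpace V]

lemma inner_setIntegral_left {ν : Measure ℝ} {x : ℝ → V} (hx : Integrable x ν) (c : V) :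
    inner ℝ (∫ s, x s ∂ν) c = ∫ s, inner ℝ (x s) c ∂ν := by
  rw [real_inner_comm, ← integral_inner hx]
  simp only [real_inner_comm]

/-- Integration by parts for the primitives of two Bochner integrable functions: Fubini on the
square `[0,t]²`, cut along the diagonal. -/
lemma inner_integral_integral {x y : ℝ → V} {t : ℝ} (ht : 0 ≤ t)
    (hx : IntervalIntegrable x volume 0 t) (hy : IntervalIntegrable y volume 0 t) :
    inner ℝ (∫ s in (0 : ℝ)..t, x s) (∫ s in (0 : ℝ)..t, y s) =
      (∫ s in (0 : ℝ)..t, inner ℝ (x s) (∫ r in (0 : ℝ)..s, y r)) +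
        ∫ s in (0 : ℝ)..t, inner ℝ (∫ r in (0 : ℝ)..s, x r) (y s) := by
  set ν := volume.restrict (Ioc 0 t) with hν
  have hx' : Integrable x ν := (intervalIntegrable_iff_integrableOn_Ioc_of_le ht).1 hx
  have hy' : Integrable y ν := (intervalIntegrable_iff_integrableOn_Ioc_of_le ht).1 hy
  simp only [intervalIntegral.integral_of_le ht]
  have hint : Integrable (fun p : ℝ × ℝ => inner ℝ (x p.1) (y p.2)) (ν.prod ν) := by
    refine (hx'.norm.mul_prod hy'.norm).mono'
      (hx'.1.comp_fst.inner hy'.1.comp_snd) (Eventually.of_forall fun p => ?_)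
    exact norm_inner_le_norm _ _
  set A : Set (ℝ × ℝ) := {p | p.2 ≤ p.1} with hA
  have hAm : MeasurableSet A := measurableSet_le measurable_snd measurable_fst
  have e0 : inner ℝ (∫ s, x s ∂ν) (∫ s, y s ∂ν) =
      ∫ p, inner ℝ (x p.1) (y p.2) ∂(ν.prod ν) := by
    rw [integral_prod _ hint, inner_setIntegral_left hx']
    congr 1; ext s
    exact (integral_inner hy' (x s)).symm
  rw [e0, ← integral_add_compl hAm hint]
  congr 1
  · rw [← integral_indicator hAm, integral_prod _ (hint.indicator hAm)]
    refine setIntegral_congr_fun measurableSet_Ioc fun r hr => ?_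
    have e1 : ∀ s, A.indicator (fun p : ℝ × ℝ => inner ℝ (x p.1) (y p.2)) (r, s) =
        inner ℝ (x r) ((Iic r).indicator y s) := by
      intro s
      by_cases h : s ≤ r
      · rw [indicator_of_mem (show (r, s) ∈ A from h), indicator_of_mem (show s ∈ Iic r from h)]
      · rw [indicator_of_notMem (show (r, s) ∉ A from h),
          indicator_of_notMem (show s ∉ Iic r from h), inner_zero_right]
    simp only [e1]
    rw [integral_inner (hy'.indicator measurableSet_Iic), integral_indicator measurableSet_Iic,
      hν, Measure.restrict_restrict measurableSet_Iic,
      intervalIntegral.integral_of_le hr.1.le]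
    congr 3
    ext s
    simp only [mem_inter_iff, mem_Iic, mem_Ioc]
    constructor
    · rintro ⟨a, b, c⟩; exact ⟨b, a⟩
    · rintro ⟨a, b⟩; exact ⟨b, a, b.trans hr.2⟩
  · rw [← integral_indicator hAm.compl, integral_prod_symm _ (hint.indicator hAm.compl)]
    refine setIntegral_congr_fun measurableSet_Ioc fun s hs => ?_
    have e1 : ∀ r, Aᶜ.indicator (fun p : ℝ × ℝ => inner ℝ (x p.1) (y p.2)) (r, s) =
        inner ℝ ((Iio s).indicator x r) (y s) := by
      intro r
      by_cases h : r < s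
      · rw [indicator_of_mem (show (r, s) ∈ Aᶜ from not_le.2 h),
          indicator_of_mem (show r ∈ Iio s from h)]
      · rw [indicator_of_notMem (show (r, s) ∉ Aᶜ from fun h' => h (not_le.1 h')),
          indicator_of_notMem (show r ∉ Iio s from h), inner_zero_left]
    simp only [e1]
    rw [← inner_setIntegral_left (hx'.indicator measurableSet_Iio),
      integral_indicator measurableSet_Iio,
      hν, Measure.restrict_restrict measurableSet_Iio,
      intervalIntegral.integral_of_le hs.1.le, integral_Ioc_eq_integral_Ioo]
    congr 3
    ext r
    simp only [mem_inter_iff, mem_Iio, mem_Ioc, mem_Ioo]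
    constructor
    · rintro ⟨a, b, c⟩; exact ⟨b, a⟩
    · rintro ⟨a, b⟩; exact ⟨b, a, b.le.trans hs.2⟩

lemma intervalIntegrable_inner {V : Type*} [NormedAddCommGroup V] [InnerProductSpace ℝ V]
    {a b : ℝ → V} {t : ℝ} (ht : 0 ≤ t)
    (ha : IntervalIntegrable a volume 0 t) (hb : ContinuousOn b (Icc 0 t)) :
    IntervalIntegrable (fun s => inner ℝ (a s) (b s)) volume 0 t := by
  obtain ⟨C, hC⟩ := isCompact_Icc.exists_bound_of_continuousOn hb
  rw [intervalIntegrable_iff_integrableOn_Icc_of_le ht] at ha ⊢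
  refine (ha.norm.mul_const C).mono'
    (ha.1.inner (hb.aestronglyMeasurable measurableSet_Icc)) ?_
  filter_upwards [ae_restrict_mem measurableSet_Icc] with s hs
  exact (norm_inner_le_norm _ _).trans (by gcongr; exact hC s hs)

/-- The product rule in integrated form. -/
lemma inner_primitive {x y x' y' : ℝ → V} {t : ℝ} (ht : 0 ≤ t)
    (hx' : IntervalIntegrable x' volume 0 t) (hy' : IntervalIntegrable y' volume 0 t)
    (hx : ∀ s ∈ Icc 0 t, x s = x 0 + ∫ r in (0 : ℝ)..s, x' r)
    (hy : ∀ s ∈ Icc 0 t, y s = y 0 + ∫ r in (0 : ℝ)..s, y' r) :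
    inner ℝ (x t) (y t) = inner ℝ (x 0) (y 0) +
      ∫ s in (0 : ℝ)..t, (inner ℝ (x' s) (y s) + inner ℝ (x s) (y' s)) := by
  have hcx : ContinuousOn (fun s => ∫ r in (0 : ℝ)..s, x' r) (Icc 0 t) := by
    simpa [uIcc_of_le ht] using
      intervalIntegral.continuousOn_primitive_interval (μ := volume) (f := x') (a := 0) (b := t)
        (by simpa [uIcc_of_le ht] using
          (intervalIntegrable_iff_integrableOn_Icc_of_le ht).1 hx')
  have hcy : ContinuousOn (fun s => ∫ r in (0 : ℝ)..s, y' r) (Icc 0 t) := by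
    simpa [uIcc_of_le ht] using
      intervalIntegral.continuousOn_primitive_interval (μ := volume) (f := y') (a := 0) (b := t)
        (by simpa [uIcc_of_le ht] using
          (intervalIntegrable_iff_integrableOn_Icc_of_le ht).1 hy')
  have I1 := fun {a b : ℝ → V} => intervalIntegrable_inner (a := a) (b := b) ht
  have hxs : ContinuousOn x (Icc 0 t) :=
    (continuousOn_const.add hcx).congr hx
  have e : ∫ s in (0 : ℝ)..t, (inner ℝ (x' s) (y s) + inner ℝ (x s) (y' s)) =
      ∫ s in (0 : ℝ)..t, ((inner ℝ (x' s) (y 0) + inner ℝ (y' s) (x 0)) +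
        (inner ℝ (x' s) (∫ r in (0 : ℝ)..s, y' r) + inner ℝ (y' s) (∫ r in (0 : ℝ)..s, x' r))) := by
    refine intervalIntegral.integral_congr fun s hs => ?_
    rw [uIcc_of_le ht] at hs
    simp only [hx s hs, hy s hs, inner_add_left, inner_add_right]
    rw [real_inner_comm (y' s), real_inner_comm (y' s)]
    ring
  have c1 := I1 hx' (continuousOn_const (c := y 0))
  have c2 := I1 hy' (continuousOn_const (c := x 0))
  have c3 := I1 hx' hcy
  have c4 := I1 hy' hcx
  rw [e, intervalIntegral.integral_add (c1.add c2) (c3.add c4),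
    intervalIntegral.integral_add c1 c2, intervalIntegral.integral_add c3 c4,
    hx t ⟨ht, le_rfl⟩, hy t ⟨ht, le_rfl⟩, inner_add_left, inner_add_right, inner_add_right,
    inner_integral_integral ht hx' hy']
  have hx'' : Integrable x' (volume.restrict (Ioc 0 t)) :=
    (intervalIntegrable_iff_integrableOn_Ioc_of_le ht).1 hx'
  have hy'' : Integrable y' (volume.restrict (Ioc 0 t)) :=
    (intervalIntegrable_iff_integrableOn_Ioc_of_le ht).1 hy'
  have e1 : ∫ s in (0 : ℝ)..t, inner ℝ (x' s) (y 0) =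
      inner ℝ (∫ s in (0 : ℝ)..t, x' s) (y 0) := by
    simp only [intervalIntegral.integral_of_le ht]
    rw [inner_setIntegral_left hx'']
  have e2 : ∫ s in (0 : ℝ)..t, inner ℝ (y' s) (x 0) =
      inner ℝ (x 0) (∫ s in (0 : ℝ)..t, y' s) := by
    simp only [intervalIntegral.integral_of_le ht]
    rw [real_inner_comm, inner_setIntegral_left hy'']
  rw [e1, e2]
  simp only [real_inner_comm]
  ring

end product

/-- A Gronwall inequality for bounded functions and almost every time. No continuity is needed: the
inequality is iterated `n` times, starting from the bound `M`, and the resulting bound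
`M (C t)ⁿ / n!` tends to zero. -/
lemma gronwall_ae {T C M : ℝ} (hC : 0 ≤ C) {y : ℝ → ℝ}
    (hM : ∀ᵐ t ∂(timeMeasure T), y t ≤ M)
    (hint : Integrable y (timeMeasure T))
    (h : ∀ᵐ t ∂(timeMeasure T), y t ≤ C * ∫ s in (0 : ℝ)..t, y s) :
    ∀ᵐ t ∂(timeMeasure T), y t ≤ 0 := by
  have key : ∀ n : ℕ, ∀ᵐ t ∂(timeMeasure T), y t ≤ M * (C * t) ^ n / n.factorial := by
    intro n
    induction n with
    | zero => simpa using hM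
    | succ n ih =>
      have ih' := (ae_restrict_iff' measurableSet_Ioo).1 ih
      filter_upwards [h, ae_restrict_mem measurableSet_Ioo] with t ht htm
      refine ht.trans ?_
      have h1 : ∫ s in (0 : ℝ)..t, y s ≤ ∫ s in (0 : ℝ)..t, M * (C * s) ^ n / n.factorial := by
        refine intervalIntegral.integral_mono_ae_restrict htm.1.le ?_ ?_ ?_
        · rw [intervalIntegrable_iff_integrableOn_Ioo_of_le htm.1.le]
          exact hint.mono_measure (Measure.restrict_mono (Ioo_subset_Ioo_right htm.2.le) le_rfl)
        · exact (by fun_prop : Continuous _).intervalIntegrable _ _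
        · rw [← restrict_Ioo_eq_restrict_Icc]
          exact ae_mono (Measure.restrict_mono (Ioo_subset_Ioo_right htm.2.le) le_rfl) ih
      have h2 : ∫ s in (0 : ℝ)..t, M * (C * s) ^ n / n.factorial =
          M * C ^ n / n.factorial * (t ^ (n + 1) / (n + 1)) := by
        simp only [mul_pow, mul_div_right_comm, ← mul_assoc]
        rw [intervalIntegral.integral_const_mul, integral_pow]
        simp
      calc C * ∫ s in (0 : ℝ)..t, y s ≤ C * _ := mul_le_mul_of_nonneg_left (h1.trans_eq h2) hC
        _ = _ := by
          rw [Nat.factorial_succ]; push_cast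
          field_simp
          ring
  rw [← ae_all_iff] at key
  filter_upwards [key] with t ht
  have hlim := (FloorSemiring.tendsto_pow_div_factorial_atTop (C * t)).const_mul M
  rw [mul_zero] at hlim
  refine ge_of_tendsto hlim (Eventually.of_forall fun n => ?_)
  rw [← mul_div_assoc]; exact ht n

/-! ### Integrability in time -/

lemma MemLqH.mono_time {q : ℝ≥0∞} {T τ : ℝ} (h : τ ≤ T) {m : ℕ} {f : ℝ → Space d → ℝ}
    (hf : MemLqH q T m f) : MemLqH q τ m f := by
  have hle : timeMeasure τ ≤ timeMeasure T :=
    Measure.restrict_mono (Ioo_subset_Ioo_right h) le_rfl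
  have hprod : (timeMeasure τ).prod (volume : Measure (Space d)) ≤
      (timeMeasure T).prod volume := Measure.prod_mono hle le_rfl
  induction m generalizing f with
  | zero => exact ⟨hf.1.mono_measure hprod, (eLpNorm_mono_measure _ hle).trans_lt hf.2⟩
  | succ m ih =>
    refine ⟨⟨hf.1.1.mono_measure hprod, (eLpNorm_mono_measure _ hle).trans_lt hf.1.2⟩, fun i => ?_⟩
    obtain ⟨g, hg, hgm⟩ := hf.2 i
    exact ⟨g, ae_mono hle hg, ih hgm⟩

lemma MemLqH.top_to_two {T : ℝ} {f : ℝ → Space d → ℝ} (h : MemLqH ⊤ T 0 f) : MemLqH 2 T 0 f := by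
  refine ⟨h.1, lt_of_le_of_lt (eLpNorm_le_eLpNorm_mul_rpow_measure_univ le_top
    (measurable_eLpNorm_slice h.1).aestronglyMeasurable) (ENNReal.mul_lt_top h.2
      (ENNReal.rpow_lt_top_of_nonneg (by simp) (measure_ne_top _ _)))⟩

lemma ae_norm_toL2_of_top {T : ℝ} {m : ℕ} {f : ℝ → Space d → ℝ} (h : MemLqH ⊤ T m f) :
    ∃ C, 0 ≤ C ∧ ∀ᵐ t ∂(timeMeasure T), ‖toL2 (f t)‖ ≤ C := by
  have := h.memLp_toL2 le_top
  refine ⟨(eLpNorm (fun t => toL2 (f t)) ⊤ (timeMeasure T)).toReal, ENNReal.toReal_nonneg, ?_⟩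
  filter_upwards [ae_le_eLpNormEssSup (f := fun t => toL2 (f t)) (μ := timeMeasure T)] with t ht
  rw [← toReal_enorm]
  exact ENNReal.toReal_mono this.2.ne (by simpa using ht)

/-- Functions of time and space that are bounded in time with values in `L¹(ℝᵈ)`. Products of two
functions in `L^∞(0,T; L²)`, such as the nonlinear fluxes of a weak solution, are of this kind. -/
structure BddL1 (T : ℝ) (f : ℝ → Space d → ℝ) : Prop where
  aesm : AEStronglyMeasurable (uncurry f) ((timeMeasure T).prod volume)
  bound : ∃ C : ℝ, 0 ≤ C ∧ ∀ᵐ t ∂(timeMeasure T), Integrable (f t) volume ∧ ∫ x, |f t x| ≤ C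

lemma BddL1.mul {T : ℝ} {f g : ℝ → Space d → ℝ} (hf : MemLqH ⊤ T 0 f) (hg : MemLqH ⊤ T 0 g) :
    BddL1 T (fun t x => f t x * g t x) := by
  obtain ⟨A, hA, hA'⟩ := ae_norm_toL2_of_top hf
  obtain ⟨B, hB, hB'⟩ := ae_norm_toL2_of_top hg
  refine ⟨hf.1.mul hg.1, A * B, by positivity, ?_⟩
  filter_upwards [hA', hB', hf.ae_memLp le_top, hg.ae_memLp le_top] with t h1 h2 h3 h4
  refine ⟨integrable_mul2 h3 h4, ?_⟩
  have := integral_mul_le_norm h3.norm h4.norm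
  rw [abs_of_nonneg (integral_nonneg fun x => by positivity)] at this
  have e : ∀ {u : Space d → ℝ}, MemLp u 2 volume → ‖toL2 fun x => ‖u x‖‖ = ‖toL2 u‖ := by
    intro u hu
    rw [norm_toL2 hu, norm_toL2 hu.norm, eLpNorm_norm]
  rw [e h3, e h4] at this
  simp only [abs_mul]
  refine le_trans this ?_
  gcongr

lemma BddL1.add {T : ℝ} {f g : ℝ → Space d → ℝ} (hf : BddL1 T f) (hg : BddL1 T g) :
    BddL1 T (fun t x => f t x + g t x) := by
  obtain ⟨A, hA, hA'⟩ := hf.bound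
  obtain ⟨B, hB, hB'⟩ := hg.bound
  refine ⟨hf.aesm.add hg.aesm, A + B, by positivity, ?_⟩
  filter_upwards [hA', hB'] with t h1 h2
  refine ⟨h1.1.add h2.1, ?_⟩
  calc ∫ x, |f t x + g t x| ≤ ∫ x, (|f t x| + |g t x|) :=
        integral_mono (h1.1.add h2.1).abs (h1.1.abs.add h2.1.abs) fun x => abs_add_le _ _
    _ ≤ A + B := by
        rw [integral_add h1.1.abs h2.1.abs]; exact add_le_add h1.2 h2.2

lemma BddL1.neg {T : ℝ} {f : ℝ → Space d → ℝ} (hf : BddL1 T f) :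
    BddL1 T (fun t x => - f t x) := by
  obtain ⟨A, hA, hA'⟩ := hf.bound
  refine ⟨hf.aesm.neg, A, hA, ?_⟩
  filter_upwards [hA'] with t h1
  exact ⟨h1.1.neg, by simpa only [abs_neg] using h1.2⟩

lemma BddL1.zero {T : ℝ} : BddL1 T (fun _ (_ : Space d) => (0 : ℝ)) :=
  ⟨aestronglyMeasurable_const, 0, le_rfl, Eventually.of_forall fun t => by simp⟩

lemma BddL1.sum {T : ℝ} {ι : Type*} (s : Finset ι) {f : ι → ℝ → Space d → ℝ}
    (hf : ∀ a ∈ s, BddL1 T (f a)) : BddL1 T (fun t x => ∑ a ∈ s, f a t x) := by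
  classical
  induction s using Finset.induction_on with
  | empty => simpa using BddL1.zero
  | insert a s ha ih =>
    simp only [Finset.sum_insert ha]
    exact (hf a (by simp)).add (ih fun b hb => hf b (by simp [hb]))

/-- Convolution in space preserves joint measurability. -/
lemma aestronglyMeasurable_moll {ν : Measure ℝ} [SFinite ν] {κ : Space d → ℝ} (hκ : IsTest κ)
    {f : ℝ → Space d → ℝ} (hf : AEStronglyMeasurable (uncurry f) (ν.prod volume)) :
    AEStronglyMeasurable (uncurry fun s => moll κ (f s)) (ν.prod volume) := by
  obtain ⟨g, hg, hfg⟩ := hf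
  have hslice : ∀ᵐ t ∂ν, f t =ᵐ[volume] fun x => g (t, x) := Measure.ae_ae_of_ae_prod hfg
  refine ⟨fun p => ∫ y, κ (p.2 - y) * g (p.1, y), ?_, ?_⟩
  · apply StronglyMeasurable.integral_prod_right'
      (f := fun q : (ℝ × Space d) × Space d => κ (q.1.2 - q.2) * g (q.1.1, q.2))
    have h1 : StronglyMeasurable fun q : (ℝ × Space d) × Space d => κ (q.1.2 - q.2) :=
      (hκ.continuous.comp (by fun_prop)).stronglyMeasurable
    have h2 : Measurable fun q : (ℝ × Space d) × Space d => (q.1.1, q.2) := by fun_prop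
    exact h1.mul (hg.comp_measurable h2)
  · filter_upwards [Measure.quasiMeasurePreserving_fst.ae hslice] with p hp
    exact congrFun (moll_congr hp) p.2

lemma norm_toL2_moll_le {κ f : Space d → ℝ} (hκ : IsTest κ) (hf : MemLp f 2 volume) :
    ‖toL2 (moll κ f)‖ ≤ (∫⁻ x, ‖κ x‖ₑ).toReal * ‖toL2 f‖ := by
  rw [norm_toL2 hf, norm_toL2 (moll_memLp hκ hf), ← ENNReal.toReal_mul]
  exact ENNReal.toReal_mono (ENNReal.mul_lt_top hκ.integrable.2 hf.2).ne (eLpNorm_moll_le hκ hf.1)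

lemma norm_toL2_moll_one_le {κ f : Space d → ℝ} (hκ : IsTest κ) (hf : Integrable f volume) :
    ‖toL2 (moll κ f)‖ ≤ (eLpNorm κ 2 volume).toReal * ∫ x, |f x| := by
  have hf1 := memLp_one_iff_integrable.2 hf
  rw [norm_toL2 (moll_memLp_one hκ hf1)]
  have e : ∫ x, |f x| = (eLpNorm f 1 volume).toReal := by
    rw [eLpNorm_one_eq_lintegral_enorm, ← integral_norm_eq_lintegral_enorm hf.1]; rfl
  rw [e, ← ENNReal.toReal_mul]
  exact ENNReal.toReal_mono (ENNReal.mul_lt_top (hκ.memLp 2).2 hf1.2).ne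
    (eLpNorm_moll_le_one hκ hf.1)

lemma integrable_toL2_moll_one {T : ℝ} {κ : Space d → ℝ} (hκ : IsTest κ) {f : ℝ → Space d → ℝ}
    (hf : BddL1 T f) : Integrable (fun s => toL2 (moll κ (f s))) (timeMeasure T) := by
  obtain ⟨C, hC, hC'⟩ := hf.bound
  refine Integrable.of_bound (aestronglyMeasurable_toL2 (aestronglyMeasurable_moll hκ hf.aesm))
    ((eLpNorm κ 2 volume).toReal * C) ?_
  filter_upwards [hC'] with s hs
  refine (norm_toL2_moll_one_le hκ hs.1).trans ?_
  gcongr; exact hs.2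

lemma integrable_toL2 {T : ℝ} {m : ℕ} {f : ℝ → Space d → ℝ}
    (hf : MemLqH 2 T m f) : Integrable (fun s => toL2 (f s)) (timeMeasure T) :=
  (hf.memLp_toL2 (by norm_num)).integrable (by norm_num)

lemma integrable_toL2_moll {T : ℝ} {κ : Space d → ℝ} (hκ : IsTest κ) {m : ℕ} {f : ℝ → Space d → ℝ}
    (hf : MemLqH 2 T m f) : Integrable (fun s => toL2 (moll κ (f s))) (timeMeasure T) := by
  refine ((integrable_toL2 hf).norm.const_mul (∫⁻ x, ‖κ x‖ₑ).toReal).mono'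
    (aestronglyMeasurable_toL2 (aestronglyMeasurable_moll hκ hf.zero.1)) ?_
  filter_upwards [hf.ae_memLp (by norm_num)] with s hs
  exact norm_toL2_moll_le hκ hs

lemma intervalIntegrable_of_timeMeasure {V : Type*} [NormedAddCommGroup V] {T t : ℝ}
    (ht : t ∈ Icc 0 T) {F : ℝ → V} (hF : Integrable F (timeMeasure T)) :
    IntervalIntegrable F volume 0 t := by
  rw [intervalIntegrable_iff_integrableOn_Ioo_of_le ht.1]
  exact hF.mono_measure (Measure.restrict_mono (Ioo_subset_Ioo_right ht.2) le_rfl)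

lemma ae_interval_of_timeMeasure {T t : ℝ} (ht : t ∈ Icc 0 T) {p : ℝ → Prop}
    (h : ∀ᵐ s ∂(timeMeasure T), p s) : ∀ᵐ s ∂volume, s ∈ Set.uIoc 0 t → p s := by
  rw [uIoc_of_le ht.1, ← ae_restrict_iff' measurableSet_Ioc, ← restrict_Ioo_eq_restrict_Ioc]
  exact ae_mono (Measure.restrict_mono (Ioo_subset_Ioo_right ht.2) le_rfl) h

lemma intervalIntegral_congr_timeMeasure {V : Type*} [NormedAddCommGroup V] [NormedSpace ℝ V]
    {T t : ℝ} (ht : t ∈ Icc 0 T) {F G : ℝ → V} (h : ∀ᵐ s ∂(timeMeasure T), F s = G s) :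
    ∫ s in (0 : ℝ)..t, F s = ∫ s in (0 : ℝ)..t, G s :=
  intervalIntegral.integral_congr_ae (ae_interval_of_timeMeasure ht h)

/-- The integrability needed to exchange time integrals and pairings in space. -/
lemma integrable_mul_prod {T t : ℝ} (ht : t ∈ Icc 0 T) {f : ℝ → Space d → ℝ}
    (hf : MemLqH 2 T 0 f) {g : Space d → ℝ} (hg : MemLp g 2 volume) :
    Integrable (fun p : ℝ × Space d => f p.1 p.2 * g p.2)
      ((volume.restrict (Ioc 0 t)).prod volume) := by
  have hle : volume.restrict (Ioc 0 t) ≤ timeMeasure T := by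
    rw [← restrict_Ioo_eq_restrict_Ioc]
    exact Measure.restrict_mono (Ioo_subset_Ioo_right ht.2) le_rfl
  refine Integrable.mono_measure (ν := (timeMeasure T).prod volume) ?_
    (Measure.prod_mono hle le_rfl)
  have hm : AEStronglyMeasurable (fun p : ℝ × Space d => f p.1 p.2 * g p.2)
    ((timeMeasure T).prod volume) := hf.1.mul hg.1.comp_snd
  rw [integrable_prod_iff hm]
  have hs := hf.ae_memLp (by norm_num)
  refine ⟨by filter_upwards [hs] with s h; exact integrable_mul2 h hg, ?_⟩
  refine ((integrable_toL2 hf).norm.mul_const ‖toL2 g‖).mono' hm.norm.integral_prod_right' ?_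
  filter_upwards [hs] with s h
  rw [Real.norm_of_nonneg (integral_nonneg fun _ => norm_nonneg _)]
  have := integral_mul_le_norm h.norm hg.norm
  rw [abs_of_nonneg (integral_nonneg fun x => by positivity)] at this
  have e : ∀ {u : Space d → ℝ}, MemLp u 2 volume → ‖toL2 fun x => ‖u x‖‖ = ‖toL2 u‖ := by
    intro u hu
    rw [norm_toL2 hu, norm_toL2 hu.norm, eLpNorm_norm]
  rw [e h, e hg] at this
  simpa only [norm_mul] using this

/-- The pointwise time integral represents the Bochner integral in `L²`. -/
lemma toL2_integral {T t : ℝ} (ht : t ∈ Icc 0 T) {f : ℝ → Space d → ℝ} (hf : MemLqH 2 T 0 f) :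
    (fun x => ∫ s in (0 : ℝ)..t, f s x) =ᵐ[volume] (∫ s in (0 : ℝ)..t, toL2 (f s) : L2 d) := by
  have hle : volume.restrict (Ioc 0 t) ≤ timeMeasure T := by
    rw [← restrict_Ioo_eq_restrict_Ioc]
    exact Measure.restrict_mono (Ioo_subset_Ioo_right ht.2) le_rfl
  simp only [intervalIntegral.integral_of_le ht.1]
  refine ae_eq_of_integral_contDiff_smul_eq ?_ (Lp.memLp _).locInt fun φ h1 h2 => ?_
  · rw [locallyIntegrable_iff]
    intro K hK
    have hg : MemLp (K.indicator fun _ => (1 : ℝ)) 2 (volume : Measure (Space d)) :=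
      memLp_indicator_const 2 hK.isClosed.measurableSet 1 (Or.inr hK.measure_lt_top.ne)
    have := (integrable_mul_prod ht hf hg).integral_prod_right
    rw [← integrable_indicator_iff hK.isClosed.measurableSet]
    refine this.congr (Eventually.of_forall fun x => ?_)
    by_cases hx : x ∈ K <;> simp [hx]
  · have hφ : IsTest φ := ⟨h1, h2⟩
    have hI : Integrable (fun s => toL2 (f s)) (volume.restrict (Ioc 0 t)) :=
      (integrable_toL2 hf).mono_measure hle
    have e1 : ∫ x, φ x • (∫ s in Ioc 0 t, toL2 (f s) : L2 d) x =
        inner ℝ (∫ s in Ioc 0 t, toL2 (f s) : L2 d) (toL2 φ) := by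
      rw [inner_L2]
      refine integral_congr_ae ?_
      filter_upwards [toL2_coe (hφ.memLp 2)] with x hx
      rw [hx, smul_eq_mul, mul_comm]
    rw [e1, inner_setIntegral_left hI]
    have e2 : ∫ s in Ioc 0 t, inner ℝ (toL2 (f s)) (toL2 φ) =
        ∫ s in Ioc 0 t, ∫ x, f s x * φ x := by
      refine integral_congr_ae ?_
      filter_upwards [ae_mono hle (hf.ae_memLp (by norm_num))] with s hs
      exact inner_toL2 hs (hφ.memLp 2)
    rw [e2, integral_integral_swap (integrable_mul_prod ht hf (hφ.memLp 2))]
    simp only [integral_mul_const, smul_eq_mul, mul_comm]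

/-! ### Pairing a weak solution of a conservation law with a regular function -/

/-- A class `𝒱` of test fields, stable under mollification, together with the orthogonal projection
`P` onto its closure in `L²`. Of the latter, what is recorded is that `P` is symmetric, that it
vanishes on the fields orthogonal to `𝒱`, and that its fixed points are stable under mollification.
The momentum equation requires the solenoidal test fields and the Leray projection, the transport
equation all test fields and the identity. -/
structure IsTestClass (P : VL2 d →L[ℝ] VL2 d) (𝒱 : (Fin d → Space d → ℝ) → Prop) : Prop where
  symm : ∀ x y, inner ℝ (P x) y = inner ℝ x (P y)
  test : ∀ v, 𝒱 v → ∀ i, IsTest (v i)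
  moll : ∀ v n, 𝒱 v → 𝒱 fun i => J n (v i)
  eq_zero : ∀ h, (∀ v, 𝒱 v → inner ℝ h (toV v) = 0) → P h = 0
  moll_fix : ∀ f : Fin d → Space d → ℝ, (∀ i, MemLp (f i) 2 volume) → P (toV f) = toV f →
    ∀ n, P (toV fun i => J n (f i)) = toV fun i => J n (f i)

lemma IsSolTest.moll {v : Fin d → Space d → ℝ} (hv : IsSolTest v) (n : ℕ) :
    IsSolTest fun i => J n (v i) := by
  refine ⟨fun i => moll_isTest (rho_isTest n) (hv.test i), fun x => ?_⟩
  simp only [J, partialD_moll' (rho_isTest n) (hv.test _)]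
  unfold Viscoelastic.moll
  rw [← integral_finsetSum _ fun i _ => (rho_isTest n).integrable_kernel
    ((hv.test i).partialD i).continuous.locallyIntegrable x]
  simp only [← Finset.mul_sum, hv.div]
  simp

lemma leray_eq_self_iff {f : VL2 d} : leray d f = f ↔ f ∈ Lsigma d :=
  Submodule.starProjection_eq_self_iff

lemma isTestClass_leray : IsTestClass (leray d) IsSolTest where
  symm x y := Submodule.inner_starProjection_left_eq_right _ _ _
  test v hv := hv.test
  moll v n hv := hv.moll n
  eq_zero h hh := leray_eq_zero hh
  moll_fix f hf h n := by
    rw [leray_eq_self_iff] at h ⊢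
    have hJ := fun i => moll_memLp (rho_isTest (d := d) n) (hf i)
    rw [mem_Lsigma_iff hf] at h
    rw [mem_Lsigma_iff hJ]
    intro φ hφ
    rw [← h _ (moll_isTest (rho_isTest n) hφ)]
    refine Finset.sum_congr rfl fun i _ => ?_
    rw [J_transpose (hf i) ((hφ.partialD i).memLp 2)]
    congr 1; ext x
    rw [partialD_moll' (rho_isTest n) hφ]

lemma isTestClass_id : IsTestClass (ContinuousLinearMap.id ℝ (VL2 d))
    (fun v => ∀ i, IsTest (v i)) where
  symm x y := rfl
  test v hv := hv
  moll v n hv i := moll_isTest (rho_isTest n) (hv i)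
  eq_zero h hh := by
    classical
    ext1 i
    refine (Lp.eq_zero_iff_ae_eq_zero).2 ?_
    refine ae_eq_zero_of_integral_contDiff_smul_eq_zero (Lp.memLp (h i)).locInt fun g h1 h2 => ?_
    have := hh (fun j => if j = i then g else fun _ => 0) fun j => by
      by_cases hj : j = i
      · simp only [hj, if_true]; exact ⟨h1, h2⟩
      · simp only [hj, if_false]; exact IsTest.zero
    rw [← toV_coeFn h, inner_toV (fun j => Lp.memLp _) fun j => ?_,
      Finset.sum_eq_single i] at this
    · simpa [mul_comm] using this
    · intro j _ hj; simp [hj]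
    · simp
    · by_cases hj : j = i
      · simp only [hj, if_true]; exact IsTest.memLp ⟨h1, h2⟩ 2
      · simp only [hj, if_false]; exact IsTest.zero.memLp 2
  moll_fix f hf h n := rfl

lemma tendsto_integral_mul_J_of_bounded {f g : Space d → ℝ} (hf : Integrable f volume)
    (hg : MemLp g 2 volume) {C : ℝ} (hC : ∀ᵐ x, |g x| ≤ C) :
    Tendsto (fun n => ∫ x, f x * J n g x) atTop (𝓝 (∫ x, f x * g x)) := by
  refine tendsto_integral_of_dominated_convergence (fun x => |f x| * C) (fun n => ?_)
    (hf.abs.mul_const C) (fun n => Eventually.of_forall fun x => ?_) ?_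
  · exact hf.1.mul (moll_contDiff (rho_isTest n) hg.locInt).continuous.aestronglyMeasurable
  · rw [norm_mul]
    exact mul_le_mul_of_nonneg_left (abs_moll_le (rho_isTest n) (rho_nonneg n) (rho_integral n) hC x)
      (abs_nonneg _)
  · filter_upwards [J_tendsto_ae hg.locInt] with x hx
    exact hx.const_mul _

lemma integrable_toV {T : ℝ} {m : ℕ} {f : Fin d → ℝ → Space d → ℝ}
    (hf : ∀ i, MemLqH 2 T m (f i)) :
    Integrable (fun s => toV fun i => f i s) (timeMeasure T) :=
  Integrable.of_eval_piLp fun i => integrable_toL2 (hf i)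

/-- The reflected derivative of the mollifier: convolution with it is the transpose of
`f ↦ ∂ₖ (J n f)`. -/
noncomputable def dker (n : ℕ) (k : Fin d) (z : Space d) : ℝ := partialD k (rho d n) (-z)

lemma dker_isTest (n : ℕ) (k : Fin d) : IsTest (dker (d := d) n k) :=
  ((rho_isTest n).partialD k).comp_neg

/-- Minus the divergence of the mollification of the flux `M₁ + M₂` at time `s`. The mollification
maps both the part `M₁`, which is only integrable, and the square integrable part `M₂` to `L²`. -/
noncomputable def fluxDiv (n : ℕ) (M₁ M₂ : Fin d → Fin d → ℝ → Space d → ℝ) (s : ℝ) : VL2 d :=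
  WithLp.toLp 2 fun i => ∑ k,
    (toL2 (moll (dker n k) (M₁ i k s)) + toL2 (moll (dker n k) (M₂ i k s)))

section
variable {τ : ℝ} {M₁ M₂ : Fin d → Fin d → ℝ → Space d → ℝ}

lemma fluxDiv_integrable (hM₁ : ∀ i k, BddL1 τ (M₁ i k)) (hM₂ : ∀ i k, MemLqH 2 τ 0 (M₂ i k))
    (n : ℕ) : Integrable (fluxDiv n M₁ M₂) (timeMeasure τ) := by
  refine Integrable.of_eval_piLp fun i => ?_
  change Integrable (fun s => ∑ k,
    (toL2 (moll (dker n k) (M₁ i k s)) + toL2 (moll (dker n k) (M₂ i k s)))) _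
  exact integrable_finsetSum _ fun k _ =>
    (integrable_toL2_moll_one (dker_isTest n k) (hM₁ i k)).add
      (integrable_toL2_moll (dker_isTest n k) (hM₂ i k))

lemma inner_fluxDiv {n : ℕ} {s : ℝ} (h₁ : ∀ i k, Integrable (M₁ i k s) volume)
    (h₂ : ∀ i k, MemLp (M₂ i k s) 2 volume) {g : Fin d → Space d → ℝ}
    (hg : ∀ i, MemLp (g i) 2 volume) :
    inner ℝ (fluxDiv n M₁ M₂ s) (toV g) = ∑ i, ∑ k,
      ((∫ x, M₁ i k s x * moll (partialD k (rho d n)) (g i) x) +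
        ∫ x, M₂ i k s x * moll (partialD k (rho d n)) (g i) x) := by
  rw [PiLp.inner_apply]
  refine Finset.sum_congr rfl fun i _ => ?_
  simp only [fluxDiv, toV_apply, sum_inner, inner_add_left]
  refine Finset.sum_congr rfl fun k _ => ?_
  have hf1 := memLp_one_iff_integrable.2 (h₁ i k)
  have hk := dker_isTest (d := d) n k
  have e : (fun z => dker (d := d) n k (-z)) = partialD k (rho d n) := by
    ext z; simp [dker]
  rw [inner_toL2 (moll_memLp_one hk hf1) (hg i), inner_toL2 (moll_memLp hk (h₂ i k)) (hg i),
    integral_moll_mul_one hk hf1 (hg i), integral_moll_mul hk (h₂ i k) (hg i), e]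

variable {P : VL2 d →L[ℝ] VL2 d} {𝒱 : (Fin d → Space d → ℝ) → Prop}
  {a : Fin d → ℝ → Space d → ℝ} {a₀ : Fin d → Space d → ℝ}

/-- After mollification and projection, a weak solution is absolutely continuous in `L²`. -/
lemma projection_moll_eq (hP : IsTestClass P 𝒱) (ha₀ : ∀ i, MemLp (a₀ i) 2 volume)
    (hat : ∀ t ∈ Icc 0 τ, ∀ i, MemLp (a i t) 2 volume)
    (hM₁ : ∀ i k, BddL1 τ (M₁ i k)) (hM₂ : ∀ i k, MemLqH 2 τ 0 (M₂ i k))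
    (heq : ∀ v, 𝒱 v → ∀ t ∈ Icc 0 τ, (∑ i, ∫ x, a i t x * v i x) - ∑ i, ∫ x, a₀ i x * v i x =
      ∫ s in (0 : ℝ)..t, ∑ i, ∑ k, ((∫ x, M₁ i k s x * partialD k (v i) x) +
        ∫ x, M₂ i k s x * partialD k (v i) x))
    (n : ℕ) {t : ℝ} (ht : t ∈ Icc 0 τ) :
    P (toV fun i => J n (a i t)) = P (toV fun i => J n (a₀ i)) +
      ∫ s in (0 : ℝ)..t, P (fluxDiv n M₁ M₂ s) := by
  have hb := intervalIntegrable_of_timeMeasure ht (fluxDiv_integrable hM₁ hM₂ n)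
  have hρ := rho_isTest (d := d) n
  rw [P.intervalIntegral_comp_comm hb, ← map_add, ← sub_eq_zero, ← map_sub]
  refine hP.eq_zero _ fun v hv => ?_
  have hvt := hP.test v hv
  have hv2 : ∀ i, MemLp (v i) 2 volume := fun i => (hvt i).memLp 2
  have e := heq _ (hP.moll v n hv) t ht
  rw [inner_sub_left, inner_add_left, inner_toV (fun i => moll_memLp hρ (hat t ht i)) hv2,
    inner_toV (fun i => moll_memLp hρ (ha₀ i)) hv2]
  simp only [J_transpose (hat t ht _) (hv2 _), J_transpose (ha₀ _) (hv2 _)]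
  have e2 : inner ℝ (∫ s in (0 : ℝ)..t, fluxDiv n M₁ M₂ s) (toV v) =
      ∫ s in (0 : ℝ)..t, inner ℝ (fluxDiv n M₁ M₂ s) (toV v) := by
    simp only [intervalIntegral.integral_of_le ht.1]
    exact inner_setIntegral_left ((intervalIntegrable_iff_integrableOn_Ioc_of_le ht.1).1 hb) _
  have e3 : ∫ s in (0 : ℝ)..t, inner ℝ (fluxDiv n M₁ M₂ s) (toV v) =
      ∫ s in (0 : ℝ)..t, ∑ i, ∑ k, ((∫ x, M₁ i k s x * partialD k (J n (v i)) x) +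
        ∫ x, M₂ i k s x * partialD k (J n (v i)) x) := by
    have h1 : ∀ᵐ s ∂(timeMeasure τ), ∀ i k, Integrable (M₁ i k s) volume := by
      simp only [ae_all_iff]
      intro i k
      obtain ⟨C, _, hC⟩ := (hM₁ i k).bound
      filter_upwards [hC] with s hs using hs.1
    have h2 : ∀ᵐ s ∂(timeMeasure τ), ∀ i k, MemLp (M₂ i k s) 2 volume := by
      simp only [ae_all_iff]
      exact fun i k => (hM₂ i k).ae_memLp (by norm_num)
    refine intervalIntegral_congr_timeMeasure ht ?_
    filter_upwards [h1, h2] with s h1 h2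
    rw [inner_fluxDiv h1 h2 hv2]
    simp only [J, partialD_moll hρ (hv2 _).locInt]
  rw [e2, e3, ← e]
  ring

/-- The pairing of a weak solution `a` of `∂ₜ a = - div (M₁ + M₂)` with a more regular function
`u`. Only test fields that do not depend on time are needed: the solution is mollified and the
product rule for absolutely continuous functions with values in `L²` is applied. -/
theorem pairing_identity (hP : IsTestClass P 𝒱) (ha₀ : ∀ i, MemLp (a₀ i) 2 volume)
    (ham : ∀ i, MemLqH ⊤ τ 0 (a i)) (hat : ∀ t ∈ Icc 0 τ, ∀ i, MemLp (a i t) 2 volume)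
    (hM₁ : ∀ i k, BddL1 τ (M₁ i k)) (hM₂ : ∀ i k, MemLqH 2 τ 0 (M₂ i k))
    (heq : ∀ v, 𝒱 v → ∀ t ∈ Icc 0 τ, (∑ i, ∫ x, a i t x * v i x) - ∑ i, ∫ x, a₀ i x * v i x =
      ∫ s in (0 : ℝ)..t, ∑ i, ∑ k, ((∫ x, M₁ i k s x * partialD k (v i) x) +
        ∫ x, M₂ i k s x * partialD k (v i) x))
    (haP : ∀ᵐ s ∂(timeMeasure τ), P (toV fun i => a i s) = toV fun i => a i s)
    {u u' : Fin d → ℝ → Space d → ℝ} {u₀ : Fin d → Space d → ℝ}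
    {Du : Fin d → Fin d → ℝ → Space d → ℝ}
    (hu₀ : ∀ i, MemLp (u₀ i) 2 volume) (hu' : ∀ i, MemLqH 2 τ 0 (u' i))
    (hut : ∀ t ∈ Icc 0 τ, ∀ i, MemLp (u i t) 2 volume)
    (hu : ∀ t ∈ Icc 0 τ, (toV fun i => u i t) = toV u₀ + ∫ s in (0 : ℝ)..t, toV fun i => u' i s)
    (huP : ∀ t ∈ Icc 0 τ, P (toV fun i => u i t) = toV fun i => u i t)
    {C : ℝ} (hDu : ∀ᵐ s ∂(timeMeasure τ), ∀ i k, HasWeakPartial k (u i s) (Du i k s) ∧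
      MemLp (Du i k s) 2 volume ∧ (∀ᵐ x, |Du i k s x| ≤ C) ∧ ‖toL2 (Du i k s)‖ ≤ C) :
    Integrable (fun s => (∑ i, ∑ k, ((∫ x, M₁ i k s x * Du i k s x) +
        ∫ x, M₂ i k s x * Du i k s x)) + ∑ i, ∫ x, a i s x * u' i s x) (timeMeasure τ) ∧
    ∀ᵐ t ∂(timeMeasure τ), ∑ i, ∫ x, a i t x * u i t x = (∑ i, ∫ x, a₀ i x * u₀ i x) +
      ∫ s in (0 : ℝ)..t, ((∑ i, ∑ k, ((∫ x, M₁ i k s x * Du i k s x) +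
        ∫ x, M₂ i k s x * Du i k s x)) + ∑ i, ∫ x, a i s x * u' i s x) := by
  have hρ := fun n => rho_isTest (d := d) n
  have hmem : ∀ᵐ s ∂(timeMeasure τ), s ∈ Icc 0 τ := by
    filter_upwards [ae_restrict_mem measurableSet_Ioo] with s hs using Ioo_subset_Icc_self hs
  -- the integrand after mollification
  set F : ℕ → ℝ → ℝ := fun n s => inner ℝ (P (fluxDiv n M₁ M₂ s)) (toV fun i => u i s) +
    inner ℝ (P (toV fun i => J n (a i s))) (toV fun i => u' i s) with hF
  set L : ℝ → ℝ := fun s => (∑ i, ∑ k, ((∫ x, M₁ i k s x * Du i k s x) +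
        ∫ x, M₂ i k s x * Du i k s x)) + ∑ i, ∫ x, a i s x * u' i s x with hL
  choose A hA0 hA using fun i => ae_norm_toL2_of_top (ham i)
  choose B hB0 hB using fun i k => (hM₁ i k).bound
  have h1 : ∀ᵐ s ∂(timeMeasure τ), ∀ i k, Integrable (M₁ i k s) volume ∧
      ∫ x, |M₁ i k s x| ≤ B i k := by
    simp only [ae_all_iff]; exact hB
  have h2 : ∀ᵐ s ∂(timeMeasure τ), ∀ i k, MemLp (M₂ i k s) 2 volume := by
    simp only [ae_all_iff]
    exact fun i k => (hM₂ i k).ae_memLp (by norm_num)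
  have h3 : ∀ᵐ s ∂(timeMeasure τ), ∀ i, MemLp (u' i s) 2 volume := by
    simp only [ae_all_iff]
    exact fun i => (hu' i).ae_memLp (by norm_num)
  have h4 : ∀ᵐ s ∂(timeMeasure τ), ∀ i, ‖toL2 (a i s)‖ ≤ A i := by
    simp only [ae_all_iff]; exact hA
  have hFeq : ∀ᵐ s ∂(timeMeasure τ), ∀ n, F n s =
      (∑ i, ∑ k, ((∫ x, M₁ i k s x * J n (Du i k s) x) + ∫ x, M₂ i k s x * J n (Du i k s) x)) +
        ∑ i, ∫ x, a i s x * J n (u' i s) x := by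
    filter_upwards [h1, h2, h3, haP, hDu, hmem] with s h1 h2 h3 haP hDu hs n
    simp only [hF]
    rw [hP.symm, huP s hs, hP.moll_fix _ (hat s hs) haP,
      inner_fluxDiv (fun i k => (h1 i k).1) h2 (hut s hs),
      inner_toV (fun i => moll_memLp (hρ n) (hat s hs i)) h3]
    simp only [J_transpose (hat s hs _) (h3 _), fun i k => funext ((hDu i k).1.moll (hρ n))]
  -- an integrable bound, uniform in `n`
  set bd : ℝ → ℝ := fun s => (∑ i, ∑ k, (B i k * C + ‖toL2 (M₂ i k s)‖ * C)) +
    ∑ i, A i * ‖toL2 (u' i s)‖ with hbd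
  have hbdi : Integrable bd (timeMeasure τ) := by
    refine Integrable.add ?_ ?_
    · exact integrable_finsetSum _ fun i _ => integrable_finsetSum _ fun k _ =>
        (integrable_const _).add ((integrable_toL2 (hM₂ i k)).norm.mul_const _)
    · exact integrable_finsetSum _ fun i _ => (integrable_toL2 (hu' i)).norm.const_mul _
  have hJn : ∀ {g : Space d → ℝ}, MemLp g 2 volume → ∀ n, ‖toL2 (J n g)‖ ≤ ‖toL2 g‖ := by
    intro g hg n
    rw [norm_toL2 hg, norm_toL2 (moll_memLp (hρ n) hg)]
    exact ENNReal.toReal_mono hg.2.ne (J_eLpNorm_le hg.1 n)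
  have hFb : ∀ᵐ s ∂(timeMeasure τ), ∀ n, ‖F n s‖ ≤ bd s := by
    filter_upwards [h1, h2, h3, h4, hDu, hmem, hFeq] with s h1 h2 h3 h4 hDu hs hFe n
    rw [hFe n]
    refine (norm_add_le _ _).trans (add_le_add ?_ ?_)
    · refine (norm_sum_le _ _).trans (Finset.sum_le_sum fun i _ => ?_)
      refine (norm_sum_le _ _).trans (Finset.sum_le_sum fun k _ => ?_)
      refine (norm_add_le _ _).trans (add_le_add ?_ ?_)
      · have hC0 : 0 ≤ C := (norm_nonneg _).trans (hDu i k).2.2.2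
        refine (norm_integral_le_of_norm_le ((h1 i k).1.abs.mul_const C)
          (Eventually.of_forall fun x => ?_)).trans ?_
        · rw [norm_mul]
          exact mul_le_mul_of_nonneg_left (abs_moll_le (hρ n) (rho_nonneg n) (rho_integral n)
            (hDu i k).2.2.1 x) (abs_nonneg _)
        · rw [integral_mul_const]; gcongr; exact (h1 i k).2
      · refine (integral_mul_le_norm (h2 i k) (moll_memLp (hρ n) (hDu i k).2.1)).trans ?_
        gcongr
        exact (hJn (hDu i k).2.1 n).trans (hDu i k).2.2.2
    · refine (norm_sum_le _ _).trans (Finset.sum_le_sum fun i _ => ?_)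
      refine (integral_mul_le_norm (hat s hs i) (moll_memLp (hρ n) (h3 i))).trans ?_
      exact mul_le_mul (h4 i) (hJn (h3 i) n) (norm_nonneg _) (hA0 i)
  have hFlim : ∀ᵐ s ∂(timeMeasure τ), Tendsto (fun n => F n s) atTop (𝓝 (L s)) := by
    filter_upwards [h1, h2, h3, hDu, hmem, hFeq] with s h1 h2 h3 hDu hs hFe
    simp only [hFe]
    refine Tendsto.add ?_ ?_
    · exact tendsto_finsetSum _ fun i _ => tendsto_finsetSum _ fun k _ =>
        (tendsto_integral_mul_J_of_bounded (h1 i k).1 (hDu i k).2.1 (hDu i k).2.2.1).add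
          (J_tendsto_integral (h2 i k) (hDu i k).2.1)
    · exact tendsto_finsetSum _ fun i _ => J_tendsto_integral (hat s hs i) (h3 i)
  have hu'V := integrable_toV hu'
  have huc : ∀ t ∈ Icc 0 τ, IntervalIntegrable (fun s => toV fun i => u' i s) volume 0 t :=
    fun t ht => intervalIntegrable_of_timeMeasure ht hu'V
  have humeas : AEStronglyMeasurable (fun s => toV fun i => u i s) (timeMeasure τ) := by
    by_cases hτ : 0 ≤ τ
    · have hc : ContinuousOn (fun t => toV u₀ + ∫ s in (0 : ℝ)..t, toV fun i => u' i s)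
          (Icc 0 τ) := by
        refine continuousOn_const.add ?_
        have := (intervalIntegrable_iff_integrableOn_Icc_of_le hτ).1 (huc τ ⟨hτ, le_rfl⟩)
        simpa [uIcc_of_le hτ] using intervalIntegral.continuousOn_primitive_interval (a := 0)
          (b := τ) (by simpa [uIcc_of_le hτ] using this)
      exact ((hc.congr hu).mono Ioo_subset_Icc_self).aestronglyMeasurable measurableSet_Ioo
    · have : timeMeasure τ = 0 := by
        simp [timeMeasure, Ioo_eq_empty (fun h => hτ h.le)]
      rw [this]; exact aestronglyMeasurable_zero_measure _
  have hFm : ∀ n, AEStronglyMeasurable (F n) (timeMeasure τ) := by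
    intro n
    have hm1 : AEStronglyMeasurable (fun s => toV fun i => J n (a i s)) (timeMeasure τ) :=
      (Integrable.of_eval_piLp fun i => integrable_toL2_moll (hρ n) (ham i).top_to_two).1
    exact ((P.continuous.comp_aestronglyMeasurable (fluxDiv_integrable hM₁ hM₂ n).1).inner
      humeas).add ((P.continuous.comp_aestronglyMeasurable hm1).inner hu'V.1)
  -- measurability of `L` in time is inherited from the mollified integrands
  have hLm : AEStronglyMeasurable L (timeMeasure τ) := aestronglyMeasurable_of_tendsto_ae _ hFm hFlim
  have hLi : Integrable L (timeMeasure τ) := by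
    refine hbdi.mono' hLm ?_
    filter_upwards [hFlim, hFb] with s hl hb
    exact le_of_tendsto hl.norm (Eventually.of_forall fun n => hb n)
  refine ⟨hLi, ?_⟩
  filter_upwards [haP, hmem] with t haPt ht
  -- the product rule for the mollified and projected weak solution
  have hprod : ∀ n, (∑ i, ∫ x, a i t x * J n (u i t) x) = (∑ i, ∫ x, a₀ i x * J n (u₀ i) x) +
      ∫ s in (0 : ℝ)..t, F n s := by
    intro n
    have hsub : ∀ {s}, s ∈ Icc 0 t → s ∈ Icc 0 τ := fun hs => ⟨hs.1, hs.2.trans ht.2⟩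
    have h00 : (0 : ℝ) ∈ Icc 0 τ := ⟨le_rfl, ht.1.trans ht.2⟩
    have hx := fun s hs => projection_moll_eq hP ha₀ hat hM₁ hM₂ heq n (t := s) hs
    have hx0 : P (toV fun i => J n (a i 0)) = P (toV fun i => J n (a₀ i)) := by
      rw [hx 0 h00]; simp
    have hy0 : (toV fun i => u i 0) = toV u₀ := by rw [hu 0 h00]; simp
    have hb := (P.integrable_comp (fluxDiv_integrable hM₁ hM₂ n))
    have := inner_primitive (x := fun s => P (toV fun i => J n (a i s)))
      (y := fun s => toV fun i => u i s) ht.1 (intervalIntegrable_of_timeMeasure ht hb) (huc t ht)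
      (fun s hs => by rw [hx s (hsub hs), hx0]) (fun s hs => by rw [hu s (hsub hs), hy0])
    rw [hP.moll_fix _ (hat t ht) haPt, hx0, hy0,
      inner_toV (fun i => moll_memLp (hρ n) (hat t ht i)) (hut t ht), hP.symm, ← hy0,
      huP 0 h00, hy0, inner_toV (fun i => moll_memLp (hρ n) (ha₀ i)) hu₀] at this
    simp only [J_transpose (hat t ht _) (hut t ht _), J_transpose (ha₀ _) (hu₀ _)] at this
    exact this
  refine tendsto_nhds_unique (tendsto_finsetSum _ fun i _ =>
    J_tendsto_integral (hat t ht i) (hut t ht i)) ?_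
  simp only [hprod]
  refine Tendsto.add (tendsto_finsetSum _ fun i _ => J_tendsto_integral (ha₀ i) (hu₀ i)) ?_
  have hle : volume.restrict (Set.uIoc 0 t) ≤ timeMeasure τ := by
    rw [uIoc_of_le ht.1, ← restrict_Ioo_eq_restrict_Ioc]
    exact Measure.restrict_mono (Ioo_subset_Ioo_right ht.2) le_rfl
  refine intervalIntegral.tendsto_integral_filter_of_dominated_convergence bd
    (Eventually.of_forall fun n => (hFm n).mono_measure hle)
    (Eventually.of_forall fun n => ae_interval_of_timeMeasure ht ?_)
    (intervalIntegrable_of_timeMeasure ht hbdi) (ae_interval_of_timeMeasure ht hFlim)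
  filter_upwards [hFb] with s hs using hs n

end

/-! ### The equations at a fixed time -/

/-- Functions of class `H²` that are bounded together with their first derivatives; `C` is a bound
for the function, for its first derivatives and for the `L²` norms of the latter. -/
structure IsRegular (C : ℝ) (f : Space d → ℝ) : Prop where
  memLp : MemLp f 2 volume
  bound : ∀ᵐ x, |f x| ≤ C
  weak : ∀ k, HasWeakPartial k f (weakPartial k f)
  memLp_partial : ∀ k, MemLp (weakPartial k f) 2 volume
  bound_partial : ∀ k, ∀ᵐ x, |weakPartial k f x| ≤ C
  norm_partial : ∀ k, ‖toL2 (weakPartial k f)‖ ≤ C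
  weak_two : ∀ k l, HasWeakPartial l (weakPartial k f) (weakPartial l (weakPartial k f))
  memLp_two : ∀ k l, MemLp (weakPartial l (weakPartial k f)) 2 volume

lemma memLp_mul_bdd {f g : Space d → ℝ} (hf : MemLp f 2 volume) (hg : AEStronglyMeasurable g volume)
    {C : ℝ} (hC : ∀ᵐ x, |g x| ≤ C) : MemLp (fun x => f x * g x) 2 volume :=
  (memLp_top_of_bound hg C hC).mul hf

lemma memLp_bdd_mul {f g : Space d → ℝ} (hf : MemLp f 2 volume) (hg : AEStronglyMeasurable g volume)
    {C : ℝ} (hC : ∀ᵐ x, |g x| ≤ C) : MemLp (fun x => g x * f x) 2 volume := by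
  simpa only [mul_comm] using memLp_mul_bdd hf hg hC

namespace IsRegular
variable {C : ℝ} {f g h : Space d → ℝ}

lemma mul_left (hf : IsRegular C f) (hh : MemLp h 2 volume) :
    MemLp (fun x => f x * h x) 2 volume := memLp_bdd_mul hh hf.memLp.1 hf.bound

lemma partial_mul_left (hf : IsRegular C f) (k : Fin d) (hh : MemLp h 2 volume) :
    MemLp (fun x => weakPartial k f x * h x) 2 volume :=
  memLp_bdd_mul hh (hf.memLp_partial k).1 (hf.bound_partial k)

lemma partial_mul_right (hf : IsRegular C f) (k : Fin d) (hh : MemLp h 2 volume) :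
    MemLp (fun x => h x * weakPartial k f x) 2 volume :=
  memLp_mul_bdd hh (hf.memLp_partial k).1 (hf.bound_partial k)

lemma weakPartial_mul (hf : IsRegular C f) (hg : IsRegular C g) (k : Fin d) :
    HasWeakPartial k (fun x => f x * g x)
      (fun x => weakPartial k f x * g x + f x * weakPartial k g x) :=
  (hf.weak k).mul (hg.weak k) hf.memLp (hf.memLp_partial k) hg.memLp (hg.memLp_partial k)

/-- A solenoidal field is orthogonal to the gradient of a product of regular functions. -/
lemma sum_integral_mul_grad_mul (hf : IsRegular C f) (hg : IsRegular C g)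
    {U : Fin d → Space d → ℝ} (hU : ∀ i, MemLp (U i) 2 volume) (hU' : toV U ∈ Lsigma d) :
    ∑ k, ∫ x, U k x * (f x * weakPartial k g x + g x * weakPartial k f x) = 0 := by
  refine sum_integral_mul_grad_eq_zero (p := fun x => f x * g x) hU hU'
    (fun k => (hf.mul_left (hg.memLp_partial k)).add (hg.mul_left (hf.memLp_partial k))) fun k => ?_
  refine (hf.weakPartial_mul hg k).congr EventuallyEq.rfl (Eventually.of_forall fun x => ?_)
  simp only; ring

lemma sum_integral_mul_grad_sq (hf : IsRegular C f)
    {U : Fin d → Space d → ℝ} (hU : ∀ i, MemLp (U i) 2 volume) (hU' : toV U ∈ Lsigma d) :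
    ∑ k, ∫ x, U k x * (f x * weakPartial k f x) = 0 := by
  have := hf.sum_integral_mul_grad_mul hf hU hU'
  have e : ∀ k, ∫ x, U k x * (f x * weakPartial k f x + f x * weakPartial k f x) =
      2 * ∫ x, U k x * (f x * weakPartial k f x) := fun k => by
    rw [← integral_const_mul]; congr 1; ext x; ring
  simp only [e, ← Finset.mul_sum] at this
  linarith

end IsRegular

/-- The state `(u, E)` of a strong solution at one time, with time derivatives `(ut, Et)`, and the
equations that it satisfies. Besides the velocity, the columns of the strain are solenoidal. -/
structure IsStrongAt (μ C : ℝ) (u : Fin d → Space d → ℝ) (E : Fin d → Fin d → Space d → ℝ)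
    (ut : Fin d → Space d → ℝ) (Et : Fin d → Fin d → Space d → ℝ) : Prop where
  reg_u : ∀ i, IsRegular C (u i)
  reg_E : ∀ i j, IsRegular C (E i j)
  mem_ut : ∀ i, MemLp (ut i) 2 volume
  mem_Et : ∀ i j, MemLp (Et i j) 2 volume
  div_u : ∀ᵐ x, ∑ i, weakPartial i (u i) x = 0
  div_E : ∀ j, ∀ᵐ x, ∑ i, weakPartial i (E i j) x = 0
  momentum : ∃ p : Space d → ℝ, (∀ i, ∃ g, HasWeakPartial i p g) ∧ ∀ᵐ x, ∀ i,
    ut i x + (∑ l, u l x * weakPartial l (u i) x) -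
        μ * (∑ l, weakPartial l (weakPartial l (u i)) x) + weakPartial i p x =
      (∑ l, weakPartial l (E i l) x) +
        ∑ l, weakPartial l (fun y => ∑ j, E i j y * E l j y) x
  strain : ∀ᵐ x, ∀ i j, Et i j x + (∑ l, u l x * weakPartial l (E i j) x) =
    weakPartial j (u i) x + ∑ l, weakPartial l (u i) x * E l j x

lemma mem_Lsigma_of_div {C : ℝ} {u : Fin d → Space d → ℝ} (hu : ∀ i, IsRegular C (u i))
    (h : ∀ᵐ x, ∑ i, weakPartial i (u i) x = 0) : toV u ∈ Lsigma d := by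
  rw [mem_Lsigma_iff fun i => (hu i).memLp]
  intro φ hφ
  simp only [((hu _).weak _).test hφ, Finset.sum_neg_distrib]
  rw [← integral_finsetSum _ fun i _ => hφ.integrable_mul ((hu i).memLp_partial i).locInt]
  rw [integral_eq_zero_of_ae, neg_zero]
  filter_upwards [h] with x hx
  rw [← Finset.sum_mul, hx, zero_mul]; rfl

section
variable {μ C : ℝ} {u : Fin d → Space d → ℝ} {E : Fin d → Fin d → Space d → ℝ}
    {ut : Fin d → Space d → ℝ} {Et : Fin d → Fin d → Space d → ℝ}

lemma IsStrongAt.mem_u (h : IsStrongAt μ C u E ut Et) : toV u ∈ Lsigma d :=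
  mem_Lsigma_of_div h.reg_u h.div_u

lemma IsStrongAt.mem_E (h : IsStrongAt μ C u E ut Et) (j : Fin d) :
    toV (fun i => E i j) ∈ Lsigma d :=
  mem_Lsigma_of_div (fun i => h.reg_E i j) (h.div_E j)

lemma integral_mul_sum {ι : Type*} (s : Finset ι) {w : Space d → ℝ} {f : ι → Space d → ℝ}
    (hw : MemLp w 2 volume) (hf : ∀ i ∈ s, MemLp (f i) 2 volume) :
    ∫ x, w x * ∑ i ∈ s, f i x = ∑ i ∈ s, ∫ x, w x * f i x := by
  simp only [Finset.mul_sum]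
  exact integral_finsetSum _ fun i hi => integrable_mul2 hw (hf i hi)

lemma memLp_sum {ι : Type*} (s : Finset ι) {f : ι → Space d → ℝ}
    (hf : ∀ i ∈ s, MemLp (f i) 2 volume) : MemLp (fun x => ∑ i ∈ s, f i x) 2 volume :=
  memLp_finsetSum _ hf

/-- The strain equation tested with a square integrable function. -/
lemma integral_mul_strain (hu : ∀ i, IsRegular C (u i)) (hE : ∀ i j, IsRegular C (E i j))
    (hst : ∀ᵐ x, ∀ i j, Et i j x + (∑ l, u l x * weakPartial l (E i j) x) =
      weakPartial j (u i) x + ∑ l, weakPartial l (u i) x * E l j x) {f : Space d → ℝ}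
    (hf : MemLp f 2 volume) (i j : Fin d) :
    ∫ x, f x * Et i j x = (∫ x, f x * weakPartial j (u i) x) +
      ∑ k, ((∫ x, f x * (weakPartial k (u i) x * E k j x)) -
        ∫ x, f x * (u k x * weakPartial k (E i j) x)) := by
  have m1 : MemLp (weakPartial j (u i)) 2 volume := (hu i).memLp_partial j
  have m2 : ∀ k, MemLp (fun x => weakPartial k (u i) x * E k j x) 2 volume :=
    fun k => (hu i).partial_mul_left k (hE k j).memLp
  have m3 : ∀ k, MemLp (fun x => u k x * weakPartial k (E i j) x) 2 volume :=
    fun k => (hu k).mul_left ((hE i j).memLp_partial k)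
  have e : ∫ x, f x * Et i j x = ∫ x, (f x * weakPartial j (u i) x +
      f x * ∑ k, weakPartial k (u i) x * E k j x) -
        f x * ∑ k, u k x * weakPartial k (E i j) x := by
    refine integral_congr_ae ?_
    filter_upwards [hst] with x hx
    have := hx i j
    rw [show Et i j x = weakPartial j (u i) x + (∑ l, weakPartial l (u i) x * E l j x) -
      ∑ l, u l x * weakPartial l (E i j) x by linarith]
    ring
  have i1 := integrable_mul2 hf m1
  have i2 := integrable_mul2 hf (memLp_sum Finset.univ fun k _ => m2 k)
  have i3 := integrable_mul2 hf (memLp_sum Finset.univ fun k _ => m3 k)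
  have i12 : Integrable (fun x => f x * weakPartial j (u i) x +
      f x * ∑ k, weakPartial k (u i) x * E k j x) volume := i1.add i2
  rw [e, integral_sub i12 i3, integral_add i1 i2,
    integral_mul_sum _ hf (fun k _ => m2 k), integral_mul_sum _ hf (fun k _ => m3 k),
    Finset.sum_sub_distrib]
  ring

/-- The strain equation tested with a square integrable matrix field. -/
lemma IsStrongAt.pair_strain (h : IsStrongAt μ C u E ut Et) {F : Fin d → Fin d → Space d → ℝ}
    (hF : ∀ i j, MemLp (F i j) 2 volume) :
    ∑ i, ∑ j, ∫ x, F i j x * Et i j x = (∑ i, ∑ j, ∫ x, F i j x * weakPartial j (u i) x) +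
      ∑ i, ∑ j, ∑ k, ((∫ x, F i j x * (weakPartial k (u i) x * E k j x)) -
        ∫ x, F i j x * (u k x * weakPartial k (E i j) x)) := by
  simp only [← Finset.sum_add_distrib]
  exact Finset.sum_congr rfl fun i _ => Finset.sum_congr rfl fun j _ =>
    integral_mul_strain h.reg_u h.reg_E h.strain (hF i j) i j

/-- The momentum equation tested with a solenoidal field of class `H¹`. The pressure drops out: its
gradient is square integrable by the equation, although nothing is assumed about it. -/
lemma IsStrongAt.pair_momentum (h : IsStrongAt μ C u E ut Et) {w : Fin d → Space d → ℝ}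
    {Dw : Fin d → Fin d → Space d → ℝ} (hw : ∀ i, MemLp (w i) 2 volume)
    (hDw : ∀ i k, HasWeakPartial k (w i) (Dw i k)) (hDw2 : ∀ i k, MemLp (Dw i k) 2 volume)
    (hws : toV w ∈ Lsigma d) :
    ∑ i, ∫ x, w i x * ut i x = (∑ i, ∑ k, ((∫ x, w i x * weakPartial k (E i k) x) -
        (∫ x, w i x * (u k x * weakPartial k (u i) x)) -
        μ * ∫ x, Dw i k x * weakPartial k (u i) x)) +
      ∑ i, ∑ j, ∑ k, ∫ x, w i x * (weakPartial k (E i j) x * E k j x) := by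
  obtain ⟨p, hp, hmom⟩ := h.momentum
  have m1 : ∀ i k, MemLp (weakPartial k (E i k)) 2 volume := fun i k => (h.reg_E i k).memLp_partial k
  have m2 : ∀ i k, MemLp (fun x => u k x * weakPartial k (u i) x) 2 volume :=
    fun i k => (h.reg_u k).mul_left ((h.reg_u i).memLp_partial k)
  have m3 : ∀ i k, MemLp (weakPartial k (weakPartial k (u i))) 2 volume :=
    fun i k => (h.reg_u i).memLp_two k k
  have m4 : ∀ i j k, MemLp (fun x => weakPartial k (E i j) x * E k j x) 2 volume :=
    fun i j k => (h.reg_E i j).partial_mul_left k (h.reg_E k j).memLp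
  have hEE : ∀ i l, weakPartial l (fun y => ∑ j, E i j y * E l j y) =ᵐ[volume] fun x =>
      ∑ j, (weakPartial l (E i j) x * E l j x + E i j x * weakPartial l (E l j) x) := fun i l =>
    (hasWeakPartial_sum Finset.univ fun j _ =>
      (h.reg_E i j).weakPartial_mul (h.reg_E l j) l).weakPartial_ae_eq
  have hEE' : ∀ᵐ x, ∀ i l, weakPartial l (fun y => ∑ j, E i j y * E l j y) x =
      ∑ j, (weakPartial l (E i j) x * E l j x + E i j x * weakPartial l (E l j) x) := by
    simp only [ae_all_iff]; exact hEE
  have hdivE : ∀ᵐ x, ∀ j, ∑ i, weakPartial i (E i j) x = 0 := by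
    simp only [ae_all_iff]; exact h.div_E
  -- the divergence of `E Eᵀ` simplifies since the columns of `E` are solenoidal
  have heq : ∀ᵐ x, ∀ i, weakPartial i p x = (∑ k, weakPartial k (E i k) x) +
      (∑ j, ∑ k, weakPartial k (E i j) x * E k j x) - (∑ k, u k x * weakPartial k (u i) x) +
      μ * (∑ k, weakPartial k (weakPartial k (u i)) x) - ut i x := by
    filter_upwards [hmom, hEE', hdivE] with x h1 h2 h3 i
    have h4 := h1 i
    simp only [h2, Finset.sum_add_distrib] at h4
    rw [Finset.sum_comm (f := fun l j => E i j x * weakPartial l (E l j) x)] at h4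
    simp only [← Finset.mul_sum, h3, mul_zero, Finset.sum_const_zero, add_zero] at h4
    rw [Finset.sum_comm (f := fun j k => weakPartial k (E i j) x * E k j x)]
    linarith
  have mA := fun i => memLp_sum Finset.univ fun k _ => m1 i k
  have mB := fun i => memLp_sum Finset.univ fun j _ => memLp_sum Finset.univ fun k _ => m4 i j k
  have mC := fun i => memLp_sum Finset.univ fun k _ => m2 i k
  have mD := fun i => (memLp_sum Finset.univ fun k _ => m3 i k).const_mul μ
  have mp : ∀ i, MemLp (weakPartial i p) 2 volume := by
    intro i
    refine MemLp.ae_eq ?_ (((((mA i).add (mB i)).sub (mC i)).add (mD i)).sub (h.mem_ut i))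
    filter_upwards [heq] with x hx
    rw [hx i]; rfl
  have hp0 := sum_integral_mul_grad_eq_zero hw hws mp fun i => (hp i).choose_spec.weakPartial
  have key : ∀ i, ∫ x, w i x * ut i x = (∑ k, ∫ x, w i x * weakPartial k (E i k) x) +
      (∑ j, ∑ k, ∫ x, w i x * (weakPartial k (E i j) x * E k j x)) -
      (∑ k, ∫ x, w i x * (u k x * weakPartial k (u i) x)) -
      (∑ k, μ * ∫ x, Dw i k x * weakPartial k (u i) x) - ∫ x, w i x * weakPartial i p x := by
    intro i
    have iA := integrable_mul2 (hw i) (mA i)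
    have iB := integrable_mul2 (hw i) (mB i)
    have iC := integrable_mul2 (hw i) (mC i)
    have iD := integrable_mul2 (hw i) (mD i)
    have iP := integrable_mul2 (hw i) (mp i)
    have e : ∫ x, w i x * ut i x = ∫ x, (((w i x * ∑ k, weakPartial k (E i k) x) +
        w i x * ∑ j, ∑ k, weakPartial k (E i j) x * E k j x) -
        w i x * ∑ k, u k x * weakPartial k (u i) x) +
        w i x * (μ * ∑ k, weakPartial k (weakPartial k (u i)) x) - w i x * weakPartial i p x := by
      refine integral_congr_ae ?_
      filter_upwards [heq] with x hx
      rw [hx i]; ring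
    have hvis : ∀ k, ∫ x, w i x * weakPartial k (weakPartial k (u i)) x =
        - ∫ x, Dw i k x * weakPartial k (u i) x := fun k =>
      integral_mul_weak (hDw i k) ((h.reg_u i).weak_two k k) (hw i) (hDw2 i k)
        ((h.reg_u i).memLp_partial k) (m3 i k)
    have iAB : Integrable (fun x => w i x * ∑ k, weakPartial k (E i k) x +
        w i x * ∑ j, ∑ k, weakPartial k (E i j) x * E k j x) volume := iA.add iB
    have iABC : Integrable (fun x => (w i x * ∑ k, weakPartial k (E i k) x +
        w i x * ∑ j, ∑ k, weakPartial k (E i j) x * E k j x) -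
        w i x * ∑ k, u k x * weakPartial k (u i) x) volume := iAB.sub iC
    have iABCD : Integrable (fun x => ((w i x * ∑ k, weakPartial k (E i k) x +
        w i x * ∑ j, ∑ k, weakPartial k (E i j) x * E k j x) -
        w i x * ∑ k, u k x * weakPartial k (u i) x) +
        w i x * (μ * ∑ k, weakPartial k (weakPartial k (u i)) x)) volume := iABC.add iD
    rw [e, integral_sub iABCD iP, integral_add iABC iD, integral_sub iAB iC, integral_add iA iB,
      integral_mul_sum _ (hw i) (fun k _ => m1 i k), integral_mul_sum _ (hw i) (fun k _ => m2 i k),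
      integral_mul_sum _ (hw i) (fun j _ => memLp_sum Finset.univ fun k _ => m4 i j k)]
    simp only [integral_mul_sum _ (hw i) (fun k _ => m4 i _ k), mul_left_comm _ μ,
      integral_const_mul]
    rw [integral_mul_sum _ (hw i) (fun k _ => m3 i k)]
    simp only [hvis, Finset.sum_neg_distrib, ← Finset.mul_sum]
    ring
  simp only [key, Finset.sum_sub_distrib, Finset.sum_add_distrib, hp0]
  ring

/-- Energy balance of a strong solution: the convective terms vanish since `u` is solenoidal, and
the terms that couple `u` and `E` form the pairing of a column of `E` with a gradient. -/
lemma IsStrongAt.energy (h : IsStrongAt μ C u E ut Et) :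
    (∑ i, ∫ x, u i x * ut i x) + ∑ i, ∑ j, ∫ x, E i j x * Et i j x =
      - (μ * ∑ i, ∑ k, ∫ x, weakPartial k (u i) x * weakPartial k (u i) x) := by
  have hu := fun i => (h.reg_u i).memLp
  have hE := fun i j => (h.reg_E i j).memLp
  rw [h.pair_strain hE, h.pair_momentum hu (fun i k => (h.reg_u i).weak k)
    (fun i k => (h.reg_u i).memLp_partial k) h.mem_u]
  have a1 : ∀ i k, ∫ x, u i x * weakPartial k (E i k) x =
      - ∫ x, E i k x * weakPartial k (u i) x := fun i k => by
    rw [integral_mul_weak ((h.reg_u i).weak k) ((h.reg_E i k).weak k) (hu i)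
      ((h.reg_u i).memLp_partial k) (hE i k) ((h.reg_E i k).memLp_partial k)]
    simp only [mul_comm]
  have a2 : ∀ i, ∑ k, ∫ x, u i x * (u k x * weakPartial k (u i) x) = 0 := fun i => by
    rw [← (h.reg_u i).sum_integral_mul_grad_sq hu h.mem_u]
    simp only [mul_left_comm]
  have a3 : ∀ i j, ∑ k, ∫ x, E i j x * (u k x * weakPartial k (E i j) x) = 0 := fun i j => by
    rw [← (h.reg_E i j).sum_integral_mul_grad_sq hu h.mem_u]
    simp only [mul_left_comm]
  have a4 : ∀ i j, ∑ k, ((∫ x, u i x * (weakPartial k (E i j) x * E k j x)) +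
      ∫ x, E i j x * (weakPartial k (u i) x * E k j x)) = 0 := fun i j => by
    rw [← (h.reg_u i).sum_integral_mul_grad_mul (h.reg_E i j) (fun k => hE k j) (h.mem_E j)]
    refine Finset.sum_congr rfl fun k _ => ?_
    rw [← integral_add (integrable_mul2 (hu i) ((h.reg_E i j).partial_mul_left k (hE k j)))
      (integrable_mul2 (hE i j) ((h.reg_u i).partial_mul_left k (hE k j)))]
    congr 1; ext x; ring
  simp only [Finset.sum_sub_distrib, a1, a2, a3, ← Finset.mul_sum, Finset.sum_neg_distrib,
    Finset.sum_const_zero]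
  have a5 : (∑ i, ∑ j, ∑ k, ∫ x, u i x * (weakPartial k (E i j) x * E k j x)) +
      ∑ i, ∑ j, ∑ k, ∫ x, E i j x * (weakPartial k (u i) x * E k j x) = 0 := by
    simp only [← Finset.sum_add_distrib, a4, Finset.sum_const_zero]
  linarith

end

section
variable {μ C : ℝ} {u : Fin d → Space d → ℝ} {E : Fin d → Fin d → Space d → ℝ}
    {ut : Fin d → Space d → ℝ} {Et : Fin d → Fin d → Space d → ℝ}
    {w : Fin d → Space d → ℝ} {F : Fin d → Fin d → Space d → ℝ}

lemma toV_sub_mem {f g : Fin d → Space d → ℝ} (hf : ∀ i, MemLp (f i) 2 volume)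
    (hg : ∀ i, MemLp (g i) 2 volume) (hf' : toV f ∈ Lsigma d) (hg' : toV g ∈ Lsigma d) :
    toV (fun i x => f i x - g i x) ∈ Lsigma d := by
  have : toV (fun i x => f i x - g i x) = toV f - toV g := by
    ext1 i; exact toL2_sub (hf i) (hg i)
  rw [this]
  exact Submodule.sub_mem _ hf' hg'

/-- The squared distance of two states, as a function of the space variable. -/
def gap (u : Fin d → Space d → ℝ) (E : Fin d → Fin d → Space d → ℝ) (w : Fin d → Space d → ℝ)
    (F : Fin d → Fin d → Space d → ℝ) (x : Space d) : ℝ :=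
  (∑ i, (w i x - u i x) ^ 2) + ∑ i, ∑ j, (F i j x - E i j x) ^ 2

lemma gap_velocity (i : Fin d) (x : Space d) : (w i x - u i x) ^ 2 ≤ gap u E w F x := by
  have h1 := Finset.single_le_sum (f := fun i => (w i x - u i x) ^ 2)
    (fun i _ => sq_nonneg _) (Finset.mem_univ i)
  have h2 : 0 ≤ ∑ i, ∑ j, (F i j x - E i j x) ^ 2 :=
    Finset.sum_nonneg fun i _ => Finset.sum_nonneg fun j _ => sq_nonneg _
  simp only [gap]
  linarith

lemma gap_strain (i j : Fin d) (x : Space d) : (F i j x - E i j x) ^ 2 ≤ gap u E w F x := by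
  have h1 := Finset.single_le_sum (f := fun j => (F i j x - E i j x) ^ 2)
    (fun i _ => sq_nonneg _) (Finset.mem_univ j)
  have h2 := Finset.single_le_sum (f := fun i => ∑ j, (F i j x - E i j x) ^ 2)
    (fun i _ => Finset.sum_nonneg fun j _ => sq_nonneg _) (Finset.mem_univ i)
  have h3 : 0 ≤ ∑ i, (w i x - u i x) ^ 2 := Finset.sum_nonneg fun i _ => sq_nonneg _
  simp only [gap]
  linarith

lemma integrable_gap (hu : ∀ i, MemLp (u i) 2 volume) (hE : ∀ i j, MemLp (E i j) 2 volume)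
    (hw : ∀ i, MemLp (w i) 2 volume) (hF : ∀ i j, MemLp (F i j) 2 volume) :
    Integrable (gap u E w F) volume :=
  (integrable_finsetSum _ fun i _ => ((hw i).sub (hu i)).integrable_sq).add
    (integrable_finsetSum _ fun i _ => integrable_finsetSum _ fun j _ =>
      ((hF i j).sub (hE i j)).integrable_sq)

lemma abs_mul_le_of_sq_le {a b q : ℝ} (ha : a ^ 2 ≤ q) (hb : b ^ 2 ≤ q) : |a * b| ≤ q := by
  rw [abs_le]
  constructor <;> nlinarith [sq_nonneg (a + b), sq_nonneg (a - b)]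

lemma abs_mul_mul_le {a b q c C : ℝ} (ha : a ^ 2 ≤ q) (hb : b ^ 2 ≤ q) (hc : |c| ≤ C) :
    |a * b * c| ≤ C * q := by
  rw [abs_mul, mul_comm C]
  exact mul_le_mul (abs_mul_le_of_sq_le ha hb) hc (abs_nonneg _) ((sq_nonneg a).trans ha)

lemma abs_integral_le_mul {f g : Space d → ℝ} (hg : Integrable g volume)
    (h : ∀ᵐ x, |f x| ≤ C * g x) : |∫ x, f x| ≤ C * ∫ x, g x := by
  rw [← integral_const_mul]
  exact norm_integral_le_of_norm_le (f := f) (hg.const_mul C) h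

/-- The relative energy inequality at a fixed time: the terms that appear when the weak solution
`(w, F)` is paired with the strong solution `(u, E)` differ from the dissipation only by terms
which are quadratic in the difference of the solutions. The constant counts these terms: there are
`d²` of the form `(w - u)(w - u) ∇u`, and three families of `d³` that involve `F - E`. -/
lemma IsStrongAt.cross_bound (hμ : 0 ≤ μ) (h : IsStrongAt μ C u E ut Et)
    {Dw : Fin d → Fin d → Space d → ℝ} (hw : ∀ i, MemLp (w i) 2 volume)
    (hF : ∀ i j, MemLp (F i j) 2 volume)
    (hDw : ∀ i k, HasWeakPartial k (w i) (Dw i k)) (hDw2 : ∀ i k, MemLp (Dw i k) 2 volume)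
    (hws : toV w ∈ Lsigma d) (hFs : ∀ j, toV (fun i => F i j) ∈ Lsigma d) :
    -(((∑ i, ∑ k, ((∫ x, (w i x * w k x + -∑ j, F i j x * F k j x) * weakPartial k (u i) x) +
          ∫ x, (-F i k x + -μ * Dw i k x) * weakPartial k (u i) x)) + ∑ i, ∫ x, w i x * ut i x) +
      ∑ j, ((∑ i, ∑ k, ((∫ x, (F i j x * w k x + -(w i x * F k j x)) * weakPartial k (E i j) x) +
          ∫ x, (if k = j then -1 else 0) * w i x * weakPartial k (E i j) x)) +
        ∑ i, ∫ x, F i j x * Et i j x)) ≤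
      μ * (∑ i, ∑ k, ∫ x, Dw i k x ^ 2) + μ * (∑ i, ∑ k, ∫ x, weakPartial k (u i) x ^ 2) +
        (d ^ 2 + 3 * d ^ 3) * C * ∫ x, gap u E w F x := by
  have hu := fun i => (h.reg_u i).memLp
  have hE := fun i j => (h.reg_E i j).memLp
  have hU : ∀ i, MemLp (fun x => w i x - u i x) 2 volume := fun i => (hw i).sub (hu i)
  have hΦ : ∀ i j, MemLp (fun x => F i j x - E i j x) 2 volume := fun i j => (hF i j).sub (hE i j)
  have hUs := toV_sub_mem hw hu hws h.mem_u
  have hΦs := fun j => toV_sub_mem (fun i => hF i j) (fun i => hE i j) (hFs j) (h.mem_E j)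
  have hDu := fun i k => (h.reg_u i).memLp_partial k
  have hDE := fun i j k => (h.reg_E i j).memLp_partial k
  -- the products that occur are integrable
  have iwwD : ∀ i k l m, Integrable (fun x => w i x * w k x * weakPartial l (u m) x) volume :=
    fun i k l m => by
      simpa only [mul_assoc] using integrable_mul2 (hw i) ((h.reg_u m).partial_mul_right l (hw k))
  have iFFD : ∀ i j k l m n, Integrable (fun x => F i j x * F k l x * weakPartial m (u n) x)
      volume := fun i j k l m n => by
    simpa only [mul_assoc] using integrable_mul2 (hF i j) ((h.reg_u n).partial_mul_right m (hF k l))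
  have iFwD : ∀ i j k l m n, Integrable (fun x => F i j x * w k x * weakPartial l (E m n) x)
      volume := fun i j k l m n => by
    simpa only [mul_assoc] using integrable_mul2 (hF i j) ((h.reg_E m n).partial_mul_right l (hw k))
  have iwFD : ∀ i j k l m n, Integrable (fun x => w i x * F j k x * weakPartial l (E m n) x)
      volume := fun i j k l m n => by
    simpa only [mul_assoc] using
      integrable_mul2 (hw i) ((h.reg_E m n).partial_mul_right l (hF j k))
  have iwuD : ∀ i k l m, Integrable (fun x => w i x * (u k x * weakPartial l (u m) x)) volume :=
    fun i k l m => integrable_mul2 (hw i) ((h.reg_u k).mul_left (hDu m l))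
  have iwDE : ∀ i j k l m n, Integrable (fun x => w i x * (weakPartial j (E k l) x * E m n x))
      volume := fun i j k l m n =>
    integrable_mul2 (hw i) ((h.reg_E k l).partial_mul_left j (hE m n))
  have iFDE : ∀ i j k l m n, Integrable (fun x => F i j x * (weakPartial k (u l) x * E m n x))
      volume := fun i j k l m n =>
    integrable_mul2 (hF i j) ((h.reg_u l).partial_mul_left k (hE m n))
  have iFuD : ∀ i j k l m n, Integrable (fun x => F i j x * (u k x * weakPartial l (E m n) x))
      volume := fun i j k l m n =>
    integrable_mul2 (hF i j) ((h.reg_u k).mul_left (hDE m n l))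
  -- the fluxes of the momentum equation
  have eM1 : ∀ i k, ∫ x, (w i x * w k x + -∑ j, F i j x * F k j x) * weakPartial k (u i) x =
      (∫ x, w i x * w k x * weakPartial k (u i) x) -
        ∑ j, ∫ x, F i j x * F k j x * weakPartial k (u i) x := fun i k => by
    rw [← integral_finsetSum _ fun j _ => iFFD i j k j k i,
      ← integral_sub (iwwD i k k i) (integrable_finsetSum _ fun j _ => iFFD i j k j k i)]
    congr 1; ext x
    rw [← Finset.sum_mul]; ring
  have eM2 : ∀ i k, ∫ x, (-F i k x + -μ * Dw i k x) * weakPartial k (u i) x =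
      -(∫ x, F i k x * weakPartial k (u i) x) - μ * ∫ x, Dw i k x * weakPartial k (u i) x :=
    fun i k => by
      rw [← integral_const_mul, ← integral_neg,
        ← integral_sub (Integrable.fun_neg (integrable_mul2 (hF i k) (hDu i k)))
          ((integrable_mul2 (hDw2 i k) (hDu i k)).const_mul μ)]
      congr 1; ext x; ring
  have eN1 : ∀ i j k, ∫ x, (F i j x * w k x + -(w i x * F k j x)) * weakPartial k (E i j) x =
      (∫ x, F i j x * w k x * weakPartial k (E i j) x) -
        ∫ x, w i x * F k j x * weakPartial k (E i j) x := fun i j k => by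
    rw [← integral_sub (iFwD i j k k i j) (iwFD i k j k i j)]
    congr 1; ext x; ring
  have eN2 : ∀ i j, ∑ k, ∫ x, (if k = j then -1 else 0) * w i x * weakPartial k (E i j) x =
      - ∫ x, w i x * weakPartial j (E i j) x := fun i j => by
    rw [Finset.sum_eq_single j]
    · rw [← integral_neg]; congr 1; ext x; simp
    · intro k _ hk; simp [hk]
    · simp
  -- the trilinear terms combine to terms that are quadratic in the differences `w - u`, `F - E` and
  -- to pairings of a difference with a gradient, which vanish after summation over `k`
  have q1 : ∀ i k, (∫ x, w i x * w k x * weakPartial k (u i) x) -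
      ∫ x, w i x * (u k x * weakPartial k (u i) x) =
      (∫ x, (w i x - u i x) * (w k x - u k x) * weakPartial k (u i) x) +
        ∫ x, (w k x - u k x) * (u i x * weakPartial k (u i) x) := fun i k => by
    rw [← integral_sub (iwwD i k k i) (iwuD i k k i), ← integral_add]
    · congr 1; ext x; ring
    · simpa only [mul_assoc] using
        integrable_mul2 (hU i) ((h.reg_u i).partial_mul_right k (hU k))
    · exact integrable_mul2 (hU k) ((h.reg_u i).mul_left (hDu i k))
  have iΦuD : ∀ i j k, Integrable (fun x => (F k j x - E k j x) *
      (u i x * weakPartial k (E i j) x + E i j x * weakPartial k (u i) x)) volume := fun i j k =>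
    integrable_mul2 (hΦ k j) (((h.reg_u i).mul_left (hDE i j k)).add
      ((h.reg_E i j).mul_left (hDu i k)))
  have iUED : ∀ i j k, Integrable (fun x => (w k x - u k x) *
      (E i j x * weakPartial k (E i j) x)) volume := fun i j k =>
    integrable_mul2 (hU k) ((h.reg_E i j).mul_left (hDE i j k))
  have iR1 : ∀ i j k, Integrable (fun x => (w i x - u i x) * (F k j x - E k j x) *
      weakPartial k (E i j) x) volume := fun i j k => by
    simpa only [mul_assoc] using
      integrable_mul2 (hU i) ((h.reg_E i j).partial_mul_right k (hΦ k j))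
  have iR2 : ∀ i j k, Integrable (fun x => (F i j x - E i j x) * (F k j x - E k j x) *
      weakPartial k (u i) x) volume := fun i j k => by
    simpa only [mul_assoc] using
      integrable_mul2 (hΦ i j) ((h.reg_u i).partial_mul_right k (hΦ k j))
  have iR3 : ∀ i j k, Integrable (fun x => (F i j x - E i j x) * (w k x - u k x) *
      weakPartial k (E i j) x) volume := fun i j k => by
    simpa only [mul_assoc] using
      integrable_mul2 (hΦ i j) ((h.reg_E i j).partial_mul_right k (hU k))
  have q2 : ∀ i j k, -(∫ x, F i j x * F k j x * weakPartial k (u i) x) +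
      (∫ x, w i x * (weakPartial k (E i j) x * E k j x)) +
      ((∫ x, F i j x * w k x * weakPartial k (E i j) x) -
        ∫ x, w i x * F k j x * weakPartial k (E i j) x) +
      ((∫ x, F i j x * (weakPartial k (u i) x * E k j x)) -
        ∫ x, F i j x * (u k x * weakPartial k (E i j) x)) =
      -(∫ x, (w i x - u i x) * (F k j x - E k j x) * weakPartial k (E i j) x) -
      (∫ x, (F i j x - E i j x) * (F k j x - E k j x) * weakPartial k (u i) x) +
      (∫ x, (F i j x - E i j x) * (w k x - u k x) * weakPartial k (E i j) x) +
      (∫ x, (w k x - u k x) * (E i j x * weakPartial k (E i j) x)) -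
      ∫ x, (F k j x - E k j x) *
        (u i x * weakPartial k (E i j) x + E i j x * weakPartial k (u i) x) := fun i j k => by
    have a1 := iFFD i j k j k i
    have a2 := iwDE i k i j k j
    have a3 := iFwD i j k k i j
    have a4 := iwFD i k j k i j
    have a5 := iFDE i j k i k j
    have a6 := iFuD i j k k i j
    have b1 := iR1 i j k
    have b2 := iR2 i j k
    have b3 := iR3 i j k
    have b4 := iUED i j k
    have b5 := iΦuD i j k
    have e1 := integral_add' (a2.sub a1) ((a3.sub a4).add (a5.sub a6))
    have e2 := integral_add' ((b3.sub b1).sub b2) (b4.sub b5)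
    rw [integral_add' (a3.sub a4) (a5.sub a6), integral_sub' a2 a1, integral_sub' a3 a4,
      integral_sub' a5 a6] at e1
    rw [integral_sub' (b3.sub b1) b2, integral_sub' b3 b1, integral_sub' b4 b5] at e2
    refine (Eq.trans ?_ (e1.symm.trans (Eq.trans
      (integral_congr_ae (Eventually.of_forall fun x => ?_)) e2))).trans ?_
    · ring
    · simp only [Pi.add_apply, Pi.sub_apply]
      ring
    · ring
  -- the differences are solenoidal, hence orthogonal to gradients
  have z1 : ∀ i, ∑ k, ∫ x, (w k x - u k x) * (u i x * weakPartial k (u i) x) = 0 := fun i =>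
    (h.reg_u i).sum_integral_mul_grad_sq hU hUs
  have z2 : ∀ i j, ∑ k, ∫ x, (w k x - u k x) * (E i j x * weakPartial k (E i j) x) = 0 :=
    fun i j => (h.reg_E i j).sum_integral_mul_grad_sq hU hUs
  have z3 : ∀ i j, ∑ k, ∫ x, (F k j x - E k j x) *
      (u i x * weakPartial k (E i j) x + E i j x * weakPartial k (u i) x) = 0 := fun i j =>
    (h.reg_u i).sum_integral_mul_grad_mul (h.reg_E i j) (fun k => hΦ k j) (hΦs j)
  have Q1 := Finset.sum_congr rfl fun i (_ : i ∈ Finset.univ) =>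
    Finset.sum_congr rfl fun k (_ : k ∈ Finset.univ) => q1 i k
  have Q2 := Finset.sum_congr rfl fun i (_ : i ∈ Finset.univ) =>
    Finset.sum_congr rfl fun j (_ : j ∈ Finset.univ) =>
      Finset.sum_congr rfl fun k (_ : k ∈ Finset.univ) => q2 i j k
  set G := ∫ x, gap u E w F x with hG
  have iG : Integrable (gap u E w F) volume := integrable_gap hu hE hw hF
  -- the quadratic remainder
  have b0 : ∀ i k, |∫ x, (w i x - u i x) * (w k x - u k x) * weakPartial k (u i) x| ≤ C * G :=
    fun i k => abs_integral_le_mul iG <| by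
      filter_upwards [(h.reg_u i).bound_partial k] with x hx
      exact abs_mul_mul_le (gap_velocity i x) (gap_velocity k x) hx
  have b1 : ∀ i j k, |∫ x, (w i x - u i x) * (F k j x - E k j x) * weakPartial k (E i j) x| ≤
      C * G := fun i j k => abs_integral_le_mul iG <| by
      filter_upwards [(h.reg_E i j).bound_partial k] with x hx
      exact abs_mul_mul_le (gap_velocity i x) (gap_strain k j x) hx
  have b2 : ∀ i j k, |∫ x, (F i j x - E i j x) * (F k j x - E k j x) * weakPartial k (u i) x| ≤
      C * G := fun i j k => abs_integral_le_mul iG <| by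
      filter_upwards [(h.reg_u i).bound_partial k] with x hx
      exact abs_mul_mul_le (gap_strain i j x) (gap_strain k j x) hx
  have b3 : ∀ i j k, |∫ x, (F i j x - E i j x) * (w k x - u k x) * weakPartial k (E i j) x| ≤
      C * G := fun i j k => abs_integral_le_mul iG <| by
      filter_upwards [(h.reg_E i j).bound_partial k] with x hx
      exact abs_mul_mul_le (gap_strain i j x) (gap_velocity k x) hx
  have B0 := Finset.sum_le_sum fun i (_ : i ∈ Finset.univ) =>
    Finset.sum_le_sum fun k (_ : k ∈ Finset.univ) => (abs_le.1 (b0 i k)).1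
  have B1 := Finset.sum_le_sum fun i (_ : i ∈ Finset.univ) =>
    Finset.sum_le_sum fun j (_ : j ∈ Finset.univ) =>
      Finset.sum_le_sum fun k (_ : k ∈ Finset.univ) => (abs_le.1 (b1 i j k)).2
  have B2 := Finset.sum_le_sum fun i (_ : i ∈ Finset.univ) =>
    Finset.sum_le_sum fun j (_ : j ∈ Finset.univ) =>
      Finset.sum_le_sum fun k (_ : k ∈ Finset.univ) => (abs_le.1 (b2 i j k)).2
  have B3 := Finset.sum_le_sum fun i (_ : i ∈ Finset.univ) =>
    Finset.sum_le_sum fun j (_ : j ∈ Finset.univ) =>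
      Finset.sum_le_sum fun k (_ : k ∈ Finset.univ) => (abs_le.1 (b3 i j k)).1
  have dis : ∀ i k, 2 * ∫ x, Dw i k x * weakPartial k (u i) x ≤
      (∫ x, Dw i k x ^ 2) + ∫ x, weakPartial k (u i) x ^ 2 := fun i k => by
    rw [← integral_const_mul, ← integral_add (hDw2 i k).integrable_sq (hDu i k).integrable_sq]
    refine integral_mono ((integrable_mul2 (hDw2 i k) (hDu i k)).const_mul 2)
      ((hDw2 i k).integrable_sq.add (hDu i k).integrable_sq) fun x => ?_
    simp only
    nlinarith [sq_nonneg (Dw i k x - weakPartial k (u i) x)]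
  have D := mul_le_mul_of_nonneg_left (Finset.sum_le_sum fun i (_ : i ∈ Finset.univ) =>
    Finset.sum_le_sum fun k (_ : k ∈ Finset.univ) => dis i k) hμ
  have pu := h.pair_momentum hw hDw hDw2 hws
  have pE := h.pair_strain hF
  simp only [eM1, eM2, eN1, Finset.sum_add_distrib, eN2, Finset.sum_sub_distrib,
    Finset.sum_neg_distrib, z1, z2, z3, ← Finset.mul_sum, Finset.sum_const_zero,
    Finset.sum_const, Finset.card_univ, Fintype.card_fin, nsmul_eq_mul]
    at Q1 Q2 B0 B1 B2 B3 D pu pE ⊢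
  rw [Finset.sum_comm (f := fun i j => ∫ x, F j i x * Et j i x), pu, pE]
  rw [Finset.sum_comm (f := fun j i => ∑ k, ∫ x, F i j x * w k x * weakPartial k (E i j) x),
    Finset.sum_comm (f := fun j i => ∑ k, ∫ x, w i x * F k j x * weakPartial k (E i j) x),
    Finset.sum_comm (f := fun j i => ∫ x, w i x * weakPartial j (E i j) x)]
  rw [Finset.sum_congr rfl fun i _ =>
    Finset.sum_comm (f := fun k j => ∫ x, F i j x * F k j x * weakPartial k (u i) x)]
  linarith

end

/-! ### Regularity in time of strong solutions -/

lemma MemLqH.mono_order {q : ℝ≥0∞} {T : ℝ} {m n : ℕ} (h : m ≤ n) {f : ℝ → Space d → ℝ}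
    (hf : MemLqH q T n f) : MemLqH q T m f := by
  induction m generalizing n f with
  | zero => exact hf.zero
  | succ m ih =>
    obtain ⟨n, rfl⟩ : ∃ k, n = k + 1 := ⟨n - 1, by omega⟩
    refine ⟨hf.1, fun i => ?_⟩
    obtain ⟨g, hg, hgm⟩ := hf.2 i
    exact ⟨g, hg, ih (by omega) hgm⟩

lemma IsRegular.mono {C C' : ℝ} (h : C ≤ C') {f : Space d → ℝ} (hf : IsRegular C f) :
    IsRegular C' f where
  memLp := hf.memLp
  bound := hf.bound.mono fun _ hx => hx.trans h
  weak := hf.weak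
  memLp_partial := hf.memLp_partial
  bound_partial k := (hf.bound_partial k).mono fun _ hx => hx.trans h
  norm_partial k := (hf.norm_partial k).trans h
  weak_two := hf.weak_two
  memLp_two := hf.memLp_two

/-- A uniform bound in time for functions in `L^∞(0,T; H²)`, by the Sobolev embedding. -/
lemma exists_bound_of_H2 (hd : d ≤ 3) {T : ℝ} {f : ℝ → Space d → ℝ} (hf : MemLqH ⊤ T 2 f) :
    ∃ C, ∀ᵐ s ∂(timeMeasure T), ∀ᵐ x, |f s x| ≤ C := by
  choose g hg hgm using fun i => hf.exists_partial i
  choose h hh hhm using fun i => (hgm i).exists_partial i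
  obtain ⟨A, hA, hA'⟩ := ae_norm_toL2_of_top hf
  choose B hB hB' using fun i => ae_norm_toL2_of_top (hhm i)
  refine ⟨√(resolventConst d) * (A + ∑ j, B j), ?_⟩
  filter_upwards [hA', ae_all_iff.2 hB', ae_all_iff.2 hg, ae_all_iff.2 hh, hf.ae_memLp le_top,
    ae_all_iff.2 fun i => (hgm i).ae_memLp le_top,
    ae_all_iff.2 fun i => (hhm i).ae_memLp le_top] with s a b c d e f g
  filter_upwards [ae_abs_le_of_H2 hd e f g c d] with x hx
  refine hx.trans ?_
  gcongr with j
  exact b j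

/-- A function in `L^∞(0,T; H³)` is bounded in space together with its first derivatives, uniformly
in time. -/
lemma exists_isRegular (hd : d ≤ 3) {T : ℝ} {f : ℝ → Space d → ℝ} (hf : MemLqH ⊤ T 3 f) :
    ∃ C, ∀ᵐ s ∂(timeMeasure T), IsRegular C (f s) := by
  choose g hg hgm using fun i => hf.exists_partial i
  choose h hh hhm using fun i k => (hgm i).exists_partial k
  obtain ⟨A, hA⟩ := exists_bound_of_H2 hd (hf.mono_order (by norm_num : 2 ≤ 3))
  choose B hB using fun i => exists_bound_of_H2 hd (hgm i)
  choose D hD hD' using fun i => ae_norm_toL2_of_top (hgm i)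
  refine ⟨|A| + ∑ i, |B i| + ∑ i, D i, ?_⟩
  have hBi : ∀ i, |B i| ≤ ∑ i, |B i| := fun i =>
    Finset.single_le_sum (f := fun i => |B i|) (fun i _ => abs_nonneg _) (Finset.mem_univ i)
  have hDi : ∀ i, D i ≤ ∑ i, D i := fun i =>
    Finset.single_le_sum (f := D) (fun i _ => hD i) (Finset.mem_univ i)
  have hB0 : 0 ≤ ∑ i, |B i| := Finset.sum_nonneg fun i _ => abs_nonneg _
  have hD0 : 0 ≤ ∑ i, D i := Finset.sum_nonneg fun i _ => hD i
  filter_upwards [hA, ae_all_iff.2 hB, ae_all_iff.2 hD', ae_all_iff.2 hg,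
    ae_all_iff.2 fun i => ae_all_iff.2 (hh i), hf.ae_memLp le_top,
    ae_all_iff.2 fun i => (hgm i).ae_memLp le_top,
    ae_all_iff.2 fun i => ae_all_iff.2 fun k => (hhm i k).ae_memLp le_top] with s a b c d e f g h
  have e1 : ∀ i, weakPartial i _ =ᵐ[volume] _ := fun i => (d i).weakPartial_ae_eq
  have e2 := fun i k => (e i k).congr (e1 i).symm EventuallyEq.rfl
  exact
    { memLp := f
      bound := a.mono fun x hx => by linarith [le_abs_self A]
      weak := fun k => (d k).weakPartial
      memLp_partial := fun k => (g k).ae_eq (e1 k).symm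
      bound_partial := fun k => by
        filter_upwards [b k, e1 k] with x hx hx'
        rw [hx']
        linarith [le_abs_self (B k), hBi k, abs_nonneg A]
      norm_partial := fun k => by
        rw [toL2_congr (e1 k)]
        linarith [c k, hDi k, abs_nonneg A]
      weak_two := fun k l => (e2 k l).weakPartial
      memLp_two := fun k l => (h k l).ae_eq (e2 k l).weakPartial_ae_eq.symm }

/-- A property that is closed and holds for almost every time holds for every time, for
continuous functions. -/
lemma mem_of_ae_mem_of_continuousOn {V : Type*} [TopologicalSpace V] {τ : ℝ} (hτ : 0 < τ)
    {F : ℝ → V} {K : Set V} (hK : IsClosed K) (hF : ContinuousOn F (Icc 0 τ))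
    (h : ∀ᵐ t ∂(timeMeasure τ), F t ∈ K) {t : ℝ} (ht : t ∈ Icc 0 τ) : F t ∈ K := by
  have hsub : Ioo 0 τ ∩ {s | F s ∈ K} ⊆ Icc 0 τ := fun s hs => Ioo_subset_Icc_self hs.1
  have hcl : t ∈ closure (Ioo 0 τ ∩ {s | F s ∈ K}) := by
    rw [mem_closure_iff]
    intro U hU htU
    rw [← closure_Ioo hτ.ne] at ht
    have hne := mem_closure_iff.1 ht U hU htU
    have hpos := (hU.inter isOpen_Ioo).measure_pos volume hne
    by_contra hemp
    rw [not_nonempty_iff_eq_empty] at hemp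
    have h0 := (ae_restrict_iff' measurableSet_Ioo).1 h
    refine hpos.ne' (measure_mono_null (fun s hs => ?_) h0)
    intro hs'
    have : s ∈ U ∩ (Ioo 0 τ ∩ {s | F s ∈ K}) := ⟨hs.1, hs.2, hs' hs.2⟩
    rw [hemp] at this
    exact this
  have := ((hF t ht).mono hsub).mem_closure hcl (t := K) fun s hs => hs.2
  rwa [hK.closure_eq] at this

lemma continuousOn_primitive {V : Type*} [NormedAddCommGroup V] [NormedSpace ℝ V] {τ : ℝ}
    (hτ : 0 ≤ τ) {f : ℝ → V} (hf : Integrable f (timeMeasure τ)) :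
    ContinuousOn (fun t => ∫ s in (0 : ℝ)..t, f s) (Icc 0 τ) := by
  have := (intervalIntegrable_iff_integrableOn_Icc_of_le hτ).1
    (intervalIntegrable_of_timeMeasure ⟨hτ, le_rfl⟩ hf)
  simpa [uIcc_of_le hτ] using intervalIntegral.continuousOn_primitive_interval (a := 0)
    (b := τ) (by simpa [uIcc_of_le hτ] using this)

/-- An identity with pointwise time integrals, as in the definition of strong solutions, is one with
Bochner integrals in `L²`. -/
lemma toL2_primitive {T : ℝ} {f f' : ℝ → Space d → ℝ} {f₀ : Space d → ℝ}
    (hf₀ : MemLp f₀ 2 volume) (hf' : MemLqH 2 T 0 f')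
    (h : ∀ t ∈ Icc 0 T, ∀ᵐ x, f t x = f₀ x + ∫ s in (0 : ℝ)..t, f' s x) {t : ℝ}
    (ht : t ∈ Icc 0 T) :
    MemLp (f t) 2 volume ∧ toL2 (f t) = toL2 f₀ + ∫ s in (0 : ℝ)..t, toL2 (f' s) := by
  have h2 := toL2_integral ht hf'
  have hm := (Lp.memLp (∫ s in (0 : ℝ)..t, toL2 (f' s))).ae_eq h2.symm
  have e : f t =ᵐ[volume] fun x => f₀ x + ∫ s in (0 : ℝ)..t, f' s x := h t ht
  refine ⟨(hf₀.add hm).ae_eq e.symm, ?_⟩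
  rw [toL2_congr e, toL2_add hf₀ hm, toL2_congr h2, toL2_coeFn]

lemma toV_primitive {T : ℝ} {f f' : Fin d → ℝ → Space d → ℝ} {f₀ : Fin d → Space d → ℝ}
    (hf₀ : ∀ i, MemLp (f₀ i) 2 volume) (hf' : ∀ i, MemLqH 2 T 0 (f' i))
    (h : ∀ t ∈ Icc 0 T, ∀ᵐ x, ∀ i, f i t x = f₀ i x + ∫ s in (0 : ℝ)..t, f' i s x) {t : ℝ}
    (ht : t ∈ Icc 0 T) :
    (toV fun i => f i t) = toV f₀ + ∫ s in (0 : ℝ)..t, toV fun i => f' i s := by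
  ext1 i
  have hi := (intervalIntegrable_iff_integrableOn_Ioc_of_le ht.1).1
    (intervalIntegrable_of_timeMeasure ht (integrable_toV hf'))
  have := (toL2_primitive (hf₀ i) (hf' i) (fun t ht => (h t ht).mono fun x hx => hx i) ht).2
  rw [intervalIntegral.integral_of_le ht.1] at this ⊢
  rw [PiLp.add_apply, eval_integral_piLp fun j => Integrable.eval_piLp hi j]
  exact this

/-! ### Propagation of the constraint on the columns of the strain -/

section
variable {C : ℝ} {u e et : Fin d → Space d → ℝ}

/-- The divergence of a vector field, by weak derivatives. -/
noncomputable def wdiv (e : Fin d → Space d → ℝ) (x : Space d) : ℝ := ∑ i, weakPartial i (e i) x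

/-- The gradient of the divergence of a vector field. -/
noncomputable def gradDiv (e : Fin d → Space d → ℝ) (l : Fin d) (x : Space d) : ℝ :=
  ∑ i, weakPartial l (weakPartial i (e i)) x

lemma memLp_wdiv (he : ∀ i, IsRegular C (e i)) : MemLp (wdiv e) 2 volume :=
  memLp_sum _ fun i _ => (he i).memLp_partial i

lemma memLp_gradDiv (he : ∀ i, IsRegular C (e i)) (l : Fin d) : MemLp (gradDiv e l) 2 volume :=
  memLp_sum _ fun i _ => (he i).memLp_two i l

lemma hasWeakPartial_wdiv (he : ∀ i, IsRegular C (e i)) (l : Fin d) :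
    HasWeakPartial l (wdiv e) (gradDiv e l) :=
  hasWeakPartial_sum _ fun i _ => (he i).weak_two i l

lemma wdiv_bound (he : ∀ i, IsRegular C (e i)) : ∀ᵐ x, |wdiv e x| ≤ ∑ _ : Fin d, C := by
  filter_upwards [ae_all_iff.2 fun i => (he i).bound_partial i] with x hx
  exact (Finset.abs_sum_le_sum_abs _ _).trans (Finset.sum_le_sum fun i _ => hx i)

lemma memLp_transport (hu : ∀ i, IsRegular C (u i)) (he : ∀ i, IsRegular C (e i)) :
    MemLp (fun x => ∑ l, u l x * gradDiv e l x) 2 volume :=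
  memLp_sum _ fun l _ => (hu l).mul_left (memLp_gradDiv he l)

/-- Transport by a solenoidal field is skew-symmetric. -/
lemma integral_transport_mul_wdiv (hu : ∀ i, IsRegular C (u i)) (hus : toV u ∈ Lsigma d)
    (he : ∀ i, IsRegular C (e i)) :
    ∫ x, (∑ l, u l x * gradDiv e l x) * wdiv e x = 0 := by
  have hq := memLp_wdiv he
  have hm : ∀ l, MemLp (fun x => wdiv e x * gradDiv e l x) 2 volume := fun l =>
    memLp_bdd_mul (memLp_gradDiv he l) hq.1 (wdiv_bound he)
  have h2 := sum_integral_mul_grad_eq_zero (p := fun x => wdiv e x * wdiv e x)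
    (fun i => (hu i).memLp) hus
    (G := fun l x => wdiv e x * gradDiv e l x + wdiv e x * gradDiv e l x)
    (fun l => (hm l).add (hm l)) fun l => by
      refine ((hasWeakPartial_wdiv he l).mul (hasWeakPartial_wdiv he l) hq (memLp_gradDiv he l) hq
        (memLp_gradDiv he l)).congr EventuallyEq.rfl (Eventually.of_forall fun x => ?_)
      simp only; ring
  have e1 : ∀ l, ∫ x, u l x * (wdiv e x * gradDiv e l x + wdiv e x * gradDiv e l x) =
      2 * ∫ x, u l x * gradDiv e l x * wdiv e x := fun l => by
    rw [← integral_const_mul]; congr 1; ext x; ring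
  simp only [e1, ← Finset.mul_sum] at h2
  simp only [Finset.sum_mul]
  rw [integral_finsetSum _ fun l _ => integrable_mul2 ((hu l).mul_left (memLp_gradDiv he l)) hq]
  linarith

/-- The equation for the strain, tested with a gradient: in the sense of distributions, the
divergence of the time derivative of a column is `- u · ∇ q`, with `q` the divergence of the
column. -/
lemma sum_integral_strain_grad {E Et : Fin d → Fin d → Space d → ℝ}
    (hu : ∀ i, IsRegular C (u i)) (hdiv : ∀ᵐ x, ∑ i, weakPartial i (u i) x = 0)
    (hE : ∀ i j, IsRegular C (E i j))
    (hst : ∀ᵐ x, ∀ i j, Et i j x + (∑ l, u l x * weakPartial l (E i j) x) =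
      weakPartial j (u i) x + ∑ l, weakPartial l (u i) x * E l j x)
    {φ : Space d → ℝ} (hφ : IsTest φ) (j : Fin d) :
    ∑ i, ∫ x, partialD i φ x * Et i j x =
      ∫ x, (∑ l, u l x * gradDiv (fun i => E i j) l x) * φ x := by
  have hus := mem_Lsigma_of_div hu hdiv
  have hu2 := fun i => (hu i).memLp
  have hE2 := fun i => (hE i j).memLp
  have hφi := fun i => hφ.partialD i
  have he := fun i => hE i j
  set q := wdiv fun i => E i j with hq
  simp only [integral_mul_strain hu hE hst ((hφi _).memLp 2), Finset.sum_add_distrib]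
  have a1 : ∑ i, ∫ x, partialD i φ x * weakPartial j (u i) x = 0 := by
    have := (mem_Lsigma_iff hu2).1 hus _ (hφi j)
    rw [← neg_eq_zero, ← this, ← Finset.sum_neg_distrib]
    refine Finset.sum_congr rfl fun i _ => ?_
    simp only [partialD_comm hφ.1 i j]
    rw [((hu i).weak j).test (hφi i)]
    simp only [mul_comm]
  have a2 : ∀ i k, ∫ x, partialD i φ x * (weakPartial k (u i) x * E k j x) =
      -(∫ x, u i x * E k j x * partialD k (partialD i φ) x) -
        ∫ x, u i x * weakPartial k (E k j) x * partialD i φ x := fun i k => by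
    rw [((hu i).weakPartial_mul (hE k j) k).test (hφi i), neg_neg, ← integral_sub]
    · congr 1; ext x; ring
    · exact integrable_mul2 (((hu i).partial_mul_left k (hE2 k)).add
        ((hu i).mul_left ((hE k j).memLp_partial k))) ((hφi i).memLp 2)
    · exact integrable_mul2 ((hu i).mul_left ((hE k j).memLp_partial k)) ((hφi i).memLp 2)
  have a3 : ∀ i k, ∫ x, partialD i φ x * (u k x * weakPartial k (E i j) x) =
      -(∫ x, u k x * E i j x * partialD k (partialD i φ) x) -
        ∫ x, E i j x * partialD i φ x * weakPartial k (u k) x := fun i k => by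
    rw [((hu k).weakPartial_mul (hE i j) k).test (hφi i), neg_neg, ← integral_sub]
    · congr 1; ext x; ring
    · exact integrable_mul2 (((hu k).partial_mul_left k (hE2 i)).add
        ((hu k).mul_left ((hE i j).memLp_partial k))) ((hφi i).memLp 2)
    · exact integrable_mul2 ((hφi i).memLp_mul (hE2 i)) ((hu k).memLp_partial k)
  have a4 : ∀ i, ∑ k, ∫ x, E i j x * partialD i φ x * weakPartial k (u k) x = 0 := fun i => by
    rw [← integral_mul_sum _ ((hφi i).memLp_mul (hE2 i)) fun k _ => (hu k).memLp_partial k]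
    refine integral_eq_zero_of_ae ?_
    filter_upwards [hdiv] with x hx
    rw [hx, mul_zero]; rfl
  have a5 : ∑ i, ∑ k, ∫ x, u i x * E k j x * partialD k (partialD i φ) x =
      ∑ i, ∑ k, ∫ x, u k x * E i j x * partialD k (partialD i φ) x := by
    rw [Finset.sum_comm]
    simp only [partialD_comm hφ.1 _ _]
  have a6 : ∀ i, ∑ k, ∫ x, u i x * weakPartial k (E k j) x * partialD i φ x =
      ∫ x, u i x * (q x * partialD i φ x) := fun i => by
    rw [← integral_finsetSum _ fun k _ =>
      integrable_mul2 ((hu i).mul_left ((hE k j).memLp_partial k)) ((hφi i).memLp 2)]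
    congr 1; ext x
    simp only [hq, wdiv, Finset.sum_mul, Finset.mul_sum, mul_assoc]
  have a7 := sum_integral_mul_grad_eq_zero (p := fun x => q x * φ x) hu2 hus
    (fun l => (hφ.memLp_mul (memLp_gradDiv he l)).add ((hφi l).memLp_mul (memLp_wdiv he)))
    fun l => (hasWeakPartial_wdiv he l).mul_test hφ
  have a8 : ∀ i, ∫ x, u i x * (gradDiv (fun i => E i j) i x * φ x + q x * partialD i φ x) =
      (∫ x, u i x * gradDiv (fun i => E i j) i x * φ x) +
        ∫ x, u i x * (q x * partialD i φ x) := fun i => by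
    rw [← integral_add]
    · congr 1; ext x; ring
    · exact integrable_mul2 ((hu i).mul_left (memLp_gradDiv he i)) (hφ.memLp 2)
    · exact integrable_mul2 (hu2 i) ((hφi i).memLp_mul (memLp_wdiv he))
  simp only [Pi.add_apply, ← hq, a8, Finset.sum_add_distrib] at a7
  simp only [a2, a3, Finset.sum_sub_distrib, Finset.sum_neg_distrib, a1, a4, a6,
    Finset.sum_const_zero, Finset.sum_mul]
  rw [integral_finsetSum _ fun l _ => integrable_mul2 ((hu l).mul_left (memLp_gradDiv he l))
    (hφ.memLp 2), a5]
  linarith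

end

lemma toL2_sum {ι : Type*} (s : Finset ι) {f : ι → Space d → ℝ}
    (hf : ∀ i ∈ s, MemLp (f i) 2 volume) : toL2 (fun x => ∑ i ∈ s, f i x) = ∑ i ∈ s, toL2 (f i) := by
  classical
  induction s using Finset.induction_on with
  | empty => simp only [Finset.sum_empty]; rw [toL2_eq MemLp.zero']; rfl
  | insert a s ha ih =>
    simp only [Finset.sum_insert ha]
    rw [← ih fun i hi => hf i (by simp [hi]), ← toL2_add (hf a (by simp))
      (memLp_sum s fun i hi => hf i (by simp [hi]))]

lemma norm_toL2_bdd_mul {f g : Space d → ℝ} (hf : MemLp f 2 volume) {C : ℝ}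
    (hg : ∀ᵐ x, |g x| ≤ C) : ‖toL2 (fun x => g x * f x)‖ ≤ |C| * ‖toL2 f‖ := by
  by_cases hm : MemLp (fun x => g x * f x) 2 volume
  · rw [norm_toL2 hm, norm_toL2 hf]
    have := eLpNorm_le_mul_eLpNorm_of_ae_le_mul (f := fun x => g x * f x) (g := f) (c := |C|)
      (μ := volume) (by
        filter_upwards [hg] with x hx
        rw [norm_mul]
        exact mul_le_mul_of_nonneg_right (hx.trans (le_abs_self C)) (norm_nonneg _)) 2
    refine (ENNReal.toReal_mono (ENNReal.mul_lt_top ENNReal.ofReal_lt_top hf.2).ne this).trans ?_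
    rw [ENNReal.toReal_mul, ENNReal.toReal_ofReal (abs_nonneg _)]
  · rw [toL2, dif_neg hm, norm_zero]; positivity

lemma L2_eq_of_test {f g : L2 d}
    (h : ∀ φ, IsTest φ → inner ℝ f (toL2 φ) = inner ℝ g (toL2 φ)) : f = g := by
  rw [← toL2_coeFn f, ← toL2_coeFn g] at h ⊢
  refine toL2_congr (ae_eq_of_integral_contDiff_smul_eq (Lp.memLp f).locInt
    (Lp.memLp g).locInt fun φ h1 h2 => ?_)
  have hφ : IsTest φ := ⟨h1, h2⟩
  have := h φ hφ
  rw [inner_toL2 (Lp.memLp f) (hφ.memLp 2), inner_toL2 (Lp.memLp g) (hφ.memLp 2)] at this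
  simpa only [smul_eq_mul, mul_comm] using this

/-- The columns of the strain of a strong solution stay solenoidal: the divergence `q` of a column
solves the transport equation `∂ₜ q + u · ∇ q = 0` with initial value `0`, so its `L²` norm is
constant in time. -/
lemma strain_div_free {τ C : ℝ} {u : Fin d → ℝ → Space d → ℝ}
    {E Et : Fin d → Fin d → ℝ → Space d → ℝ} {E₀ : Fin d → Space d → ℝ} {j : Fin d}
    (hum : ∀ i, AEStronglyMeasurable (uncurry (u i)) ((timeMeasure τ).prod volume))
    (hEm : ∀ i, MemLqH ⊤ τ 2 (E i j)) (hEt : ∀ i j, MemLqH 2 τ 0 (Et i j))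
    (hE₀ : ∀ i, MemLp (E₀ i) 2 volume) (hE₀s : toV E₀ ∈ Lsigma d)
    (hE : ∀ t ∈ Icc 0 τ, (toV fun i => E i j t) = toV E₀ + ∫ s in (0 : ℝ)..t, toV fun i => Et i j s)
    (hreg : ∀ᵐ s ∂(timeMeasure τ), (∀ i, IsRegular C (u i s)) ∧
      (∀ᵐ x, ∑ i, weakPartial i (u i s) x = 0) ∧ (∀ i j, IsRegular C (E i j s)) ∧
      ∀ᵐ x, ∀ i j, Et i j s x + (∑ l, u l s x * weakPartial l (E i j s) x) =
        weakPartial j (u i s) x + ∑ l, weakPartial l (u i s) x * E l j s x) :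
    ∀ᵐ s ∂(timeMeasure τ), ∀ᵐ x, ∑ i, weakPartial i (E i j s) x = 0 := by
  have hmem : ∀ᵐ s ∂(timeMeasure τ), s ∈ Icc 0 τ := by
    filter_upwards [ae_restrict_mem measurableSet_Ioo] with s hs using Ioo_subset_Icc_self hs
  set q : ℝ → Space d → ℝ := fun s => wdiv fun i => E i j s with hq
  set r : ℝ → Space d → ℝ := fun s x => ∑ l, u l s x * gradDiv (fun i => E i j s) l x with hr
  have hEt2 : ∀ᵐ s ∂(timeMeasure τ), ∀ i, MemLp (Et i j s) 2 volume :=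
    ae_all_iff.2 fun i => (hEt i j).ae_memLp (by norm_num)
  -- the transport term `r` is integrable in time; its joint measurability comes from the
  -- representatives `h` of the second derivatives, as `weakPartial` is chosen separately at each time
  choose g hg hgm using fun i => (hEm i).exists_partial i
  choose h hh hhm using fun i l => (hgm i).exists_partial l
  have hri : Integrable (fun s => toL2 (r s)) (timeMeasure τ) := by
    set R : ℝ → Space d → ℝ := fun s x => ∑ l, u l s x * ∑ i, h i l s x with hR
    have hRm : AEStronglyMeasurable (uncurry R) ((timeMeasure τ).prod volume) := by
      have : uncurry R = fun p => ∑ l, uncurry (u l) p * ∑ i, uncurry (h i l) p := rfl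
      rw [this]
      exact Finset.aestronglyMeasurable_fun_sum _ fun l _ => (hum l).mul
        (Finset.aestronglyMeasurable_fun_sum _ fun i _ => (hhm i l).zero.1)
    choose B hB hB' using fun i l => ae_norm_toL2_of_top (hhm i l)
    have hrR : ∀ᵐ s ∂(timeMeasure τ), toL2 (R s) = toL2 (r s) ∧
        ‖toL2 (r s)‖ ≤ ∑ l, |C| * ∑ i, B i l := by
      filter_upwards [hreg, ae_all_iff.2 hg, ae_all_iff.2 fun i => ae_all_iff.2 (hh i),
        ae_all_iff.2 fun i => ae_all_iff.2 (hB' i),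
        ae_all_iff.2 fun i => ae_all_iff.2 fun l => (hhm i l).ae_memLp le_top]
        with s hs h1 h2 h3 h4
      have e1 : ∀ i, weakPartial i (E i j s) =ᵐ[volume] g i s := fun i => (h1 i).weakPartial_ae_eq
      have e2 : ∀ i l, weakPartial l (weakPartial i (E i j s)) =ᵐ[volume] h i l s := fun i l =>
        ((h2 i l).congr (e1 i).symm EventuallyEq.rfl).weakPartial_ae_eq
      have e3 : toL2 (R s) = toL2 (r s) := by
        refine toL2_congr ?_
        filter_upwards [ae_all_iff.2 fun i => ae_all_iff.2 (e2 i)] with x hx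
        simp only [hR, hr, gradDiv, hx]
      refine ⟨e3, ?_⟩
      have hmul : ∀ l, MemLp (fun x => u l s x * gradDiv (fun i => E i j s) l x) 2 volume :=
        fun l => (hs.1 l).mul_left (memLp_gradDiv (fun i => hs.2.2.1 i j) l)
      simp only [hr]
      rw [toL2_sum _ fun l _ => hmul l]
      refine (norm_sum_le _ _).trans (Finset.sum_le_sum fun l _ => ?_)
      refine (norm_toL2_bdd_mul (memLp_gradDiv (fun i => hs.2.2.1 i j) l) (hs.1 l).bound).trans ?_
      gcongr
      unfold gradDiv
      rw [toL2_sum _ fun i _ => (hs.2.2.1 i j).memLp_two i l]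
      refine (norm_sum_le _ _).trans (Finset.sum_le_sum fun i _ => ?_)
      rw [toL2_congr (e2 i l)]
      exact h3 i l
    refine Integrable.of_bound ((aestronglyMeasurable_toL2 hRm).congr ?_)
      (∑ l, |C| * ∑ i, B i l) ?_
    · filter_upwards [hrR] with s hs using hs.1
    · filter_upwards [hrR] with s hs using hs.2
  have hII : ∀ t ∈ Icc 0 τ, IntervalIntegrable (fun s => toL2 (r s)) volume 0 t := fun t ht =>
    intervalIntegrable_of_timeMeasure ht hri
  -- the transport equation in integrated form
  have hqr : ∀ᵐ t ∂(timeMeasure τ), toL2 (q t) = -∫ s in (0 : ℝ)..t, toL2 (r s) := by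
    filter_upwards [hreg, hmem] with t ht htm
    refine L2_eq_of_test fun φ hφ => ?_
    have hφi := fun i => (hφ.partialD i).memLp 2
    have he := fun i => ht.2.2.1 i j
    have e1 : inner ℝ (toL2 (q t)) (toL2 φ) =
        - inner ℝ (toV fun i => E i j t) (toV fun i => partialD i φ) := by
      rw [inner_toL2 (memLp_wdiv he) (hφ.memLp 2), inner_toV (fun i => (he i).memLp) hφi]
      simp only [((he _).weak _).test hφ, Finset.sum_neg_distrib, neg_neg, wdiv,
        Finset.sum_mul]
      exact integral_finsetSum _ fun i _ => integrable_mul2 ((he i).memLp_partial i) (hφ.memLp 2)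
    have e2 : inner ℝ (toV E₀) (toV fun i => partialD i φ) = 0 := by
      rw [inner_toV hE₀ hφi]; exact (mem_Lsigma_iff hE₀).1 hE₀s φ hφ
    rw [e1, hE t htm, inner_add_left, e2, zero_add, inner_neg_left,
      intervalIntegral.integral_of_le htm.1, intervalIntegral.integral_of_le htm.1,
      inner_setIntegral_left ((intervalIntegrable_iff_integrableOn_Ioc_of_le htm.1).1
        (intervalIntegrable_of_timeMeasure htm (integrable_toV fun i => hEt i j))),
      inner_setIntegral_left ((intervalIntegrable_iff_integrableOn_Ioc_of_le htm.1).1 (hII t htm)),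
      ← intervalIntegral.integral_of_le htm.1, ← intervalIntegral.integral_of_le htm.1]
    congr 1
    refine intervalIntegral_congr_timeMeasure htm ?_
    filter_upwards [hreg, hEt2] with s hs h2
    rw [inner_toV h2 hφi, inner_toL2 (memLp_transport hs.1 fun i => hs.2.2.1 i j) (hφ.memLp 2),
      ← sum_integral_strain_grad hs.1 hs.2.1 hs.2.2.1 hs.2.2.2 hφ j]
    simp only [mul_comm]
  filter_upwards [hqr, hmem, hreg] with t ht htm hregt
  -- conservation of the `L²` norm, by skew-symmetry of the transport term
  have key := inner_primitive (x := fun t => ∫ s in (0 : ℝ)..t, toL2 (r s))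
    (y := fun t => ∫ s in (0 : ℝ)..t, toL2 (r s)) htm.1 (hII t htm) (hII t htm)
    (fun s _ => by simp) (fun s _ => by simp)
  have h0 : ∫ s in (0 : ℝ)..t, (inner ℝ (toL2 (r s)) (∫ s' in (0 : ℝ)..s, toL2 (r s')) +
      inner ℝ (∫ s' in (0 : ℝ)..s, toL2 (r s')) (toL2 (r s))) = ∫ s in (0 : ℝ)..t, (0 : ℝ) := by
    refine intervalIntegral_congr_timeMeasure htm ?_
    filter_upwards [hqr, hreg] with s hs hrs
    have he := fun i => hrs.2.2.1 i j
    have : inner ℝ (toL2 (r s)) (toL2 (q s)) = 0 := by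
      rw [inner_toL2 (memLp_transport hrs.1 he) (memLp_wdiv he)]
      exact integral_transport_mul_wdiv hrs.1 (mem_Lsigma_of_div hrs.1 hrs.2.1) he
    rw [hs, inner_neg_right, neg_eq_zero] at this
    rw [real_inner_comm (toL2 (r s)), this, add_zero]
  rw [h0] at key
  simp only [intervalIntegral.integral_same, inner_zero_left, intervalIntegral.integral_zero,
    add_zero, inner_self_eq_zero] at key
  rw [key, neg_zero] at ht
  have hz : toL2 (q t) = toL2 (fun _ => 0) := by
    rw [ht, toL2_eq MemLp.zero']; rfl
  exact toL2_inj (memLp_wdiv fun i => hregt.2.2.1 i j) MemLp.zero' hz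

/-! ### Strong solutions as absolutely continuous paths in `L²` -/

lemma MemLqH.memLp_toL2_weakPartial {T : ℝ} {m : ℕ} {f : ℝ → Space d → ℝ}
    (hf : MemLqH 2 T (m + 1) f) (k : Fin d) :
    MemLp (fun s => toL2 (weakPartial k (f s))) 2 (timeMeasure T) ∧
      ∀ᵐ s ∂(timeMeasure T), HasWeakPartial k (f s) (weakPartial k (f s)) ∧
        MemLp (weakPartial k (f s)) 2 volume := by
  obtain ⟨g, hg, hgm⟩ := hf.exists_partial k
  refine ⟨(hgm.memLp_toL2 (by norm_num)).ae_eq ?_, ?_⟩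
  · filter_upwards [hg] with s hs using toL2_congr hs.weakPartial_ae_eq.symm
  · filter_upwards [hg, hgm.ae_memLp (by norm_num)] with s hs hs'
    exact ⟨hs.weakPartial, hs'.ae_eq hs.weakPartial_ae_eq.symm⟩

lemma integrable_integral_sq {T : ℝ} {g : ℝ → Space d → ℝ}
    (hg : MemLp (fun s => toL2 (g s)) 2 (timeMeasure T))
    (hg' : ∀ᵐ s ∂(timeMeasure T), MemLp (g s) 2 volume) :
    Integrable (fun s => ∫ x, g s x ^ 2) (timeMeasure T) := by
  refine ((memLp_two_iff_integrable_sq_norm hg.1).1 hg).congr ?_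
  filter_upwards [hg'] with s hs using norm_toL2_sq hs

/-- A strong solution on `[0,τ]`, with its components as functions of time and space, as an
absolutely continuous path in `L²`; the regularity bound `C` is uniform in time. -/
structure IsStrongPath (μ C τ : ℝ) (u₀ : Fin d → Space d → ℝ) (E₀ : Fin d → Fin d → Space d → ℝ)
    (u ut : Fin d → ℝ → Space d → ℝ) (E Et : Fin d → Fin d → ℝ → Space d → ℝ) : Prop where
  ae_strong : ∀ᵐ s ∂(timeMeasure τ), IsStrongAt μ C (fun i => u i s) (fun i j => E i j s)
    (fun i => ut i s) (fun i j => Et i j s)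
  mem_u : ∀ i, MemLqH ⊤ τ 0 (u i)
  mem_E : ∀ i j, MemLqH ⊤ τ 0 (E i j)
  mem_ut : ∀ i, MemLqH 2 τ 0 (ut i)
  mem_Et : ∀ i j, MemLqH 2 τ 0 (Et i j)
  memLp_grad : ∀ i k, MemLp (fun s => toL2 (weakPartial k (u i s))) 2 (timeMeasure τ)
  memLp_u₀ : ∀ i, MemLp (u₀ i) 2 volume
  memLp_E₀ : ∀ i j, MemLp (E₀ i j) 2 volume
  memLp_u : ∀ t ∈ Icc 0 τ, ∀ i, MemLp (u i t) 2 volume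
  memLp_E : ∀ t ∈ Icc 0 τ, ∀ i j, MemLp (E i j t) 2 volume
  u_eq : ∀ t ∈ Icc 0 τ, (toV fun i => u i t) = toV u₀ + ∫ s in (0 : ℝ)..t, toV fun i => ut i s
  E_eq : ∀ j, ∀ t ∈ Icc 0 τ, (toV fun i => E i j t) =
    (toV fun i => E₀ i j) + ∫ s in (0 : ℝ)..t, toV fun i => Et i j s

lemma MemH.memLp {m : ℕ} {f : Space d → ℝ} (h : MemH m f) : MemLp f 2 volume := by
  cases m with
  | zero => exact h
  | succ m => exact h.1

lemma toV_mem_Lsigma_of_memH {m : ℕ} {f : Fin d → Space d → ℝ} (hf : ∀ i, MemH (m + 1) (f i))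
    (h : ∀ᵐ x, ∑ i, weakPartial i (f i) x = 0) : toV f ∈ Lsigma d := by
  rw [mem_Lsigma_iff fun i => (hf i).memLp]
  intro φ hφ
  have hw : ∀ i, HasWeakPartial i (f i) (weakPartial i (f i)) := fun i => by
    obtain ⟨g, hg, _⟩ := (hf i).2 i
    exact hg.weakPartial
  simp only [(hw _).test hφ, Finset.sum_neg_distrib]
  rw [← integral_finsetSum _ fun i _ => hφ.integrable_mul (hw i).locallyIntegrable_deriv]
  rw [integral_eq_zero_of_ae, neg_zero]
  filter_upwards [h] with x hx
  rw [← Finset.sum_mul, hx, zero_mul]; rfl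

/-- A strong solution of Sobolev regularity at least three gives a path in the sense of
`IsStrongPath`: the bounds come from the Sobolev embedding, and the constraint on the columns of the
strain is propagated from the initial data. -/
theorem IsStrongSolution.exists_path (hd : d ≤ 3) {k : ℕ} (hk : 3 ≤ k) {μ τ S : ℝ} (hτ : τ ≤ S)
    {u₀ : Space d → Space d} {E₀ : Space d → Matrix (Fin d) (Fin d) ℝ}
    (hu₀ : ∀ i, MemH k (fun x => u₀ x i)) (hE₀ : ∀ i j, MemH k (fun x => E₀ x i j))
    (hE₀s : ∀ j, (toV fun i x => E₀ x i j) ∈ Lsigma d)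
    {u : ℝ → Space d → Space d} {E : ℝ → Space d → Matrix (Fin d) (Fin d) ℝ}
    (h : IsStrongSolution μ k S u₀ E₀ u E) :
    ∃ C, 0 ≤ C ∧ ∃ (ut : Fin d → ℝ → Space d → ℝ) (Et : Fin d → Fin d → ℝ → Space d → ℝ),
      IsStrongPath μ C τ (fun i x => u₀ x i) (fun i j x => E₀ x i j) (fun i t x => u t x i) ut
        (fun i j t x => E t x i j) Et := by
  obtain ⟨ut, p, hut, hu, hp, hmom⟩ := h.momentum
  obtain ⟨Et, hEt, hE, hst⟩ := h.strain
  have hle : timeMeasure τ ≤ timeMeasure S := Measure.restrict_mono (Ioo_subset_Ioo_right hτ) le_rfl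
  have hIcc : Icc (0 : ℝ) τ ⊆ Icc 0 S := Icc_subset_Icc_right hτ
  have hum : ∀ i, MemLqH ⊤ τ 3 (fun t x => u t x i) := fun i =>
    ((h.velocity_mem i).mono_order hk).mono_time hτ
  have hEm : ∀ i j, MemLqH ⊤ τ 3 (fun t x => E t x i j) := fun i j =>
    ((h.strain_mem i j).mono_order hk).mono_time hτ
  have hut' := fun i => (hut i).mono_time hτ
  have hEt' := fun i j => (hEt i j).mono_time hτ
  have hum2 : ∀ i, MemLqH 2 τ 1 (fun t x => u t x i) := fun i =>
    ((h.velocity_mem_succ i).mono_order (by omega)).mono_time hτ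
  choose A hA using fun i => exists_isRegular hd (hum i)
  choose B hB using fun i j => exists_isRegular hd (hEm i j)
  set C : ℝ := (∑ i, |A i|) + ∑ i, ∑ j, |B i j| with hC
  have hB0 : 0 ≤ ∑ i, ∑ j, |B i j| :=
    Finset.sum_nonneg fun i _ => Finset.sum_nonneg fun j _ => abs_nonneg _
  have hA0 : 0 ≤ ∑ i, |A i| := Finset.sum_nonneg fun i _ => abs_nonneg _
  have hAC : ∀ i, A i ≤ C := fun i => by
    have := Finset.single_le_sum (f := fun i => |A i|) (fun i _ => abs_nonneg _) (Finset.mem_univ i)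
    linarith [le_abs_self (A i)]
  have hBC : ∀ i j, B i j ≤ C := fun i j => by
    have h1 := Finset.single_le_sum (f := fun j => |B i j|) (fun j _ => abs_nonneg _)
      (Finset.mem_univ j)
    have h2 := Finset.single_le_sum (f := fun i => ∑ j, |B i j|)
      (fun i _ => Finset.sum_nonneg fun j _ => abs_nonneg _) (Finset.mem_univ i)
    linarith [le_abs_self (B i j)]
  have hu₀2 := fun i => (hu₀ i).memLp
  have hE₀2 := fun i j => (hE₀ i j).memLp
  have hu_eq : ∀ t ∈ Icc 0 τ, ∀ᵐ x, ∀ i, u t x i = u₀ x i + ∫ s in (0 : ℝ)..t, ut s x i :=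
    fun t ht => hu t (hIcc ht)
  have hE_eq : ∀ t ∈ Icc 0 τ, ∀ᵐ x, ∀ i j, E t x i j = E₀ x i j + ∫ s in (0 : ℝ)..t, Et s x i j :=
    fun t ht => hE t (hIcc ht)
  have hEp : ∀ j, ∀ t ∈ Icc 0 τ, (toV fun i x => E t x i j) =
      (toV fun i x => E₀ x i j) + ∫ s in (0 : ℝ)..t, toV fun i x => Et s x i j := fun j t ht =>
    toV_primitive (f := fun i t x => E t x i j) (f' := fun i t x => Et t x i j)
      (fun i => hE₀2 i j) (fun i => hEt' i j)
      (fun t ht => (hE_eq t ht).mono fun x hx i => hx i j) ht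
  have hreg : ∀ᵐ s ∂(timeMeasure τ), (∀ i, IsRegular C fun x => u s x i) ∧
      (∀ᵐ x, ∑ i, weakPartial i (fun x => u s x i) x = 0) ∧
      (∀ i j, IsRegular C fun x => E s x i j) ∧
      ∀ᵐ x, ∀ i j, Et s x i j + (∑ l, u s x l * weakPartial l (fun x => E s x i j) x) =
        weakPartial j (fun x => u s x i) x +
          ∑ l, weakPartial l (fun x => u s x i) x * E s x l j := by
    filter_upwards [ae_all_iff.2 hA, ae_all_iff.2 fun i => ae_all_iff.2 (hB i),
      ae_mono hle h.div_free, ae_mono hle hst] with s h1 h2 h3 h4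
    exact ⟨fun i => (h1 i).mono (hAC i), h3, fun i j => (h2 i j).mono (hBC i j), h4⟩
  have hdivE : ∀ j, ∀ᵐ s ∂(timeMeasure τ), ∀ᵐ x, ∑ i, weakPartial i (fun x => E s x i j) x = 0 :=
    fun j => strain_div_free (u := fun i t x => u t x i) (E := fun i j t x => E t x i j)
      (Et := fun i j t x => Et t x i j) (E₀ := fun i x => E₀ x i j) (j := j) (C := C)
      (fun i => (hum i).zero.1) (fun i => (hEm i j).mono_order (by norm_num)) hEt'
      (fun i => hE₀2 i j) (hE₀s j) (hEp j) hreg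
  refine ⟨C, by positivity, fun i t x => ut t x i, fun i j t x => Et t x i j, ?_, fun i => (hum i).zero,
    fun i j => (hEm i j).zero, hut', hEt', fun i k => ((hum2 i).memLp_toL2_weakPartial k).1,
    hu₀2, hE₀2, fun t ht i => ?_, fun t ht i j => ?_, fun t ht => ?_, hEp⟩
  · filter_upwards [hreg, ae_all_iff.2 hdivE, ae_all_iff.2 fun i => (hut' i).ae_memLp (by norm_num),
      ae_all_iff.2 fun i => ae_all_iff.2 fun j => (hEt' i j).ae_memLp (by norm_num),
      ae_mono hle hp, ae_mono hle hmom] with s h1 h2 h3 h4 h5 h6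
    exact ⟨h1.1, h1.2.2.1, h3, h4, h1.2.1, h2, ⟨p s, h5, by
      simpa only [Matrix.mul_apply, Matrix.transpose_apply] using h6⟩, h1.2.2.2⟩
  · exact (toL2_primitive (hu₀2 i) (hut' i)
      (fun t ht => (hu_eq t ht).mono fun x hx => hx i) ht).1
  · exact (toL2_primitive (hE₀2 i j) (hEt' i j)
      (fun t ht => (hE_eq t ht).mono fun x hx => hx i j) ht).1
  · exact toV_primitive (f := fun i t x => u t x i) (f' := fun i t x => ut t x i)
      hu₀2 hut' hu_eq ht

section
variable {μ C τ : ℝ} {u₀ : Fin d → Space d → ℝ} {E₀ : Fin d → Fin d → Space d → ℝ}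
    {u ut : Fin d → ℝ → Space d → ℝ} {E Et : Fin d → Fin d → ℝ → Space d → ℝ}

lemma isClosed_Lsigma : IsClosed (Lsigma d : Set (VL2 d)) :=
  Submodule.isClosed_orthogonal _

lemma IsStrongPath.continuousOn_u (h : IsStrongPath μ C τ u₀ E₀ u ut E Et) (hτ : 0 < τ) :
    ContinuousOn (fun t => toV fun i => u i t) (Icc 0 τ) :=
  (continuousOn_const.add (continuousOn_primitive hτ.le (integrable_toV h.mem_ut))).congr h.u_eq

lemma IsStrongPath.continuousOn_E (h : IsStrongPath μ C τ u₀ E₀ u ut E Et) (hτ : 0 < τ)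
    (j : Fin d) : ContinuousOn (fun t => toV fun i => E i j t) (Icc 0 τ) :=
  (continuousOn_const.add (continuousOn_primitive hτ.le
    (integrable_toV fun i => h.mem_Et i j))).congr (h.E_eq j)

/-- The velocity is solenoidal at every time, by continuity. -/
lemma IsStrongPath.u_mem_Lsigma (h : IsStrongPath μ C τ u₀ E₀ u ut E Et) (hτ : 0 < τ) {t : ℝ}
    (ht : t ∈ Icc 0 τ) : (toV fun i => u i t) ∈ Lsigma d :=
  mem_of_ae_mem_of_continuousOn hτ isClosed_Lsigma (h.continuousOn_u hτ)
    (h.ae_strong.mono fun _ hs => hs.mem_u) ht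

lemma integrable_dissipation {τ : ℝ} {u : Fin d → ℝ → Space d → ℝ}
    (h : ∀ i k, MemLp (fun s => toL2 (weakPartial k (u i s))) 2 (timeMeasure τ))
    (h' : ∀ᵐ s ∂(timeMeasure τ), ∀ i k, MemLp (weakPartial k (u i s)) 2 volume) :
    Integrable (fun s => ∑ i, ∑ k, ∫ x, weakPartial k (u i s) x ^ 2) (timeMeasure τ) :=
  integrable_finsetSum _ fun i _ => integrable_finsetSum _ fun k _ =>
    integrable_integral_sq (h i k) (h'.mono fun _ hs => hs i k)

/-- The energy equality for strong solutions. -/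
lemma IsStrongPath.energy (h : IsStrongPath μ C τ u₀ E₀ u ut E Et) (hτ : 0 < τ) {t : ℝ}
    (ht : t ∈ Icc 0 τ) : (∑ i, ∫ x, u i t x ^ 2) + (∑ i, ∑ j, ∫ x, E i j t x ^ 2) +
        2 * (μ * ∫ s in (0 : ℝ)..t, ∑ i, ∑ k, ∫ x, weakPartial k (u i s) x ^ 2) =
      (∑ i, ∫ x, u₀ i x ^ 2) + ∑ i, ∑ j, ∫ x, E₀ i j x ^ 2 := by
  have h00 : (0 : ℝ) ∈ Icc 0 τ := ⟨le_rfl, ht.1.trans ht.2⟩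
  have hsub : ∀ {s}, s ∈ Icc 0 t → s ∈ Icc 0 τ := fun hs => ⟨hs.1, hs.2.trans ht.2⟩
  have hu0 : (toV fun i => u i 0) = toV u₀ := by rw [h.u_eq 0 h00]; simp
  have hE0 : ∀ j, (toV fun i => E i j 0) = toV fun i => E₀ i j := fun j => by
    rw [h.E_eq j 0 h00]; simp
  have iu := intervalIntegrable_of_timeMeasure ht (integrable_toV h.mem_ut)
  have iE := fun j => intervalIntegrable_of_timeMeasure ht (integrable_toV fun i => h.mem_Et i j)
  have pu := inner_primitive (x := fun s => toV fun i => u i s) (y := fun s => toV fun i => u i s)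
    ht.1 iu iu (fun s hs => by rw [h.u_eq s (hsub hs), hu0])
    (fun s hs => by rw [h.u_eq s (hsub hs), hu0])
  have pE := fun j => inner_primitive (x := fun s => toV fun i => E i j s)
    (y := fun s => toV fun i => E i j s)
    ht.1 (iE j) (iE j) (fun s hs => by rw [h.E_eq j s (hsub hs), hE0])
    (fun s hs => by rw [h.E_eq j s (hsub hs), hE0])
  have hsub' : Icc 0 t ⊆ Icc 0 τ := fun s hs => hsub hs
  have ju := intervalIntegrable_inner ht.1 iu ((h.continuousOn_u hτ).mono hsub')
  have jE := fun j => intervalIntegrable_inner ht.1 (iE j) ((h.continuousOn_E hτ j).mono hsub')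
  have jS : IntervalIntegrable (fun s => ∑ j, inner ℝ (toV fun i => Et i j s)
      (toV fun i => E i j s)) volume 0 t := by
    simpa only [Finset.sum_fn] using IntervalIntegrable.sum Finset.univ fun j _ => jE j
  have key : (∫ s in (0 : ℝ)..t, inner ℝ (toV fun i => ut i s) (toV fun i => u i s)) +
      ∑ j, ∫ s in (0 : ℝ)..t, inner ℝ (toV fun i => Et i j s) (toV fun i => E i j s) =
      -(μ * ∫ s in (0 : ℝ)..t, ∑ i, ∑ k, ∫ x, weakPartial k (u i s) x ^ 2) := by
    rw [← intervalIntegral.integral_finsetSum fun j _ => jE j,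
      ← intervalIntegral.integral_add ju jS,
      ← intervalIntegral.integral_const_mul, ← intervalIntegral.integral_neg]
    refine intervalIntegral_congr_timeMeasure ht ?_
    filter_upwards [h.ae_strong] with s hs
    have := hs.energy
    rw [Finset.sum_comm (f := fun i j => ∫ x, E i j s x * Et i j s x)] at this
    simp only [← sq] at this
    rw [← this]
    simp only [inner_toV hs.mem_ut fun i => (hs.reg_u i).memLp,
      fun j => inner_toV (fun i => hs.mem_Et i j) fun i => (hs.reg_E i j).memLp, mul_comm]
  simp only [real_inner_comm (toV fun i => ut i _), real_inner_comm (toV fun i => Et i _ _),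
    ← two_mul, intervalIntegral.integral_const_mul, hu0, hE0] at pu pE
  have pE' := Finset.sum_congr rfl fun j (_ : j ∈ Finset.univ) => pE j
  simp only [Finset.sum_add_distrib, ← Finset.mul_sum] at pE'
  simp only [inner_toV (h.memLp_u t ht) (h.memLp_u t ht), inner_toV h.memLp_u₀ h.memLp_u₀] at pu
  simp only [inner_toV (fun i => h.memLp_E t ht i _) (fun i => h.memLp_E t ht i _),
    inner_toV (fun i => h.memLp_E₀ i _) (fun i => h.memLp_E₀ i _)] at pE'
  rw [Finset.sum_comm (f := fun j i => ∫ x, E i j t x * E i j t x),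
    Finset.sum_comm (f := fun j i => ∫ x, E₀ i j x * E₀ i j x)] at pE'
  simp only [← sq] at pu pE'
  linarith

end

/-! ### Weak solutions tested with fields that do not depend on time -/

/-- A test field that does not depend on time, with time derivative `0`. -/
lemma isTestField_const {T : ℝ} {v : Fin d → Space d → ℝ} (hv : ∀ i, IsTest (v i)) :
    IsTestField T (fun _ x => WithLp.toLp 2 fun i => v i x) (fun _ _ => 0) where
  contDiff t _ := contDiff_euclidean.2 fun i => (hv i).contDiff
  contDiff_deriv t _ := contDiff_const
  support := by
    refine ⟨⋃ i, tsupport (v i), isCompact_iUnion fun i => (hv i).compact, fun t _ x hx => ?_⟩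
    ext i
    simp only [mem_iUnion, not_exists] at hx
    exact image_eq_zero_of_notMem_tsupport (f := v i) (hx i)
  hasDeriv x t _ := hasDerivWithinAt_const _ _ _
  continuousOn n := by
    have h : ContDiff ℝ ∞ (fun x : Space d => (WithLp.toLp 2 fun i => v i x : Space d)) :=
      contDiff_euclidean.2 fun i => (hv i).contDiff
    exact ((h.continuous_iteratedFDeriv (m := n) (by exact_mod_cast le_top)).comp
      continuous_snd).continuousOn
  continuousOn_deriv n := by
    have h : ContDiff ℝ ∞ (fun _ : Space d => (0 : Space d)) := contDiff_const
    exact ((h.continuous_iteratedFDeriv (m := n) (by exact_mod_cast le_top)).comp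
      continuous_snd).continuousOn

lemma BddL1.integrable_test {T : ℝ} {f : ℝ → Space d → ℝ} (hf : BddL1 T f) {φ : Space d → ℝ}
    (hφ : IsTest φ) : Integrable (fun s => ∫ x, f s x * φ x) (timeMeasure T) := by
  obtain ⟨C, hC, hC'⟩ := hf.bound
  obtain ⟨A, hA, hA'⟩ := hφ.bounded
  have hm : AEStronglyMeasurable (fun p : ℝ × Space d => f p.1 p.2 * φ p.2)
    ((timeMeasure T).prod volume) := hf.aesm.mul hφ.continuous.aestronglyMeasurable.comp_snd
  refine Integrable.of_bound hm.integral_prod_right' (C * A) ?_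
  filter_upwards [hC'] with s hs
  refine (norm_integral_le_of_norm_le (hs.1.abs.mul_const A) (Eventually.of_forall fun x => ?_)).trans
    ?_
  · rw [norm_mul]
    exact mul_le_mul_of_nonneg_left (hA' x) (abs_nonneg _)
  · rw [integral_mul_const]
    exact mul_le_mul_of_nonneg_right hs.2 hA

lemma MemLqH.integrable_test {T : ℝ} {f : ℝ → Space d → ℝ} (hf : MemLqH 2 T 0 f) {φ : Space d → ℝ}
    (hφ : IsTest φ) : Integrable (fun s => ∫ x, f s x * φ x) (timeMeasure T) := by
  refine ((integrable_toL2 hf).inner_const (toL2 φ)).congr ?_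
  filter_upwards [hf.ae_memLp (by norm_num)] with s hs using inner_toL2 hs (hφ.memLp 2)

lemma MemLqH.neg {q : ℝ≥0∞} {T : ℝ} {f : ℝ → Space d → ℝ} (hf : MemLqH q T 0 f) :
    MemLqH q T 0 fun t x => - f t x := by
  refine ⟨hf.1.neg, ?_⟩
  have : (fun t => eLpNorm (fun x => - f t x) 2 volume) = fun t => eLpNorm (f t) 2 volume :=
    funext fun t => eLpNorm_neg (f t) 2 volume
  rw [this]; exact hf.2

/-- A finite energy weak solution on `(0,τ)`, with its components as functions of time and space,
jointly measurable representatives `G` of the velocity gradient, and the weak formulation for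
test fields that do not depend on time. The fluxes are split into a part bounded in `L¹` and a part
in `L²(0,τ; L²)`, as `pairing_identity` requires. -/
structure IsWeakPath (μ τ : ℝ) (u₀ : Fin d → Space d → ℝ) (E₀ : Fin d → Fin d → Space d → ℝ)
    (w : Fin d → ℝ → Space d → ℝ) (G F : Fin d → Fin d → ℝ → Space d → ℝ) : Prop where
  mem_w : ∀ i, MemLqH ⊤ τ 0 (w i)
  mem_F : ∀ i j, MemLqH ⊤ τ 0 (F i j)
  mem_G : ∀ i k, MemLqH 2 τ 0 (G i k)
  grad : ∀ᵐ s ∂(timeMeasure τ), ∀ i k, HasWeakPartial k (w i s) (G i k s)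
  memLp_w : ∀ t ∈ Icc 0 τ, ∀ i, MemLp (w i t) 2 volume
  memLp_F : ∀ t ∈ Icc 0 τ, ∀ i j, MemLp (F i j t) 2 volume
  sol_w : ∀ᵐ s ∂(timeMeasure τ), (toV fun i => w i s) ∈ Lsigma d
  momentum : ∀ v, IsSolTest v → ∀ t ∈ Icc 0 τ,
    (∑ i, ∫ x, w i t x * v i x) - ∑ i, ∫ x, u₀ i x * v i x =
      ∫ s in (0 : ℝ)..t, ∑ i, ∑ k,
        ((∫ x, (w i s x * w k s x + -∑ j, F i j s x * F k j s x) * partialD k (v i) x) +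
          ∫ x, (-F i k s x + -μ * G i k s x) * partialD k (v i) x)
  transport : ∀ j, ∀ v : Fin d → Space d → ℝ, (∀ i, IsTest (v i)) → ∀ t ∈ Icc 0 τ,
    (∑ i, ∫ x, F i j t x * v i x) - ∑ i, ∫ x, E₀ i j x * v i x =
      ∫ s in (0 : ℝ)..t, ∑ i, ∑ k,
        ((∫ x, (F i j s x * w k s x + -(w i s x * F k j s x)) * partialD k (v i) x) +
          ∫ x, (if k = j then -1 else 0) * w i s x * partialD k (v i) x)
  energy : ∀ᵐ t ∂(timeMeasure τ), (∑ i, ∫ x, w i t x ^ 2) + (∑ i, ∑ j, ∫ x, F i j t x ^ 2) +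
      2 * (μ * ∫ s in (0 : ℝ)..t, ∑ i, ∑ k, ∫ x, G i k s x ^ 2) ≤
    (∑ i, ∫ x, u₀ i x ^ 2) + ∑ i, ∑ j, ∫ x, E₀ i j x ^ 2

lemma energy_eq {u : Space d → Space d} {E : Space d → Matrix (Fin d) (Fin d) ℝ}
    (hu : ∀ i, MemLp (fun x => u x i) 2 volume) (hE : ∀ i j, MemLp (fun x => E x i j) 2 volume) :
    energy u E = (1 / 2) * ((∑ i, ∫ x, u x i ^ 2) + ∑ i, ∑ j, ∫ x, E x i j ^ 2) := by
  rw [energy, integral_finsetSum _ fun i _ => (hu i).integrable_sq,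
    integral_finsetSum _ fun i _ => integrable_finsetSum _ fun j _ => (hE i j).integrable_sq]
  simp only [integral_finsetSum _ fun j _ => (hE _ j).integrable_sq]

/-- A weak solution gives a path in the sense of `IsWeakPath`, on every smaller time interval. -/
theorem IsWeakSolution.exists_path {μ τ T : ℝ} (hτ : τ ≤ T)
    {u₀ : Space d → Space d} {E₀ : Space d → Matrix (Fin d) (Fin d) ℝ}
    (hu₀ : ∀ i, MemLp (fun x => u₀ x i) 2 volume)
    (hE₀ : ∀ i j, MemLp (fun x => E₀ x i j) 2 volume)
    {u : ℝ → Space d → Space d} {E : ℝ → Space d → Matrix (Fin d) (Fin d) ℝ}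
    (h : IsWeakSolution μ T u₀ E₀ u E) :
    ∃ G, IsWeakPath μ τ (fun i x => u₀ x i) (fun i j x => E₀ x i j) (fun i t x => u t x i) G
      (fun i j t x => E t x i j) := by
  choose G hG hGm using fun i k => (h.gradient_mem i).exists_partial k
  have hle : timeMeasure τ ≤ timeMeasure T := Measure.restrict_mono (Ioo_subset_Ioo_right hτ) le_rfl
  have hIcc : Icc (0 : ℝ) τ ⊆ Icc 0 T := Icc_subset_Icc_right hτ
  have hmem : ∀ᵐ s ∂(timeMeasure T), s ∈ Icc 0 T := by
    filter_upwards [ae_restrict_mem measurableSet_Ioo] with s hs using Ioo_subset_Icc_self hs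
  have hGw : ∀ᵐ s ∂(timeMeasure T), ∀ i k,
      weakPartial k (fun x => u s x i) =ᵐ[volume] G i k s := by
    filter_upwards [ae_all_iff.2 fun i => ae_all_iff.2 (hG i)] with s hs i k
    exact (hs i k).weakPartial_ae_eq
  have hG2 : ∀ᵐ s ∂(timeMeasure T), ∀ i k, MemLp (G i k s) 2 volume :=
    ae_all_iff.2 fun i => ae_all_iff.2 fun k => (hGm i k).ae_memLp (by norm_num)
  refine ⟨G, fun i => (h.velocity_mem i).mono_time hτ, fun i j => (h.strain_mem i j).mono_time hτ,
    fun i k => (hGm i k).mono_time hτ, ?_, fun t ht => h.velocity_memLp t (hIcc ht),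
    fun t ht => h.strain_memLp t (hIcc ht), ?_, fun v hv t ht => ?_, fun j v hv t ht => ?_, ?_⟩
  · exact ae_mono hle (ae_all_iff.2 fun i => ae_all_iff.2 (hG i))
  · refine ae_mono hle ?_
    filter_upwards [h.div_free, hmem] with s h1 h2
    exact (weaklyDivFree_iff (h.velocity_memLp s h2)).1 h1
  · have htT := hIcc ht
    have hvi := fun i k => (hv.test i).partialD k
    have hD := fun i k => (hvi i k).memLp 2
    have key := h.momentum _ _ (isTestField_const hv.test) (fun _ _ x => hv.div x) t htT
    simp only [PiLp.zero_apply, mul_zero, Finset.sum_const_zero, zero_add, Matrix.mul_apply,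
      Matrix.transpose_apply] at key
    rw [integral_finsetSum _ fun i _ => integrable_mul2 (h.velocity_memLp t htT i)
      ((hv.test i).memLp 2), integral_finsetSum _ fun i _ => integrable_mul2 (hu₀ i)
      ((hv.test i).memLp 2)] at key
    have hM : ∀ i k, BddL1 T fun s x => u s x i * u s x k + -∑ j, E s x i j * E s x k j :=
      fun i k => (BddL1.mul (h.velocity_mem i) (h.velocity_mem k)).add
        (BddL1.sum _ fun j _ => BddL1.mul (h.strain_mem i j) (h.strain_mem k j)).neg
    set A : ℝ → ℝ := fun s => ∑ i, ∑ k,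
      ∫ x, (u s x i * u s x k + -∑ j, E s x i j * E s x k j) * partialD k (v i) x with hA
    set B : ℝ → ℝ := fun s => ∑ i, ∑ k, ∫ x, -E s x i k * partialD k (v i) x with hB
    set D : ℝ → ℝ := fun s => ∑ i, ∑ k, ∫ x, G i k s x * partialD k (v i) x with hDd
    have iA : Integrable A (timeMeasure T) := integrable_finsetSum _ fun i _ =>
      integrable_finsetSum _ fun k _ => (hM i k).integrable_test (hvi i k)
    have iB : Integrable B (timeMeasure T) := integrable_finsetSum _ fun i _ =>
      integrable_finsetSum _ fun k _ =>
        (h.strain_mem i k).top_to_two.neg.integrable_test (hvi i k)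
    have iD : Integrable D (timeMeasure T) := integrable_finsetSum _ fun i _ =>
      integrable_finsetSum _ fun k _ => (hGm i k).integrable_test (hvi i k)
    choose K hK hK' using fun i k => (hM i k).bound
    have hMi : ∀ᵐ s ∂(timeMeasure T), ∀ i k, Integrable
        (fun x => (u s x i * u s x k + -∑ j, E s x i j * E s x k j) * partialD k (v i) x)
        volume := by
      filter_upwards [ae_all_iff.2 fun i => ae_all_iff.2 (hK' i)] with s hs i k
      exact (hvi i k).integrable_mul (hs i k).1.locallyIntegrable
    have e1 : ∫ s in (0 : ℝ)..t, ∫ x, ∑ i, ∑ k,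
        (u s x i * u s x k - (∑ j, E s x i j * E s x k j) - E s x i k) * partialD k (v i) x =
        ∫ s in (0 : ℝ)..t, (A s + B s) := by
      refine intervalIntegral_congr_timeMeasure htT ?_
      filter_upwards [hMi, hmem] with s h1 h2
      have h3 : ∀ i k, Integrable (fun x => -E s x i k * partialD k (v i) x) volume := fun i k =>
        integrable_mul2 (h.strain_memLp s h2 i k).neg (hD i k)
      simp only [hA, hB, ← Finset.sum_add_distrib]
      have h4 : ∀ i k, (fun x => (u s x i * u s x k - (∑ j, E s x i j * E s x k j) - E s x i k) *
          partialD k (v i) x) = fun x =>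
          (u s x i * u s x k + -∑ j, E s x i j * E s x k j) * partialD k (v i) x +
            -E s x i k * partialD k (v i) x := fun i k => by ext x; ring
      have h5 : ∀ i k, Integrable (fun x => (u s x i * u s x k - (∑ j, E s x i j * E s x k j) -
          E s x i k) * partialD k (v i) x) volume := fun i k => by
        rw [h4]; exact (h1 i k).add (h3 i k)
      rw [integral_finsetSum _ fun i _ => integrable_finsetSum _ fun k _ => h5 i k]
      refine Finset.sum_congr rfl fun i _ => ?_
      rw [integral_finsetSum _ fun k _ => h5 i k]
      refine Finset.sum_congr rfl fun k _ => ?_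
      rw [h4, integral_add (h1 i k) (h3 i k)]
    have e2 : ∫ s in (0 : ℝ)..t, ∫ x, ∑ i, ∑ k,
        weakPartial k (fun y => u s y i) x * partialD k (v i) x = ∫ s in (0 : ℝ)..t, D s := by
      refine intervalIntegral_congr_timeMeasure htT ?_
      filter_upwards [hGw, hG2] with s h1 h2
      have h3 : ∀ i k, Integrable (fun x => weakPartial k (fun y => u s y i) x * partialD k (v i) x)
          volume := fun i k => integrable_mul2 ((h2 i k).ae_eq (h1 i k).symm) (hD i k)
      rw [integral_finsetSum _ fun i _ => integrable_finsetSum _ fun k _ => h3 i k]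
      refine Finset.sum_congr rfl fun i _ => ?_
      rw [integral_finsetSum _ fun k _ => h3 i k]
      refine Finset.sum_congr rfl fun k _ => integral_congr_ae ?_
      filter_upwards [h1 i k] with x hx
      rw [hx]
    have iAB : Integrable (fun s => A s + B s) (timeMeasure T) := iA.add iB
    rw [key, e1, e2, ← intervalIntegral.integral_const_mul, ← intervalIntegral.integral_sub
      (intervalIntegrable_of_timeMeasure htT iAB)
      (intervalIntegrable_of_timeMeasure htT (iD.const_mul μ))]
    refine intervalIntegral_congr_timeMeasure htT ?_
    filter_upwards [hG2, hmem] with s h1 h2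
    simp only [hA, hB, hDd, Finset.mul_sum, ← Finset.sum_add_distrib, ← Finset.sum_sub_distrib]
    refine Finset.sum_congr rfl fun i _ => Finset.sum_congr rfl fun k _ => ?_
    have hEi : Integrable (fun x => -E s x i k * partialD k (v i) x) volume :=
      integrable_mul2 (h.strain_memLp s h2 i k).neg (hD i k)
    rw [add_sub_assoc, ← integral_const_mul, ← integral_sub hEi
      ((integrable_mul2 (h1 i k) (hD i k)).const_mul μ)]
    congr 2; ext x; ring
  · have htT := hIcc ht
    have hvi := fun i k => (hv i).partialD k
    have hD := fun i k => (hvi i k).memLp 2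
    have key := h.transport _ _ (isTestField_const hv) j t htT
    simp only [PiLp.zero_apply, mul_zero, Finset.sum_const_zero, zero_add] at key
    rw [integral_finsetSum _ fun i _ => integrable_mul2 (h.strain_memLp t htT i j)
      ((hv i).memLp 2), integral_finsetSum _ fun i _ => integrable_mul2 (hE₀ i j)
      ((hv i).memLp 2)] at key
    rw [key]
    refine intervalIntegral_congr_timeMeasure htT ?_
    filter_upwards [hmem] with s hs
    have hu := h.velocity_memLp s hs
    have hE := h.strain_memLp s hs
    have h1 : ∀ i k, Integrable (fun x => (E s x i j * u s x k - u s x i * E s x k j) *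
        partialD k (v i) x) volume := fun i k =>
      (hvi i k).integrable_mul ((integrable_mul2 (hE i j) (hu k)).sub
        (integrable_mul2 (hu i) (hE k j))).locallyIntegrable
    have h2 : ∀ i, Integrable (fun x => u s x i * partialD j (v i) x) volume := fun i =>
      integrable_mul2 (hu i) (hD i j)
    have h3 : ∀ i, ∑ k, ∫ x, (if k = j then -1 else 0) * u s x i * partialD k (v i) x =
        - ∫ x, u s x i * partialD j (v i) x := fun i => by
      rw [Finset.sum_eq_single j]
      · rw [← integral_neg]; congr 1; ext x; simp
      · intro k _ hk; simp [hk]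
      · simp
    simp only [Finset.sum_add_distrib, h3, ← sub_eq_add_neg, Finset.sum_sub_distrib]
    rw [integral_sub (integrable_finsetSum _ fun i _ => integrable_finsetSum _ fun k _ => h1 i k)
      (integrable_finsetSum _ fun i _ => h2 i),
      integral_finsetSum _ fun i _ => integrable_finsetSum _ fun k _ => h1 i k,
      integral_finsetSum _ fun i _ => h2 i]
    simp only [integral_finsetSum _ fun k _ => h1 _ k]
  · filter_upwards [ae_mono hle h.energy_le,
      (ae_restrict_mem measurableSet_Ioo : ∀ᵐ s ∂(timeMeasure τ), s ∈ Ioo 0 τ)] with t ht htm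
    have htT := hIcc (Ioo_subset_Icc_self htm)
    rw [energy_eq (h.velocity_memLp t htT) (h.strain_memLp t htT), energy_eq hu₀ hE₀] at ht
    have e2 : ∫ s in (0 : ℝ)..t, ∫ x, ∑ i, ∑ k, weakPartial k (fun y => u s y i) x ^ 2 =
        ∫ s in (0 : ℝ)..t, ∑ i, ∑ k, ∫ x, G i k s x ^ 2 := by
      refine intervalIntegral_congr_timeMeasure htT ?_
      filter_upwards [hGw, hG2] with s h1 h2
      have h3 : ∀ i k, Integrable (fun x => weakPartial k (fun y => u s y i) x ^ 2)
          volume := fun i k => ((h2 i k).ae_eq (h1 i k).symm).integrable_sq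
      rw [integral_finsetSum _ fun i _ => integrable_finsetSum _ fun k _ => h3 i k]
      refine Finset.sum_congr rfl fun i _ => ?_
      rw [integral_finsetSum _ fun k _ => h3 i k]
      refine Finset.sum_congr rfl fun k _ => integral_congr_ae ?_
      filter_upwards [h1 i k] with x hx
      rw [hx]
    rw [e2] at ht
    linarith

section
variable {μ τ : ℝ} {u₀ : Fin d → Space d → ℝ} {E₀ : Fin d → Fin d → Space d → ℝ}
    {w : Fin d → ℝ → Space d → ℝ} {G F : Fin d → Fin d → ℝ → Space d → ℝ}

/-- The columns of the strain of a weak solution are solenoidal at every time: for a gradient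
field `∇φ`, the terms of the transport equation cancel by skew-symmetry. -/
lemma IsWeakPath.sol_F (h : IsWeakPath μ τ u₀ E₀ w G F) (hE₀ : ∀ i j, MemLp (E₀ i j) 2 volume)
    (j : Fin d) (hE₀s : (toV fun i => E₀ i j) ∈ Lsigma d) {t : ℝ} (ht : t ∈ Icc 0 τ) :
    (toV fun i => F i j t) ∈ Lsigma d := by
  rw [mem_Lsigma_iff fun i => h.memLp_F t ht i j]
  intro φ hφ
  have hφi := fun i => hφ.partialD i
  have key := h.transport j _ hφi t ht
  rw [(mem_Lsigma_iff fun i => hE₀ i j).1 hE₀s φ hφ, sub_zero] at key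
  rw [key]
  have hmem : ∀ᵐ s ∂(timeMeasure τ), s ∈ Icc 0 τ := by
    filter_upwards [ae_restrict_mem measurableSet_Ioo] with s hs using Ioo_subset_Icc_self hs
  refine (intervalIntegral_congr_timeMeasure (G := fun _ => (0 : ℝ)) ht ?_).trans (by simp)
  filter_upwards [h.sol_w, hmem] with s h1 hs
  have hw := h.memLp_w s hs
  have hF := h.memLp_F s hs
  have h2 : ∀ i, ∑ k, ∫ x, (if k = j then -1 else 0) * w i s x * partialD k (partialD i φ) x =
      - ∫ x, w i s x * partialD i (partialD j φ) x := fun i => by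
    rw [Finset.sum_eq_single j]
    · rw [← integral_neg]; congr 1; ext x; simp [partialD_comm hφ.1 j i]
    · intro k _ hk; simp [hk]
    · simp
  have i1 : ∀ i k l m n, Integrable (fun x => F i k s x * w l s x * partialD m (partialD n φ) x)
      volume := fun i k l m n => ((hφi n).partialD m).integrable_mul
        (integrable_mul2 (hF i k) (hw l)).locallyIntegrable
  have h3 : ∀ i k, ∫ x, (F i j s x * w k s x + -(w i s x * F k j s x)) *
      partialD k (partialD i φ) x = (∫ x, F i j s x * w k s x * partialD k (partialD i φ) x) -
        ∫ x, F k j s x * w i s x * partialD i (partialD k φ) x := fun i k => by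
    rw [← integral_sub (i1 i j k k i) (i1 k j i i k)]
    congr 1; ext x
    rw [partialD_comm hφ.1 i k]; ring
  simp only [Finset.sum_add_distrib, h2, h3, Finset.sum_neg_distrib, Finset.sum_sub_distrib,
    (mem_Lsigma_iff hw).1 h1 _ (hφi j)]
  rw [Finset.sum_comm]
  simp

end

/-! ### Comparison of weak and strong solutions -/

section
variable {q : ℝ≥0∞} {T : ℝ} {f g : ℝ → Space d → ℝ}

lemma memLqH_of_toL2 (hm : AEStronglyMeasurable (uncurry f) ((timeMeasure T).prod volume))
    (h : ∀ᵐ t ∂(timeMeasure T), MemLp (f t) 2 volume)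
    (h2 : MemLp (fun t => toL2 (f t)) q (timeMeasure T)) : MemLqH q T 0 f := by
  refine ⟨hm, lt_of_le_of_lt (le_of_eq ?_) h2.2⟩
  apply eLpNorm_congr_enorm_ae
  filter_upwards [h] with t ht
  rw [toL2_eq ht, Lp.enorm_toLp]; rfl

lemma MemLqH.add (hq : 1 ≤ q) (hf : MemLqH q T 0 f) (hg : MemLqH q T 0 g) :
    MemLqH q T 0 fun t x => f t x + g t x := by
  have h1 := hf.ae_memLp hq
  have h2 := hg.ae_memLp hq
  refine memLqH_of_toL2 (hf.1.add hg.1) ?_ (((hf.memLp_toL2 hq).add (hg.memLp_toL2 hq)).ae_eq ?_)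
  · filter_upwards [h1, h2] with t a b using a.add b
  · filter_upwards [h1, h2] with t a b using (toL2_add a b).symm

lemma MemLqH.const_mul (hq : 1 ≤ q) (hf : MemLqH q T 0 f) (c : ℝ) :
    MemLqH q T 0 fun t x => c * f t x := by
  have h1 := hf.ae_memLp hq
  refine memLqH_of_toL2 (hf.1.const_mul c) ?_ (((hf.memLp_toL2 hq).const_smul c).ae_eq ?_)
  · filter_upwards [h1] with t a using a.const_mul c
  · filter_upwards [h1] with t a using (toL2_const_mul a c).symm

end

section
variable {μ C τ : ℝ} {u₀ : Fin d → Space d → ℝ} {E₀ : Fin d → Fin d → Space d → ℝ}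
    {w : Fin d → ℝ → Space d → ℝ} {G F : Fin d → Fin d → ℝ → Space d → ℝ}
    {u ut : Fin d → ℝ → Space d → ℝ} {E Et : Fin d → Fin d → ℝ → Space d → ℝ}

lemma IsWeakPath.bddL1_momentum (h : IsWeakPath μ τ u₀ E₀ w G F) (i k : Fin d) :
    BddL1 τ fun s x => w i s x * w k s x + -∑ j, F i j s x * F k j s x :=
  (BddL1.mul (h.mem_w i) (h.mem_w k)).add
    (BddL1.sum _ fun j _ => BddL1.mul (h.mem_F i j) (h.mem_F k j)).neg

lemma IsWeakPath.memLqH_momentum (h : IsWeakPath μ τ u₀ E₀ w G F) (i k : Fin d) :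
    MemLqH 2 τ 0 fun s x => -F i k s x + -μ * G i k s x :=
  (h.mem_F i k).top_to_two.neg.add (by norm_num) ((h.mem_G i k).const_mul (by norm_num) _)

lemma IsWeakPath.bddL1_transport (h : IsWeakPath μ τ u₀ E₀ w G F) (j i k : Fin d) :
    BddL1 τ fun s x => F i j s x * w k s x + -(w i s x * F k j s x) :=
  (BddL1.mul (h.mem_F i j) (h.mem_w k)).add (BddL1.mul (h.mem_w i) (h.mem_F k j)).neg

lemma IsWeakPath.memLqH_transport (h : IsWeakPath μ τ u₀ E₀ w G F) (j i k : Fin d) :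
    MemLqH 2 τ 0 fun s x => (if k = j then -1 else 0) * w i s x :=
  (h.mem_w i).top_to_two.const_mul (by norm_num) _

lemma gap_nonneg {u w : Fin d → Space d → ℝ} {E F : Fin d → Fin d → Space d → ℝ} (x : Space d) :
    0 ≤ gap u E w F x :=
  add_nonneg (Finset.sum_nonneg fun _ _ => sq_nonneg _)
    (Finset.sum_nonneg fun _ _ => Finset.sum_nonneg fun _ _ => sq_nonneg _)

lemma integral_gap_eq {u w : Fin d → Space d → ℝ} {E F : Fin d → Fin d → Space d → ℝ}
    (hu : ∀ i, MemLp (u i) 2 volume) (hE : ∀ i j, MemLp (E i j) 2 volume)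
    (hw : ∀ i, MemLp (w i) 2 volume) (hF : ∀ i j, MemLp (F i j) 2 volume) :
    ∫ x, gap u E w F x = (∑ i, ∫ x, (w i x - u i x) ^ 2) +
      ∑ i, ∑ j, ∫ x, (F i j x - E i j x) ^ 2 := by
  have h1 : ∀ i, Integrable (fun x => (w i x - u i x) ^ 2) volume := fun i =>
    ((hw i).sub (hu i)).integrable_sq
  have h2 : ∀ i j, Integrable (fun x => (F i j x - E i j x) ^ 2) volume := fun i j =>
    ((hF i j).sub (hE i j)).integrable_sq
  simp only [gap]
  rw [integral_add (integrable_finsetSum _ fun i _ => h1 i)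
    (integrable_finsetSum _ fun i _ => integrable_finsetSum _ fun j _ => h2 i j),
    integral_finsetSum _ fun i _ => h1 i,
    integral_finsetSum _ fun i _ => integrable_finsetSum _ fun j _ => h2 i j]
  simp only [integral_finsetSum _ fun j _ => h2 _ j]

lemma integral_sub_sq {f g : Space d → ℝ} (hf : MemLp f 2 volume) (hg : MemLp g 2 volume) :
    ∫ x, (f x - g x) ^ 2 = (∫ x, f x ^ 2) + (∫ x, g x ^ 2) - 2 * ∫ x, f x * g x := by
  have h1 : Integrable (fun x => f x ^ 2 + g x ^ 2) volume := hf.integrable_sq.add hg.integrable_sq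
  rw [← integral_add hf.integrable_sq hg.integrable_sq, ← integral_const_mul,
    ← integral_sub h1 ((integrable_mul2 hf hg).const_mul 2)]
  congr 1; ext x; ring

/-- Weak and strong solutions coincide at almost every time: their squared distance in `L²`
satisfies the hypothesis of Gronwall's inequality, by the energy inequality, the energy equality and
the pairing identities. -/
theorem ae_eq_of_paths (hμ : 0 < μ) (hτ : 0 < τ) (hC : 0 ≤ C)
    (hw : IsWeakPath μ τ u₀ E₀ w G F) (hs : IsStrongPath μ C τ u₀ E₀ u ut E Et)
    (hE₀s : ∀ j, (toV fun i => E₀ i j) ∈ Lsigma d) :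
    ∀ᵐ t ∂(timeMeasure τ), (∀ i, w i t =ᵐ[volume] u i t) ∧ ∀ i j, F i j t =ᵐ[volume] E i j t := by
  have hmem : ∀ᵐ s ∂(timeMeasure τ), s ∈ Icc 0 τ := by
    filter_upwards [ae_restrict_mem measurableSet_Ioo] with s hs using Ioo_subset_Icc_self hs
  -- the pairing of the velocities
  obtain ⟨iL₁, hL₁⟩ := pairing_identity (u := u) (u' := ut) (u₀ := u₀)
    (Du := fun i k s => weakPartial k (u i s)) (C := C) isTestClass_leray hs.memLp_u₀ hw.mem_w
    hw.memLp_w hw.bddL1_momentum hw.memLqH_momentum hw.momentum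
    (hw.sol_w.mono fun s h => leray_eq_self_iff.2 h) hs.memLp_u₀ hs.mem_ut hs.memLp_u hs.u_eq
    (fun t ht => leray_eq_self_iff.2 (hs.u_mem_Lsigma hτ ht))
    (hs.ae_strong.mono fun s h i k => ⟨(h.reg_u i).weak k, (h.reg_u i).memLp_partial k,
      (h.reg_u i).bound_partial k, (h.reg_u i).norm_partial k⟩)
  -- the pairing of the columns of the strains
  have hcol := fun j => pairing_identity (u := fun i => E i j) (u' := fun i => Et i j)
    (u₀ := fun i => E₀ i j) (a := fun i => F i j)
    (Du := fun i k s => weakPartial k (E i j s)) (C := C) isTestClass_id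
    (fun i => hs.memLp_E₀ i j) (fun i => hw.mem_F i j)
    (fun t ht i => hw.memLp_F t ht i j) (hw.bddL1_transport j) (hw.memLqH_transport j)
    (hw.transport j) (Eventually.of_forall fun s => rfl) (fun i => hs.memLp_E₀ i j)
    (fun i => hs.mem_Et i j) (fun t ht i => hs.memLp_E t ht i j) (hs.E_eq j)
    (fun t ht => rfl)
    (hs.ae_strong.mono fun s h i k => ⟨(h.reg_E i j).weak k, (h.reg_E i j).memLp_partial k,
      (h.reg_E i j).bound_partial k, (h.reg_E i j).norm_partial k⟩)
  set L₁ : ℝ → ℝ := fun s => (∑ i, ∑ k,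
    ((∫ x, (w i s x * w k s x + -∑ j, F i j s x * F k j s x) * weakPartial k (u i s) x) +
      ∫ x, (-F i k s x + -μ * G i k s x) * weakPartial k (u i s) x)) +
        ∑ i, ∫ x, w i s x * ut i s x with hL₁d
  set L₂ : Fin d → ℝ → ℝ := fun j s => (∑ i, ∑ k,
    ((∫ x, (F i j s x * w k s x + -(w i s x * F k j s x)) * weakPartial k (E i j s) x) +
      ∫ x, (if k = j then -1 else 0) * w i s x * weakPartial k (E i j s) x)) +
        ∑ i, ∫ x, F i j s x * Et i j s x with hL₂d
  have iL₂ : ∀ j, Integrable (L₂ j) (timeMeasure τ) := fun j => (hcol j).1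
  have hL₂ : ∀ᵐ t ∂(timeMeasure τ), ∀ j, ∑ i, ∫ x, F i j t x * E i j t x =
      (∑ i, ∫ x, E₀ i j x * E₀ i j x) + ∫ s in (0 : ℝ)..t, L₂ j s :=
    ae_all_iff.2 fun j => (hcol j).2
  set DG : ℝ → ℝ := fun s => ∑ i, ∑ k, ∫ x, G i k s x ^ 2 with hDG
  set Du : ℝ → ℝ := fun s => ∑ i, ∑ k, ∫ x, weakPartial k (u i s) x ^ 2 with hDu
  have hG2 : ∀ᵐ s ∂(timeMeasure τ), ∀ i k, MemLp (G i k s) 2 volume :=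
    ae_all_iff.2 fun i => ae_all_iff.2 fun k => (hw.mem_G i k).ae_memLp (by norm_num)
  have iDG : Integrable DG (timeMeasure τ) :=
    integrable_finsetSum _ fun i _ => integrable_finsetSum _ fun k _ =>
      integrable_integral_sq ((hw.mem_G i k).memLp_toL2 (by norm_num)) (hG2.mono fun _ h => h i k)
  have iDu : Integrable Du (timeMeasure τ) := integrable_dissipation hs.memLp_grad
    (hs.ae_strong.mono fun s h i k => (h.reg_u i).memLp_partial k)
  -- the squared distance
  set y : ℝ → ℝ := fun s => ∫ x, gap (fun i => u i s) (fun i j => E i j s) (fun i => w i s)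
    (fun i j => F i j s) x with hy
  have hy_eq : ∀ s ∈ Icc 0 τ, y s = (∑ i, ∫ x, (w i s x - u i s x) ^ 2) +
      ∑ i, ∑ j, ∫ x, (F i j s x - E i j s x) ^ 2 := fun s hsm =>
    integral_gap_eq (hs.memLp_u s hsm) (hs.memLp_E s hsm) (hw.memLp_w s hsm) (hw.memLp_F s hsm)
  have mU : ∀ i, MemLqH ⊤ τ 0 fun s x => w i s x - u i s x := fun i => by
    simpa only [sub_eq_add_neg] using (hw.mem_w i).add le_top (hs.mem_u i).neg
  have mΦ : ∀ i j, MemLqH ⊤ τ 0 fun s x => F i j s x - E i j s x := fun i j => by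
    simpa only [sub_eq_add_neg] using (hw.mem_F i j).add le_top (hs.mem_E i j).neg
  have iy : Integrable y (timeMeasure τ) := by
    have isq : ∀ {f : ℝ → Space d → ℝ}, MemLqH ⊤ τ 0 f →
        Integrable (fun s => ∫ x, f s x ^ 2) (timeMeasure τ) := fun hf =>
      integrable_integral_sq (hf.top_to_two.memLp_toL2 (by norm_num)) (hf.ae_memLp le_top)
    refine Integrable.congr ((integrable_finsetSum Finset.univ fun i _ => isq (mU i)).add
      (integrable_finsetSum Finset.univ fun i _ => integrable_finsetSum Finset.univ fun j _ =>
        isq (mΦ i j))) ?_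
    filter_upwards [hmem] with s hsm using (hy_eq s hsm).symm
  obtain ⟨M, hM⟩ : ∃ M, ∀ᵐ s ∂(timeMeasure τ), y s ≤ M := by
    choose A hA0 hA using fun i => ae_norm_toL2_of_top (mU i)
    choose B hB0 hB using fun i j => ae_norm_toL2_of_top (mΦ i j)
    refine ⟨(∑ i, A i ^ 2) + ∑ i, ∑ j, B i j ^ 2, ?_⟩
    filter_upwards [hmem, ae_all_iff.2 hA, ae_all_iff.2 fun i => ae_all_iff.2 (hB i)]
      with s hsm h1 h2
    rw [hy_eq s hsm]
    refine add_le_add (Finset.sum_le_sum fun i _ => ?_)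
      (Finset.sum_le_sum fun i _ => Finset.sum_le_sum fun j _ => ?_)
    · have hm : MemLp (fun x => w i s x - u i s x) 2 volume :=
        (hw.memLp_w s hsm i).sub (hs.memLp_u s hsm i)
      rw [← norm_toL2_sq hm]
      exact pow_le_pow_left₀ (norm_nonneg _) (h1 i) 2
    · have hm : MemLp (fun x => F i j s x - E i j s x) 2 volume :=
        (hw.memLp_F s hsm i j).sub (hs.memLp_E s hsm i j)
      rw [← norm_toL2_sq hm]
      exact pow_le_pow_left₀ (norm_nonneg _) (h2 i j) 2
  set K : ℝ := (d ^ 2 + 3 * d ^ 3) * C with hK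
  have hcross : ∀ᵐ s ∂(timeMeasure τ), -(L₁ s + ∑ j, L₂ j s) - μ * DG s - μ * Du s ≤ K * y s := by
    filter_upwards [hs.ae_strong, hw.grad, hw.sol_w, hG2, hmem] with s h1 h2 h3 h4 hsm
    have := h1.cross_bound hμ.le (hw.memLp_w s hsm) (hw.memLp_F s hsm) h2 h4 h3
      fun j => hw.sol_F hs.memLp_E₀ j (hE₀s j) hsm
    linarith
  -- expand the square: energies of both solutions minus twice the pairings
  have hmain : ∀ᵐ t ∂(timeMeasure τ), y t ≤ 2 * K * ∫ s in (0 : ℝ)..t, y s := by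
    filter_upwards [hL₁, hL₂, hw.energy, hmem] with t h1 h2 h3 htm
    have h4 := hs.energy hτ htm
    have h2' := Finset.sum_congr rfl fun j (_ : j ∈ Finset.univ) => h2 j
    rw [Finset.sum_comm, Finset.sum_add_distrib,
      Finset.sum_comm (f := fun j i => ∫ x, E₀ i j x * E₀ i j x),
      ← intervalIntegral.integral_finsetSum fun j _ =>
        intervalIntegrable_of_timeMeasure htm (iL₂ j)] at h2'
    simp only [← sq] at h1 h2'
    have hI := fun {f : ℝ → ℝ} (hf : Integrable f (timeMeasure τ)) =>
      intervalIntegrable_of_timeMeasure htm hf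
    have iS : Integrable (fun s => ∑ j, L₂ j s) (timeMeasure τ) :=
      integrable_finsetSum _ fun j _ => iL₂ j
    have i12 : Integrable (fun s => L₁ s + ∑ j, L₂ j s) (timeMeasure τ) := iL₁.add iS
    have i12' : Integrable (fun s => -(L₁ s + ∑ j, L₂ j s)) (timeMeasure τ) := i12.neg
    have iN : Integrable (fun s => -(L₁ s + ∑ j, L₂ j s) - μ * DG s) (timeMeasure τ) :=
      i12'.sub (iDG.const_mul μ)
    have iR : Integrable (fun s => -(L₁ s + ∑ j, L₂ j s) - μ * DG s - μ * Du s)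
      (timeMeasure τ) := iN.sub (iDu.const_mul μ)
    have hle : ∫ s in (0 : ℝ)..t, (-(L₁ s + ∑ j, L₂ j s) - μ * DG s - μ * Du s) ≤
        ∫ s in (0 : ℝ)..t, K * y s := by
      refine intervalIntegral.integral_mono_ae_restrict htm.1 (hI iR) (hI (iy.const_mul K)) ?_
      rw [← restrict_Ioo_eq_restrict_Icc]
      exact ae_mono (Measure.restrict_mono (Ioo_subset_Ioo_right htm.2) le_rfl) hcross
    rw [intervalIntegral.integral_sub (hI iN) (hI (iDu.const_mul μ)),
      intervalIntegral.integral_sub (hI i12') (hI (iDG.const_mul μ)),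
      intervalIntegral.integral_neg, intervalIntegral.integral_add (hI iL₁) (hI iS),
      intervalIntegral.integral_const_mul, intervalIntegral.integral_const_mul,
      intervalIntegral.integral_const_mul] at hle
    rw [hy_eq t htm]
    simp only [integral_sub_sq (hw.memLp_w t htm _) (hs.memLp_u t htm _),
      integral_sub_sq (hw.memLp_F t htm _ _) (hs.memLp_E t htm _ _), Finset.sum_sub_distrib,
      Finset.sum_add_distrib, ← Finset.mul_sum]
    linarith
  have hK0 : 0 ≤ 2 * K := by positivity
  filter_upwards [gronwall_ae hK0 hM iy hmain, hmem] with t ht htm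
  have h0 : gap (fun i => u i t) (fun i j => E i j t) (fun i => w i t) (fun i j => F i j t)
      =ᵐ[volume] 0 := by
    rw [← integral_eq_zero_iff_of_nonneg (fun x => gap_nonneg x) (integrable_gap (hs.memLp_u t htm)
      (hs.memLp_E t htm) (hw.memLp_w t htm) (hw.memLp_F t htm))]
    exact le_antisymm ht (integral_nonneg fun x => gap_nonneg x)
  constructor
  · intro i
    filter_upwards [h0] with x hx
    have := gap_velocity (u := fun i => u i t) (E := fun i j => E i j t) (w := fun i => w i t)
      (F := fun i j => F i j t) i x
    rw [hx] at this
    exact sub_eq_zero.1 (pow_eq_zero_iff (two_ne_zero) |>.1 (le_antisymm this (sq_nonneg _)))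
  · intro i j
    filter_upwards [h0] with x hx
    have := gap_strain (u := fun i => u i t) (E := fun i j => E i j t) (w := fun i => w i t)
      (F := fun i j => F i j t) i j x
    rw [hx] at this
    exact sub_eq_zero.1 (pow_eq_zero_iff (two_ne_zero) |>.1 (le_antisymm this (sq_nonneg _)))

/-- Weak solutions are weakly continuous in time, up to the projection `P`; hence an identity
that holds for almost every time holds for every time. -/
lemma projection_eq_of_ae {P : VL2 d →L[ℝ] VL2 d} {𝒱 : (Fin d → Space d → ℝ) → Prop}
    (hP : IsTestClass P 𝒱) (hτ : 0 < τ) {a b : Fin d → ℝ → Space d → ℝ}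
    {a₀ : Fin d → Space d → ℝ} {M₁ M₂ : Fin d → Fin d → ℝ → Space d → ℝ}
    (hat : ∀ t ∈ Icc 0 τ, ∀ i, MemLp (a i t) 2 volume)
    (hM₁ : ∀ i k, BddL1 τ (M₁ i k)) (hM₂ : ∀ i k, MemLqH 2 τ 0 (M₂ i k))
    (heq : ∀ v, 𝒱 v → ∀ t ∈ Icc 0 τ, (∑ i, ∫ x, a i t x * v i x) - ∑ i, ∫ x, a₀ i x * v i x =
      ∫ s in (0 : ℝ)..t, ∑ i, ∑ k, ((∫ x, M₁ i k s x * partialD k (v i) x) +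
        ∫ x, M₂ i k s x * partialD k (v i) x))
    (hb : ContinuousOn (fun t => toV fun i => b i t) (Icc 0 τ))
    (hab : ∀ᵐ t ∂(timeMeasure τ), ∀ i, a i t =ᵐ[volume] b i t) {t : ℝ} (ht : t ∈ Icc 0 τ) :
    P (toV fun i => a i t) = P (toV fun i => b i t) := by
  rw [← sub_eq_zero, ← map_sub]
  refine hP.eq_zero _ fun v hv => ?_
  have hvt := hP.test v hv
  have hv2 : ∀ i, MemLp (v i) 2 volume := fun i => (hvt i).memLp 2
  have hint : Integrable (fun s => ∑ i, ∑ k, ((∫ x, M₁ i k s x * partialD k (v i) x) +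
        ∫ x, M₂ i k s x * partialD k (v i) x)) (timeMeasure τ) :=
    integrable_finsetSum _ fun i _ => integrable_finsetSum _ fun k _ =>
      ((hM₁ i k).integrable_test ((hvt i).partialD k)).add
        ((hM₂ i k).integrable_test ((hvt i).partialD k))
  have hca : ContinuousOn (fun t => inner ℝ (toV fun i => a i t) (toV v)) (Icc 0 τ) := by
    refine ((continuousOn_const (c := ∑ i, ∫ x, a₀ i x * v i x)).add
      (continuousOn_primitive hτ.le hint)).congr fun s hs => ?_
    rw [inner_toV (hat s hs) hv2]
    simp only [Pi.add_apply]
    linarith [heq v hv s hs]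
  have hc := hca.sub (hb.inner (continuousOn_const (c := toV v)))
  have := mem_of_ae_mem_of_continuousOn hτ (isClosed_singleton (x := (0 : ℝ))) hc (by
    filter_upwards [hab] with s hs
    have e : (toV fun i => a i s) = toV fun i => b i s := by
      ext1 i; exact toL2_congr (hs i)
    simp [e]) ht
  rw [inner_sub_left]
  exact this

end

end Viscoelastic

theorem theorem2p2 (d : ℕ) (hd : d = 2 ∨ d = 3) (k : ℕ) (hk : 3 ≤ k) (μ : ℝ) (hμ : 0 < μ)
    (u₀ : Viscoelastic.Space d → Viscoelastic.Space d)
    (E₀ : Viscoelastic.Space d → Matrix (Fin d) (Fin d) ℝ)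
    (hu₀ : ∀ i, Viscoelastic.MemH k (fun x => u₀ x i))
    (hE₀ : ∀ i j, Viscoelastic.MemH k (fun x => E₀ x i j))
    (hdata : Viscoelastic.IsAdmissibleData u₀ E₀)
    (T S : ℝ) (hT : 0 < T) (hS : 0 < S)
    (uw : ℝ → Viscoelastic.Space d → Viscoelastic.Space d)
    (Ew : ℝ → Viscoelastic.Space d → Matrix (Fin d) (Fin d) ℝ)
    (hweak : Viscoelastic.IsWeakSolution μ T u₀ E₀ uw Ew)
    (u : ℝ → Viscoelastic.Space d → Viscoelastic.Space d)
    (E : ℝ → Viscoelastic.Space d → Matrix (Fin d) (Fin d) ℝ)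
    (hstrong : Viscoelastic.IsStrongSolution μ k S u₀ E₀ u E) :
    (∀ᵐ t ∂(volume.restrict (Ioo 0 (min T S))), uw t =ᵐ[volume] u t) ∧
    ∀ t ∈ Icc 0 (min T S), Ew t =ᵐ[volume] E t ∧
      (Viscoelastic.WeaklyDivFree (uw t) → uw t =ᵐ[volume] u t) := by
  have hτ : 0 < min T S := lt_min hT hS
  have hE₀s : ∀ j, (Viscoelastic.toV fun i x => E₀ x i j) ∈ Viscoelastic.Lsigma d := fun j =>
    Viscoelastic.toV_mem_Lsigma_of_memH (m := k - 1)
      (fun i => by rw [Nat.sub_add_cancel (by omega)]; exact hE₀ i j) (hdata.div_transpose j)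
  obtain ⟨C, hC, ut, Et, hs⟩ := hstrong.exists_path (by omega) hk (min_le_right T S) hu₀ hE₀ hE₀s
  obtain ⟨G, hw⟩ := hweak.exists_path (min_le_left T S) (fun i => (hu₀ i).memLp)
    (fun i j => (hE₀ i j).memLp)
  have hae := Viscoelastic.ae_eq_of_paths hμ hτ hC hw hs hE₀s
  have hvec : ∀ {f g : Viscoelastic.Space d → Viscoelastic.Space d},
      (∀ i, (fun x => f x i) =ᵐ[volume] fun x => g x i) → f =ᵐ[volume] g := fun {f g} h => by
    filter_upwards [ae_all_iff.2 h] with x hx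
    ext i; exact hx i
  refine ⟨hae.mono fun t ht => hvec ht.1, fun t ht => ⟨?_, fun hdiv => hvec fun i => ?_⟩⟩
  · have hcol : ∀ i j, (fun x => Ew t x i j) =ᵐ[volume] fun x => E t x i j := fun i j => by
      have e := Viscoelastic.projection_eq_of_ae (a := fun i t x => Ew t x i j)
        Viscoelastic.isTestClass_id hτ
        (fun t ht i => hw.memLp_F t ht i j) (hw.bddL1_transport j) (hw.memLqH_transport j)
        (hw.transport j) (hs.continuousOn_E hτ j) (hae.mono fun t h i => h.2 i j) ht
      exact Viscoelastic.toL2_inj (hw.memLp_F t ht i j) (hs.memLp_E t ht i j)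
        (congrArg (fun V : Viscoelastic.VL2 d => V i) e)
    filter_upwards [ae_all_iff.2 fun i => ae_all_iff.2 (hcol i)] with x hx
    ext i j; exact hx i j
  · have e := Viscoelastic.projection_eq_of_ae Viscoelastic.isTestClass_leray hτ hw.memLp_w
      hw.bddL1_momentum hw.memLqH_momentum hw.momentum (hs.continuousOn_u hτ)
      (hae.mono fun t h => h.1) ht
    rw [Viscoelastic.leray_eq_self_iff.2 (hs.u_mem_Lsigma hτ ht), Viscoelastic.leray_eq_self_iff.2
      ((Viscoelastic.weaklyDivFree_iff (hw.memLp_w t ht)).1 hdiv)] at e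
    exact Viscoelastic.toL2_inj (hw.memLp_w t ht i) (hs.memLp_u t ht i)
      (congrArg (fun V : Viscoelastic.VL2 d => V i) e)
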